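/- For $\Delta\in\mathbb N$ put $n=\Delta^2$ and identify $\mathbb R^n$ with the set of functions $[\Delta]^2\to\mathbb R$. For $x,y\ge 0$ with $\|x\|_1=\|y\|_1$ let $\mathrm{EMD}^*(x,y)$ be the minimum of $\sum_{i,j}\gamma(i,j)\|i-j\|_1$ over all flows $\gamma\ge0$ with $\sum_l\gamma(i,l)=x_i$ and $\sum_l\gamma(l,j)=y_j$; for $w\in\mathbb R^n$ let $$\|w\|_{EMD}=\min\{\mathrm{EMD}^*(x,y)+2\Delta\|z\|_1 : x-y+z=w,\ x,y\ge 0,\ \|x\|_1=\|y\|_1\}.$$ **Theorem.** There are a program of the real RAM (registers hold exact real numbers or natural-number indices; every arithmetic operation, comparison and memory access costs one step; no rounding operation and no real constants), constants $C_1,C_2$, $c,d\in\mathbb N$, and for every $a\in\mathbb N$ a constant $T_a$, such that for all $\Delta$, all $k\ge1$ with $k<n/2$ and all $0<\epsilon\le1$ there are a number $m$ and an $m\times n$ integer matrix $A$ with entries of absolute value at most $n^{d}$ such that the following hold. 1. $m\le C_1\,\epsilon^{-2}k\log(n/k)$. 2. (EMD/EMD recovery.) There is a map $R:\mathbb R^m\to\mathbb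 R^n$ such that for every $x\in\mathbb R_+^n$ the vector $x^*=R(Ax)$ satisfies $$\|x-x^*\|_{EMD}\le C_2\,\epsilon\sqrt{\log(n/k)}\,\min_{k\text{-sparse }x'}\|x-x'\|_{EMD}.$$ 3. (Recovery time.) For every $a\in\mathbb N$ and every $x$ whose coefficients are non-negative integers bounded by $n^{a}$, the program, on input $\Delta,k,m,\epsilon,A$ and $Ax$, halts after at most $T_a\,(\epsilon^{-2}k)^2\,n\log^{c}n$ steps with an output $x^*$ that satisfies the same inequality. (For constant $\epsilon$ this is $O(k^2n\log^c n)$.) -/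

import Mathlib

namespace EMDRecovery

/-! ### Images and the Earth-Mover norm -/

/-- The pixels of a `Δ × Δ` image; a vector of `ℝ^n`, `n = Δ ^ 2`, is a function `Pixel Δ → ℝ`. -/
abbrev Pixel (Δ : ℕ) : Type := Fin Δ × Fin Δ

/-- The `ℓ₁` distance between two pixels. -/
noncomputable def pixelDist {Δ : ℕ} (p q : Pixel Δ) : ℝ :=
  |((p.1 : ℕ) : ℝ) - ((q.1 : ℕ) : ℝ)| + |((p.2 : ℕ) : ℝ) - ((q.2 : ℕ) : ℝ)|

/-- The `ℓ₁` norm. -/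
noncomputable def l1Norm {Δ : ℕ} (x : Pixel Δ → ℝ) : ℝ := ∑ p, |x p|

/-- `γ` is a flow from `x` to `y`. -/
def IsFlow {Δ : ℕ} (x y : Pixel Δ → ℝ) (γ : Pixel Δ → Pixel Δ → ℝ) : Prop :=
  (∀ p q, 0 ≤ γ p q) ∧ (∀ p, ∑ q, γ p q = x p) ∧ (∀ q, ∑ p, γ p q = y q)

/-- The cost of the cheapest flow from `x` to `y`; it is used only for `x, y ≥ 0` of equal mass,
where flows exist and the minimum is attained. -/
noncomputable def emdStar {Δ : ℕ} (x y : Pixel Δ → ℝ) : ℝ :=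
  sInf {v : ℝ | ∃ γ, IsFlow x y γ ∧ v = ∑ p, ∑ q, γ p q * pixelDist p q}

/-- The Earth-Mover norm of a signed vector: mass that is not transported is paid for at the price
`2 * Δ` per unit. -/
noncomputable def emdNorm {Δ : ℕ} (w : Pixel Δ → ℝ) : ℝ :=
  sInf {v : ℝ | ∃ x y z : Pixel Δ → ℝ, (∀ p, 0 ≤ x p) ∧ (∀ p, 0 ≤ y p) ∧ l1Norm x = l1Norm y ∧
    x - y + z = w ∧ v = emdStar x y + 2 * (Δ : ℝ) * l1Norm z}

/-- At most `k` coordinates of `x` are non-zero. -/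
def IsSparse {Δ : ℕ} (k : ℕ) (x : Pixel Δ → ℝ) : Prop := {p | x p ≠ 0}.ncard ≤ k

/-- `xs` approximates `x` within the factor `C` of the best `k`-sparse approximation of `x` in the
Earth-Mover norm, that is, `‖x - xs‖_EMD ≤ C * min_{x' k-sparse} ‖x - x'‖_EMD`. -/
def IsEMDApprox {Δ : ℕ} (C : ℝ) (k : ℕ) (x xs : Pixel Δ → ℝ) : Prop :=
  ∀ x' : Pixel Δ → ℝ, IsSparse k x' → emdNorm (x - xs) ≤ C * emdNorm (x - x')

/-- The sketch `A x` of a real vector `x` by an integer matrix `A`. -/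
noncomputable def sketch {Δ m : ℕ} (A : Matrix (Fin m) (Pixel Δ) ℤ) (x : Pixel Δ → ℝ) :
    Fin m → ℝ :=
  (A.map (fun z : ℤ => (z : ℝ))).mulVec x

/-! ### The real RAM

Programs work on finitely many arrays of natural numbers (indices, counters) and finitely many
arrays of real numbers. A program contains no real constants, and there is no rounding of reals to
integers. Every arithmetic operation, comparison, memory access, assignment and branching costs one
step. -/

/-- The memory: `idx a i` is cell `i` of the `a`-th array of natural numbers, `val a i` is cell `i`
of the `a`-th array of reals. -/
structure Store where
  idx : ℕ → ℕ → ℕ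
  val : ℕ → ℕ → ℝ

/-- Expressions for natural numbers (`sub` is truncated). -/
inductive IExp : Type
  | const (n : ℕ) : IExp
  | get (a : ℕ) (i : IExp) : IExp
  | add (e f : IExp) : IExp
  | sub (e f : IExp) : IExp
  | mul (e f : IExp) : IExp

/-- Expressions for real numbers (a quotient with denominator `0` has the value `0`). -/
inductive RExp : Type
  | ofIdx (e : IExp) : RExp
  | get (a : ℕ) (i : IExp) : RExp
  | add (e f : RExp) : RExp
  | sub (e f : RExp) : RExp
  | mul (e f : RExp) : RExp
  | div (e f : RExp) : RExp

/-- Tests: comparisons of two natural or of two real numbers. -/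
inductive Test : Type
  | idxLe (e f : IExp) : Test
  | idxLt (e f : IExp) : Test
  | valLe (e f : RExp) : Test
  | valLt (e f : RExp) : Test

/-- Programs. -/
inductive Prog : Type
  | skip : Prog
  | setIdx (a : ℕ) (i e : IExp) : Prog
  | setVal (a : ℕ) (i : IExp) (e : RExp) : Prog
  | seq (P Q : Prog) : Prog
  | cond (b : Test) (P Q : Prog) : Prog
  | loop (b : Test) (P : Prog) : Prog

def IExp.eval (s : Store) : IExp → ℕ
  | .const n => n
  | .get a i => s.idx a (i.eval s)
  | .add e f => e.eval s + f.eval s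
  | .sub e f => e.eval s - f.eval s
  | .mul e f => e.eval s * f.eval s

def IExp.cost : IExp → ℕ
  | .const _ => 1
  | .get _ i => 1 + i.cost
  | .add e f => 1 + e.cost + f.cost
  | .sub e f => 1 + e.cost + f.cost
  | .mul e f => 1 + e.cost + f.cost

noncomputable def RExp.eval (s : Store) : RExp → ℝ
  | .ofIdx e => (e.eval s : ℝ)
  | .get a i => s.val a (i.eval s)
  | .add e f => e.eval s + f.eval s
  | .sub e f => e.eval s - f.eval s
  | .mul e f => e.eval s * f.eval s
  | .div e f => e.eval s / f.eval s

def RExp.cost : RExp → ℕ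
  | .ofIdx e => 1 + e.cost
  | .get _ i => 1 + i.cost
  | .add e f => 1 + e.cost + f.cost
  | .sub e f => 1 + e.cost + f.cost
  | .mul e f => 1 + e.cost + f.cost
  | .div e f => 1 + e.cost + f.cost

def Test.Holds (s : Store) : Test → Prop
  | .idxLe e f => e.eval s ≤ f.eval s
  | .idxLt e f => e.eval s < f.eval s
  | .valLe e f => e.eval s ≤ f.eval s
  | .valLt e f => e.eval s < f.eval s

def Test.cost : Test → ℕ
  | .idxLe e f => 1 + e.cost + f.cost
  | .idxLt e f => 1 + e.cost + f.cost
  | .valLe e f => 1 + e.cost + f.cost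
  | .valLt e f => 1 + e.cost + f.cost

/-- Writing `v` into cell `i` of the `a`-th array of natural numbers. -/
def Store.writeIdx (s : Store) (a i v : ℕ) : Store :=
  { s with idx := Function.update s.idx a (Function.update (s.idx a) i v) }

/-- Writing `v` into cell `i` of the `a`-th array of reals. -/
noncomputable def Store.writeVal (s : Store) (a i : ℕ) (v : ℝ) : Store :=
  { s with val := Function.update s.val a (Function.update (s.val a) i v) }

/-- `Runs P s t s'`: started in `s`, the program `P` halts in `s'` after exactly `t` steps. -/
inductive Runs : Prog → Store → ℕ → Store → Prop
  | skip (s : Store) : Runs .skip s 1 s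
  | setIdx (a : ℕ) (i e : IExp) (s : Store) :
      Runs (.setIdx a i e) s (1 + i.cost + e.cost) (s.writeIdx a (i.eval s) (e.eval s))
  | setVal (a : ℕ) (i : IExp) (e : RExp) (s : Store) :
      Runs (.setVal a i e) s (1 + i.cost + e.cost) (s.writeVal a (i.eval s) (e.eval s))
  | seq {P Q : Prog} {s s' s'' : Store} {t u : ℕ} :
      Runs P s t s' → Runs Q s' u s'' → Runs (.seq P Q) s (t + u) s''
  | condTrue {b : Test} {P Q : Prog} {s s' : Store} {t : ℕ} :
      b.Holds s → Runs P s t s' → Runs (.cond b P Q) s (1 + b.cost + t) s'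
  | condFalse {b : Test} {P Q : Prog} {s s' : Store} {t : ℕ} :
      ¬ b.Holds s → Runs Q s t s' → Runs (.cond b P Q) s (1 + b.cost + t) s'
  | loopTrue {b : Test} {P : Prog} {s s' s'' : Store} {t u : ℕ} :
      b.Holds s → Runs P s t s' → Runs (.loop b P) s' u s'' →
      Runs (.loop b P) s (1 + b.cost + t + u) s''
  | loopFalse {b : Test} {P : Prog} {s : Store} :
      ¬ b.Holds s → Runs (.loop b P) s (1 + b.cost) s

/-- Programs are deterministic: the final store and the number of steps are determined. -/
theorem Runs.deterministic {P : Prog} {s s₁ s₂ : Store} {t₁ t₂ : ℕ}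
    (h₁ : Runs P s t₁ s₁) (h₂ : Runs P s t₂ s₂) : t₁ = t₂ ∧ s₁ = s₂ := by
  induction h₁ generalizing t₂ s₂ with
  | skip s => cases h₂; exact ⟨rfl, rfl⟩
  | setIdx a i e s => cases h₂; exact ⟨rfl, rfl⟩
  | setVal a i e s => cases h₂; exact ⟨rfl, rfl⟩
  | seq _ _ ih₁ ih₂ =>
    cases h₂ with
    | seq k₁ k₂ =>
      obtain ⟨rfl, rfl⟩ := ih₁ k₁
      obtain ⟨rfl, rfl⟩ := ih₂ k₂
      exact ⟨rfl, rfl⟩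
  | condTrue hb _ ih =>
    cases h₂ with
    | condTrue _ k => obtain ⟨rfl, rfl⟩ := ih k; exact ⟨rfl, rfl⟩
    | condFalse hb' _ => exact absurd hb hb'
  | condFalse hb _ ih =>
    cases h₂ with
    | condTrue hb' _ => exact absurd hb' hb
    | condFalse _ k => obtain ⟨rfl, rfl⟩ := ih k; exact ⟨rfl, rfl⟩
  | loopTrue hb _ _ ih₁ ih₂ =>
    cases h₂ with
    | loopTrue _ k₁ k₂ =>
      obtain ⟨rfl, rfl⟩ := ih₁ k₁
      obtain ⟨rfl, rfl⟩ := ih₂ k₂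
      exact ⟨rfl, rfl⟩
    | loopFalse hb' => exact absurd hb hb'
  | loopFalse hb =>
    cases h₂ with
    | loopTrue hb' _ _ => exact absurd hb' hb
    | loopFalse _ => exact ⟨rfl, rfl⟩

/-! ### Input and output of a recovery program -/

/-- A finite sequence as an array, continued by zeros. -/
noncomputable def toArray {N : ℕ} (f : Fin N → ℝ) (q : ℕ) : ℝ :=
  if h : q < N then f ⟨q, h⟩ else 0

/-- The initial store on input `Δ, k, m, ε`, a matrix `A` and a sketch `b`. The first array of
natural numbers holds `Δ, k, m`; the real arrays `0`, `1`, `2` hold `ε`, the matrix `A` (entry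
`(r, (i, j))` in cell `r * Δ ^ 2 + i * Δ + j`) and the sketch `b`. All other cells are `0`. -/
noncomputable def inputStore {Δ m : ℕ} (k : ℕ) (ε : ℝ) (A : Matrix (Fin m) (Pixel Δ) ℤ)
    (b : Fin m → ℝ) : Store where
  idx a i := if a = 0 then [Δ, k, m].getD i 0 else 0
  val a i :=
    if a = 0 then (if i = 0 then ε else 0)
    else if a = 1 then
      toArray (fun q : Fin (m * (Δ * Δ)) =>
        (A (finProdFinEquiv.symm q).1
          (finProdFinEquiv.symm (finProdFinEquiv.symm q).2) : ℝ)) i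
    else if a = 2 then toArray b i
    else 0

/-- The vector that a program leaves in the real array `3` (pixel `(i, j)` in cell
`i * Δ + j`). -/
def outputVector (Δ : ℕ) (s : Store) (p : Pixel Δ) : ℝ :=
  s.val 3 ((p.1 : ℕ) * Δ + (p.2 : ℕ))

end EMDRecovery

/-!
The nodes of a quadtree over the grid, refined to a binary heap by halving cells alternately in the two
directions, carry the mass of the image in their cell, weighted by the diameter of the cell up to a
constant. This pyramid turns the Earth-Mover norm into an `ℓ₁` norm: an image rebuilt from approximate
masses is as close to the image as the weighted masses are (`emdNorm_sub_rebuild_le`). Conversely, if the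
image is close to a vector supported on `k` pixels, then little mass lies far from these `k` centres
(`sum_mul_centreDist_le_emdNorm`). Hence, up to a factor `ε` of the best error, the pyramid lives on the
cells that are not too far, relative to their size, from a centre. With `O(k / ε ^ 2)` nodes on each
level these form a subtree containing the root, of size `s = O(ε⁻² k log (n / k))`, and since any few
heavy nodes outside may be joined to the root at the same cost, the remainder is also small after the
measurement (`exists_tree_approximation`).

There are only `4 ^ s` or so subtrees with `s` nodes (`card_heapTrees_le`), so no logarithmic factor is
lost in a union bound: a random sign matrix `B` with `O(s)` rows is almost isometric on all vectors
supported on a subtree (`exists_treeIsometry`). For this it is enough to test integer vectors of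
bounded norm (`almost_isometry_of_integer`), and a sign matrix fails on a single one with probability
exponentially small in `s`. The weights are integers, so the matrix that maps an image to `B` applied to
its pyramid has small integer entries.

Over the reals, least squares over all subtrees recovers the pyramid (`exists_leastSquares_recovery`).
The program instead runs iterative hard thresholding: a gradient step, followed by the projection to the
best subtree, which a dynamic program over pairs of a node and a budget finds in time `O(N s ^ 2)`
(`DPSpec.optimal`). Each step halves the error until the noise caused by the remainder dominates
(`IsThresholdingStep.norm_sub_le`), so that logarithmically many rounds suffice for coefficients that are
polynomially bounded. What is left of the initial error then matters only if the remainder vanishes. In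
that case the masses are integers, the iterate rounds to them, and comparing the sketch of the rounded
masses with the given one tells whether to use them (`IsRecovered.isEMDApprox`). The program needs to
know `B`, which the input gives it only through the matrix; therefore the matrix has additional rows that
list the entries of `B` (`measurementMatrix`).
-/

namespace EMDRecovery

/-! ### Concentration of random sign matrices -/

section

open Real

/-- The sign `±1` encoded by a Boolean. -/
def boolSign (b : Bool) : ℝ := if b then 1 else -1

/-- The Rademacher sum `∑ i, ± a i` for a choice `σ` of signs. -/
noncomputable def signSum {ι : Type*} [Fintype ι] (σ : ι → Bool) (a : ι → ℝ) : ℝ :=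
  ∑ i, boolSign (σ i) * a i

section Concentration

variable {ι : Type*} [Fintype ι] [DecidableEq ι]

/-- The moment generating function of a Rademacher sum, from `cosh t ≤ exp (t ^ 2 / 2)`. -/
lemma sum_exp_signSum_le (a : ι → ℝ) (ha : ∑ i, a i ^ 2 = 1) (g : ℝ) :
    ∑ σ : ι → Bool, exp (signSum σ a * g) ≤ 2 ^ Fintype.card ι * exp (g ^ 2 / 2) := by
  have h1 : ∀ σ : ι → Bool, exp (signSum σ a * g) = ∏ i, exp (boolSign (σ i) * a i * g) := by
    intro σ
    rw [← exp_sum, signSum, Finset.sum_mul]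
  have h2 := (Finset.prod_univ_sum (fun _ : ι => (Finset.univ : Finset Bool))
    (fun i b => exp (boolSign b * a i * g))).symm
  rw [Fintype.piFinset_univ] at h2
  simp_rw [h1]
  rw [h2]
  calc ∏ i, ∑ b : Bool, exp (boolSign b * a i * g)
      ≤ ∏ i : ι, (2 * exp ((a i * g) ^ 2 / 2)) := by
        refine Finset.prod_le_prod (fun i _ => Finset.sum_nonneg fun _ _ => (exp_pos _).le)
          fun i _ => ?_
        have := cosh_le_exp_half_sq (a i * g)
        rw [cosh_eq] at this
        simp only [Fintype.sum_bool, boolSign]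
        simp only [if_true, Bool.false_eq_true, if_false, one_mul, neg_mul]
        linarith
    _ = 2 ^ Fintype.card ι * exp (g ^ 2 / 2) := by
        rw [Finset.prod_mul_distrib, Finset.prod_const, Finset.card_univ, ← exp_sum]
        congr 2
        simp_rw [mul_pow]
        rw [← Finset.sum_div, ← Finset.sum_mul, ha, one_mul]

lemma integral_exp_linear_sub_sq (y : ℝ) :
    ∫ g : ℝ, exp (y * g - g ^ 2) = √π * exp (y ^ 2 / 4) := by
  have h1 : ∀ g : ℝ, exp (y * g - g ^ 2) = exp (-1 * (g - y / 2) ^ 2) * exp (y ^ 2 / 4) := by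
    intro g
    rw [← exp_add]
    ring_nf
  simp_rw [h1]
  rw [MeasureTheory.integral_mul_const,
    MeasureTheory.integral_sub_right_eq_self (fun g : ℝ => exp (-1 * g ^ 2)) (y / 2),
    integral_gaussian]
  simp

lemma integrable_exp_linear_sub_sq (y : ℝ) :
    MeasureTheory.Integrable (fun g : ℝ => exp (y * g - g ^ 2)) := by
  have h1 : ∀ g : ℝ, exp (y * g - g ^ 2) = exp (-1 * (g - y / 2) ^ 2) * exp (y ^ 2 / 4) := by
    intro g
    rw [← exp_add]
    ring_nf
  simp_rw [h1]
  exact ((integrable_exp_neg_mul_sq one_pos).comp_sub_right (y / 2)).mul_const _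

/-- The square of a Rademacher sum is subexponential: `exp (X ^ 2 / 4)` is a Gaussian average of
`exp (X * g)`, and the mean of the latter is at most `exp (g ^ 2 / 2)`. -/
lemma sum_exp_sq_signSum_le (a : ι → ℝ) (ha : ∑ i, a i ^ 2 = 1) :
    ∑ σ : ι → Bool, exp (signSum σ a ^ 2 / 4) ≤ √2 * 2 ^ Fintype.card ι := by
  have hπ : 0 < √π := sqrt_pos.mpr pi_pos
  have key : √π * ∑ σ : ι → Bool, exp (signSum σ a ^ 2 / 4)
      ≤ 2 ^ Fintype.card ι * √(π / (1 / 2)) := by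
    rw [Finset.mul_sum]
    simp_rw [← integral_exp_linear_sub_sq]
    rw [← MeasureTheory.integral_finsetSum _ fun σ _ => integrable_exp_linear_sub_sq _,
      ← integral_gaussian, ← MeasureTheory.integral_const_mul]
    refine MeasureTheory.integral_mono
      (MeasureTheory.integrable_finsetSum _ fun σ _ => integrable_exp_linear_sub_sq _)
      ((integrable_exp_neg_mul_sq (by norm_num)).const_mul _) fun g => ?_
    have h := sum_exp_signSum_le a ha g
    calc ∑ σ : ι → Bool, exp (signSum σ a * g - g ^ 2)
        = (∑ σ : ι → Bool, exp (signSum σ a * g)) * exp (-g ^ 2) := by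
          rw [Finset.sum_mul]
          refine Finset.sum_congr rfl fun σ _ => ?_
          rw [← exp_add]; ring_nf
      _ ≤ (2 ^ Fintype.card ι * exp (g ^ 2 / 2)) * exp (-g ^ 2) :=
          mul_le_mul_of_nonneg_right h (exp_pos _).le
      _ = _ := by
          rw [mul_assoc, ← exp_add]; ring_nf
  have h2 : √(π / (1 / 2)) = √π * √2 := by
    rw [← sqrt_mul pi_pos.le]; congr 1; ring
  rw [h2] at key
  have : √π * ∑ σ : ι → Bool, exp (signSum σ a ^ 2 / 4) ≤ √π * (√2 * 2 ^ Fintype.card ι) := by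
    linarith
  exact le_of_mul_le_mul_left this hπ

lemma sum_sq_signSum (a : ι → ℝ) (ha : ∑ i, a i ^ 2 = 1) :
    ∑ σ : ι → Bool, signSum σ a ^ 2 = 2 ^ Fintype.card ι := by
  have h0 : ∀ i j : ι, ∑ σ : ι → Bool, boolSign (σ i) * boolSign (σ j)
      = if i = j then 2 ^ Fintype.card ι else 0 := by
    intro i j
    split_ifs with hij
    · subst hij
      have : ∀ b : Bool, boolSign b * boolSign b = 1 := by
        intro b; cases b <;> simp [boolSign]
      simp [this]
    -- flipping the `i`-th sign pairs the sign vectors so that the summands cancel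
    · have hinv : Function.Involutive
          (fun σ : ι → Bool => Function.update σ i (!σ i)) := by
        intro σ
        ext k
        by_cases hk : k = i
        · subst hk; simp
        · simp [hk]
      have h := Equiv.sum_comp (Function.Involutive.toPerm _ hinv)
        (fun σ : ι → Bool => boolSign (σ i) * boolSign (σ j))
      have h' : ∀ σ : ι → Bool, boolSign (Function.Involutive.toPerm _ hinv σ i)
            * boolSign (Function.Involutive.toPerm _ hinv σ j)
          = -(boolSign (σ i) * boolSign (σ j)) := by
        intro σ
        have hb : ∀ b : Bool, boolSign (!b) = - boolSign b := by
          intro b; cases b <;> simp [boolSign]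
        simp [Function.Involutive.toPerm, Ne.symm hij, hb]
      simp only [h', Finset.sum_neg_distrib] at h
      linarith
  have h1 : ∀ σ : ι → Bool, signSum σ a ^ 2
      = ∑ i, ∑ j, (a i * a j) * (boolSign (σ i) * boolSign (σ j)) := by
    intro σ
    rw [signSum, sq, Finset.sum_mul_sum]
    refine Finset.sum_congr rfl fun i _ => Finset.sum_congr rfl fun j _ => by ring
  simp_rw [h1]
  rw [Finset.sum_comm]
  simp_rw [Finset.sum_comm (s := (Finset.univ : Finset (ι → Bool))), ← Finset.mul_sum, h0]
  simp only [mul_ite, mul_zero, Finset.sum_ite_eq, Finset.mem_univ, if_true]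
  rw [← Finset.sum_mul]
  simp_rw [← sq]
  rw [ha, one_mul]

/-- A Taylor bound of the exponential for the square of a subexponential variable. The linear term is
kept, since it has the expectation `l`; the remainder is absorbed by `exp (x ^ 2 / 4)`. -/
lemma exp_mul_sq_le (l x : ℝ) (hl : |l| ≤ 1 / 8) :
    exp (l * x ^ 2) ≤ 1 + l * x ^ 2 + l ^ 2 * (128 * exp (x ^ 2 / 4)) := by
  have h1 := Complex.norm_exp_sub_sum_le_norm_mul_exp ((l * x ^ 2 : ℝ) : ℂ) 2
  have h2 : |exp (l * x ^ 2) - (1 + l * x ^ 2)| ≤ |l * x ^ 2| ^ 2 * exp |l * x ^ 2| := by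
    have e : Complex.exp ((l * x ^ 2 : ℝ) : ℂ)
        - ∑ m ∈ Finset.range 2, ((l * x ^ 2 : ℝ) : ℂ) ^ m / (m.factorial : ℂ)
        = ((exp (l * x ^ 2) - (1 + l * x ^ 2) : ℝ) : ℂ) := by
      simp [Finset.sum_range_succ]
    rw [e, Complex.norm_real, Complex.norm_real, Real.norm_eq_abs, Real.norm_eq_abs] at h1
    exact h1
  have h3 : |l * x ^ 2| ≤ x ^ 2 / 8 := by
    rw [abs_mul, abs_of_nonneg (sq_nonneg x)]
    nlinarith [sq_nonneg x]
  have h4 : |l * x ^ 2| ^ 2 = l ^ 2 * x ^ 4 := by rw [sq_abs]; ring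
  have h5 : x ^ 4 ≤ 128 * exp (x ^ 2 / 8) := by
    have := quadratic_le_exp_of_nonneg (x := x ^ 2 / 8) (by positivity)
    nlinarith [sq_nonneg x]
  have h6 : exp |l * x ^ 2| ≤ exp (x ^ 2 / 8) := exp_le_exp.mpr h3
  have h7 : x ^ 4 * exp |l * x ^ 2| ≤ 128 * exp (x ^ 2 / 4) := by
    calc x ^ 4 * exp |l * x ^ 2| ≤ (128 * exp (x ^ 2 / 8)) * exp (x ^ 2 / 8) := by gcongr
      _ = _ := by rw [mul_assoc, ← exp_add]; ring_nf
  have h8 := (abs_le.mp h2).2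
  rw [h4, mul_assoc] at h8
  nlinarith [mul_le_mul_of_nonneg_left h7 (sq_nonneg l)]

lemma sum_exp_mul_sq_signSum_le (a : ι → ℝ) (ha : ∑ i, a i ^ 2 = 1) (l : ℝ) (hl : |l| ≤ 1 / 8) :
    ∑ σ : ι → Bool, exp (l * signSum σ a ^ 2)
      ≤ 2 ^ Fintype.card ι * exp (l + 182 * l ^ 2) := by
  have h1 := sum_exp_sq_signSum_le a ha
  have h2 := sum_sq_signSum a ha
  have h3 : √2 ≤ 1.42 := by
    rw [sqrt_le_left (by norm_num)]; norm_num
  have hp : (0 : ℝ) < 2 ^ Fintype.card ι := by positivity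
  calc ∑ σ : ι → Bool, exp (l * signSum σ a ^ 2)
      ≤ ∑ σ : ι → Bool, (1 + l * signSum σ a ^ 2 + l ^ 2 * (128 * exp (signSum σ a ^ 2 / 4))) :=
        Finset.sum_le_sum fun σ _ => exp_mul_sq_le l _ hl
    _ = 2 ^ Fintype.card ι + l * 2 ^ Fintype.card ι
          + l ^ 2 * (128 * ∑ σ : ι → Bool, exp (signSum σ a ^ 2 / 4)) := by
        rw [Finset.sum_add_distrib, Finset.sum_add_distrib, ← Finset.mul_sum, h2,
          ← Finset.mul_sum, ← Finset.mul_sum]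
        simp
    _ ≤ 2 ^ Fintype.card ι + l * 2 ^ Fintype.card ι
          + l ^ 2 * (128 * (1.42 * 2 ^ Fintype.card ι)) := by
        gcongr
        exact h1.trans (by gcongr)
    _ ≤ 2 ^ Fintype.card ι * ((l + 182 * l ^ 2) + 1) := by
        have : 0 ≤ l ^ 2 * 2 ^ Fintype.card ι := by positivity
        nlinarith
    _ ≤ _ := by
        gcongr
        exact add_one_le_exp _

/-- The exponential moment of the energy of `m` independent Rademacher sums. -/
lemma sum_exp_mul_energy_le (m : ℕ) (a : ι → ℝ) (ha : ∑ i, a i ^ 2 = 1) (l : ℝ)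
    (hl : |l| ≤ 1 / 8) :
    ∑ ω : Fin m → ι → Bool, exp (l * ∑ r, signSum (ω r) a ^ 2)
      ≤ 2 ^ (m * Fintype.card ι) * exp (m * (l + 182 * l ^ 2)) := by
  have h2 := (Finset.prod_univ_sum (fun _ : Fin m => (Finset.univ : Finset (ι → Bool)))
    (fun _ σ => exp (l * signSum σ a ^ 2))).symm
  rw [Fintype.piFinset_univ] at h2
  simp_rw [Finset.mul_sum, exp_sum]
  rw [h2, Finset.prod_const, Finset.card_univ, Fintype.card_fin]
  calc _ ≤ (2 ^ Fintype.card ι * exp (l + 182 * l ^ 2)) ^ m :=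
        pow_le_pow_left₀ (Finset.sum_nonneg fun _ _ => (exp_pos _).le)
          (sum_exp_mul_sq_signSum_le a ha l hl) m
    _ = _ := by
        rw [mul_pow, ← pow_mul, mul_comm m, ← exp_nat_mul]

/-- The number of sign matrices that distort the norm of the unit vector `a` by more than `1 / 8` is
exponentially small, by Chernoff's method. -/
lemma card_distorting_le (m : ℕ) (a : ι → ℝ) (ha : ∑ i, a i ^ 2 = 1) :
    ((Finset.univ.filter fun ω : Fin m → ι → Bool =>
        (m : ℝ) / 8 < |∑ r, signSum (ω r) a ^ 2 - m|).card : ℝ)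
      ≤ 2 * 2 ^ (m * Fintype.card ι) * exp (-(m : ℝ) / 46592) := by
  have h : ∀ l : ℝ, |l| ≤ 1 / 8 → ∑ ω : Fin m → ι → Bool,
      exp (l * (∑ r, signSum (ω r) a ^ 2 - m)) ≤ 2 ^ (m * Fintype.card ι) * exp (m * (182 * l ^ 2)) := by
    intro l hl
    have h1 := sum_exp_mul_energy_le m a ha l hl
    have e : ∀ ω : Fin m → ι → Bool, exp (l * (∑ r, signSum (ω r) a ^ 2 - m))
        = exp (l * ∑ r, signSum (ω r) a ^ 2) * exp (- (m * l)) := by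
      intro ω; rw [← exp_add]; ring_nf
    simp_rw [e]
    rw [← Finset.sum_mul]
    calc _ ≤ (2 ^ (m * Fintype.card ι) * exp (m * (l + 182 * l ^ 2))) * exp (- (m * l)) := by gcongr
      _ = _ := by rw [mul_assoc, ← exp_add]; ring_nf
  -- `l = ± 1 / 2912` minimizes `182 * l ^ 2 - l / 8`
  have hp := h (1 / 2912) (by norm_num)
  have hm := h (-(1 / 2912)) (by norm_num)
  have hsum : ∑ ω : Fin m → ι → Bool, (exp (1 / 2912 * (∑ r, signSum (ω r) a ^ 2 - m))
      + exp (-(1 / 2912) * (∑ r, signSum (ω r) a ^ 2 - m)))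
      ≤ 2 * 2 ^ (m * Fintype.card ι) * exp (m * (182 * (1 / 2912) ^ 2)) := by
    rw [Finset.sum_add_distrib]
    rw [neg_sq] at hm
    linarith
  have hlow : ((Finset.univ.filter fun ω : Fin m → ι → Bool =>
        (m : ℝ) / 8 < |∑ r, signSum (ω r) a ^ 2 - m|).card : ℝ) * exp (1 / 2912 * (m / 8))
      ≤ ∑ ω : Fin m → ι → Bool, (exp (1 / 2912 * (∑ r, signSum (ω r) a ^ 2 - m))
      + exp (-(1 / 2912) * (∑ r, signSum (ω r) a ^ 2 - m))) := by
    rw [← nsmul_eq_mul, ← Finset.sum_const]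
    refine (Finset.sum_le_sum fun ω hω => ?_).trans
      (Finset.sum_le_sum_of_subset_of_nonneg (Finset.filter_subset _ _)
        fun ω _ _ => by positivity)
    rw [Finset.mem_filter] at hω
    rcases lt_abs.mp hω.2 with h1 | h1
    · have : exp (1 / 2912 * (m / 8)) ≤ exp (1 / 2912 * (∑ r, signSum (ω r) a ^ 2 - m)) :=
        exp_le_exp.mpr (by linarith)
      linarith [exp_pos (-(1 / 2912) * (∑ r, signSum (ω r) a ^ 2 - m))]
    · have : exp (1 / 2912 * (m / 8)) ≤ exp (-(1 / 2912) * (∑ r, signSum (ω r) a ^ 2 - m)) :=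
        exp_le_exp.mpr (by linarith)
      linarith [exp_pos ((1 / 2912) * (∑ r, signSum (ω r) a ^ 2 - m))]
  have hfin := hlow.trans hsum
  have e : exp (m * (182 * (1 / 2912) ^ 2)) = exp (-(m : ℝ) / 46592) * exp (1 / 2912 * (m / 8)) := by
    rw [← exp_add]; ring_nf
  rw [e, ← mul_assoc] at hfin
  exact le_of_mul_le_mul_right hfin (exp_pos _)

end Concentration

end

/-! ### Counting heap trees and integer test vectors -/

section

open Real
open scoped InnerProductSpace

/-- Node `v ≥ 1` of the infinite binary heap has the children `2 * v` and `2 * v + 1`. A heap tree is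
a set of nodes below `N` that contains the parent `v / 2` of each of its members `v` other than the
root `1`. The empty set counts as a tree. -/
def HeapTree (N : ℕ) (T : Finset ℕ) : Prop :=
  T ⊆ Finset.Ico 1 N ∧ ∀ v ∈ T, 1 < v → v / 2 ∈ T

lemma HeapTree.union {N : ℕ} {S T : Finset ℕ} (hS : HeapTree N S) (hT : HeapTree N T) :
    HeapTree N (S ∪ T) := by
  refine ⟨Finset.union_subset hS.1 hT.1, fun v hv h1 => ?_⟩
  rcases Finset.mem_union.mp hv with h | h
  · exact Finset.mem_union_left _ (hS.2 v h h1)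
  · exact Finset.mem_union_right _ (hT.2 v h h1)

/-- The root and the children of the members of `T`; contains `T` if `T` is a tree. -/
def heapFrontier (T : Finset ℕ) : Finset ℕ :=
  insert 1 (T.image (fun v => 2 * v) ∪ T.image (fun v => 2 * v + 1))

lemma card_heapFrontier_le (T : Finset ℕ) : (heapFrontier T).card ≤ 2 * T.card + 1 := by
  refine (Finset.card_insert_le _ _).trans ?_
  have h1 := Finset.card_union_le (T.image (fun v => 2 * v)) (T.image (fun v => 2 * v + 1))
  have h2 := Finset.card_image_le (s := T) (f := fun v => 2 * v)
  have h3 := Finset.card_image_le (s := T) (f := fun v => 2 * v + 1)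
  omega

lemma HeapTree.mem_heapFrontier {N v : ℕ} {S T : Finset ℕ} (hS : HeapTree N S) (hv : v ∈ S)
    (h : 1 < v → v / 2 ∈ T) : v ∈ heapFrontier T := by
  by_cases h1 : 1 < v
  · refine Finset.mem_insert_of_mem (Finset.mem_union.mpr ?_)
    rcases Nat.mod_two_eq_zero_or_one v with h2 | h2
    · exact Or.inl (Finset.mem_image.mpr ⟨_, h h1, by omega⟩)
    · exact Or.inr (Finset.mem_image.mpr ⟨_, h h1, by omega⟩)
  · have := Finset.mem_Ico.mp (hS.1 hv)
    have : v = 1 := by omega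
    subst this
    exact Finset.mem_insert_self _ _

/-- A tree is recovered from its union with a set that avoids its frontier. -/
lemma HeapTree.subset_of_union_eq {N : ℕ} {S T V W : Finset ℕ} (hS : HeapTree N S)
    (hW : Disjoint W (heapFrontier T)) (h : V ∪ S = W ∪ T) : S ⊆ T := by
  intro v
  induction v using Nat.strong_induction_on with
  | _ v ih =>
    intro hv
    have hf : v ∈ heapFrontier T :=
      hS.mem_heapFrontier hv fun h1 => ih (v / 2) (by omega) (hS.2 v hv h1)
    have hvW : v ∉ W := fun hw => Finset.disjoint_left.mp hW hw hf
    have : v ∈ W ∪ T := h ▸ Finset.mem_union_right _ hv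
    exact (Finset.mem_union.mp this).resolve_left hvW

open Classical in
/-- The number of trees with at most `s` nodes does not depend on the depth of the heap. If every node
tosses a coin and the tree consists of the nodes all of whose ancestors show heads, then every tree
with at most `s` nodes is determined by at most `2 * s + 1` coins. -/
lemma card_heapTrees_le (N s : ℕ) :
    ((Finset.Ico 1 N).powerset.filter fun T => HeapTree N T ∧ T.card ≤ s).card
      ≤ 2 ^ (2 * s + 1) := by
  set I := Finset.Ico 1 N with hI
  set 𝒯 := I.powerset.filter fun T => HeapTree N T ∧ T.card ≤ s with h𝒯
  -- a tree, together with a set of nodes off its frontier, is determined by the union of both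
  have h1 : (𝒯.sigma fun T => (I \ heapFrontier T).powerset).card ≤ I.powerset.card := by
    refine Finset.card_le_card_of_injOn (fun p => p.2 ∪ p.1) ?_ ?_
    · rintro ⟨T, W⟩ hp
      simp only [Finset.coe_sigma, Set.mem_sigma_iff, Finset.mem_coe, Finset.mem_powerset] at hp
      have hT := (Finset.mem_filter.mp hp.1).2.1
      exact Finset.mem_coe.mpr (Finset.mem_powerset.mpr
        (Finset.union_subset (hp.2.trans Finset.sdiff_subset) hT.1))
    · rintro ⟨S, V⟩ hp ⟨T, W⟩ hq h
      simp only [Finset.coe_sigma, Set.mem_sigma_iff, Finset.mem_coe, Finset.mem_powerset] at hp hq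
      have hS := (Finset.mem_filter.mp hp.1).2.1
      have hT := (Finset.mem_filter.mp hq.1).2.1
      have hV : Disjoint V (heapFrontier S) :=
        (Finset.disjoint_sdiff.mono_right hp.2).symm
      have hW : Disjoint W (heapFrontier T) :=
        (Finset.disjoint_sdiff.mono_right hq.2).symm
      have hST : S = T := (hS.subset_of_union_eq hW h).antisymm
        (hT.subset_of_union_eq hV (Eq.symm h))
      subst hST
      have hsub : S ⊆ heapFrontier S := fun v hv => hS.mem_heapFrontier hv (hS.2 v hv)
      have hVW : V = W := by
        have e : (V ∪ S) \ S = (W ∪ S) \ S := by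
          have h' : V ∪ S = W ∪ S := h
          rw [h']
        rwa [Finset.union_sdiff_cancel_right (hV.mono_right hsub),
          Finset.union_sdiff_cancel_right (hW.mono_right hsub)] at e
      rw [hVW]
  rw [Finset.card_sigma, Finset.card_powerset] at h1
  have h2 : ∀ T ∈ 𝒯, 2 ^ I.card ≤ 2 ^ (2 * s + 1) * (I \ heapFrontier T).powerset.card := by
    intro T hT
    have hc := (Finset.mem_filter.mp hT).2.2
    have h3 := card_heapFrontier_le T
    have h4 := Finset.le_card_sdiff (heapFrontier T) I
    rw [Finset.card_powerset, ← pow_add]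
    exact Nat.pow_le_pow_right (by norm_num) (by omega)
  have h3 : 𝒯.card * 2 ^ I.card ≤ 2 ^ (2 * s + 1) * 2 ^ I.card := by
    calc 𝒯.card * 2 ^ I.card = ∑ T ∈ 𝒯, 2 ^ I.card := by simp
      _ ≤ ∑ T ∈ 𝒯, 2 ^ (2 * s + 1) * (I \ heapFrontier T).powerset.card := Finset.sum_le_sum h2
      _ = 2 ^ (2 * s + 1) * ∑ T ∈ 𝒯, (I \ heapFrontier T).powerset.card := by
          rw [Finset.mul_sum]
      _ ≤ _ := Nat.mul_le_mul_left _ h1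
  exact Nat.le_of_mul_le_mul_right h3 (by positivity)

lemma sum_half_pow_natAbs_le (M : ℕ) :
    ∑ z ∈ Finset.Icc (-(M : ℤ)) M, (1 / 2 : ℝ) ^ z.natAbs ≤ 3 := by
  suffices h : ∑ z ∈ Finset.Icc (-(M : ℤ)) M, (1 / 2 : ℝ) ^ z.natAbs = 3 - 2 * (1 / 2) ^ M by
    rw [h]; linarith [show (0 : ℝ) < (1 / 2) ^ M by positivity]
  induction M with
  | zero => norm_num
  | succ M ih =>
    have e : Finset.Icc (-((M + 1 : ℕ) : ℤ)) ((M + 1 : ℕ) : ℤ)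
        = insert (-((M : ℤ) + 1)) (insert ((M : ℤ) + 1) (Finset.Icc (-(M : ℤ)) M)) := by
      ext z
      simp only [Finset.mem_Icc, Finset.mem_insert]
      omega
    have n1 : (-((M : ℤ) + 1)).natAbs = M + 1 := by omega
    have n2 : ((M : ℤ) + 1).natAbs = M + 1 := by omega
    rw [e, Finset.sum_insert, Finset.sum_insert, ih, n1, n2, pow_succ]
    · ring
    · simp
    · simp only [Finset.mem_insert, Finset.mem_Icc]; omega

/-- The integer vectors supported in `T` whose entries are at most `M` in absolute value. -/
noncomputable def integerBox {ι : Type*} [Fintype ι] [DecidableEq ι] (T : Finset ι) (M : ℕ) : Finset (ι → ℤ) :=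
  Fintype.piFinset fun i => if i ∈ T then Finset.Icc (-(M : ℤ)) M else {0}

/-- The number of integer vectors of bounded norm: `2 ^ M * 2 ^ (-∑ |z i|)` is at least `1` on them, and
its sum over the whole box is a product. -/
lemma card_integerBox_filter_le {ι : Type*} [Fintype ι] [DecidableEq ι] (T : Finset ι) (M : ℕ) :
    ((integerBox T M).filter fun z => ∑ i, z i ^ 2 ≤ (M : ℤ)).card ≤ 2 ^ M * 4 ^ T.card := by
  have h1 : (((integerBox T M).filter fun z => ∑ i, z i ^ 2 ≤ (M : ℤ)).card : ℝ)
      ≤ ∑ z ∈ integerBox T M, 2 ^ M * ∏ i, (1 / 2 : ℝ) ^ (z i).natAbs := by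
    rw [Finset.card_eq_sum_ones, Nat.cast_sum]
    refine (Finset.sum_le_sum fun z hz => ?_).trans (Finset.sum_le_sum_of_subset_of_nonneg
      (Finset.filter_subset _ _) fun z _ _ => by positivity)
    have hz' := (Finset.mem_filter.mp hz).2
    rw [Finset.prod_pow_eq_pow_sum]
    have hle : ∑ i, (z i).natAbs ≤ M := by
      have : ((∑ i, (z i).natAbs : ℕ) : ℤ) ≤ M := by
        push_cast
        refine le_trans (Finset.sum_le_sum fun i _ => ?_) hz'
        rw [← sq_abs]
        have := abs_nonneg (z i)
        nlinarith [sq_nonneg (|z i|), Int.le_self_sq |z i|]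
      exact_mod_cast this
    have hp : (1 / 2 : ℝ) ^ M ≤ (1 / 2) ^ ∑ i, (z i).natAbs :=
      pow_le_pow_of_le_one (by norm_num) (by norm_num) hle
    calc ((1 : ℕ) : ℝ) = 2 ^ M * (1 / 2) ^ M := by rw [← mul_pow]; norm_num
      _ ≤ _ := by gcongr
  have h2 : ∑ z ∈ integerBox T M, ∏ i, (1 / 2 : ℝ) ^ (z i).natAbs ≤ 4 ^ T.card := by
    have e := Finset.prod_univ_sum (fun i => if i ∈ T then Finset.Icc (-(M : ℤ)) M else {0})
      (fun _ z => (1 / 2 : ℝ) ^ z.natAbs)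
    rw [integerBox, ← e]
    calc _ ≤ ∏ i : ι, (if i ∈ T then (4 : ℝ) else 1) := by
          refine Finset.prod_le_prod (fun i _ => Finset.sum_nonneg fun _ _ => by positivity)
            fun i _ => ?_
          split_ifs with h
          · exact (sum_half_pow_natAbs_le M).trans (by norm_num)
          · simp
      _ = _ := by
          rw [Finset.prod_ite_mem, Finset.univ_inter, Finset.prod_const]
  rw [← Finset.mul_sum] at h1
  have h3 := h1.trans (mul_le_mul_of_nonneg_left h2 (by positivity))
  exact_mod_cast h3

/-! ### Sign matrices that are almost isometric on trees -/

section Isometry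

variable {E F : Type*} [NormedAddCommGroup E] [InnerProductSpace ℝ E]
  [NormedAddCommGroup F] [InnerProductSpace ℝ F]

lemma normSq_map_add_sub (L : E →ₗ[ℝ] F) (x y : E) :
    ‖L (x + y)‖ ^ 2 - ‖x + y‖ ^ 2
      = (‖L x‖ ^ 2 - ‖x‖ ^ 2) + 2 * (⟪L x, L y⟫_ℝ - ⟪x, y⟫_ℝ) + (‖L y‖ ^ 2 - ‖y‖ ^ 2) := by
  rw [map_add, norm_add_sq_real, norm_add_sq_real]
  ring

lemma normSq_map_smul (L : E →ₗ[ℝ] F) (c : ℝ) (x : E) :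
    ‖L (c • x)‖ ^ 2 - ‖c • x‖ ^ 2 = c ^ 2 * (‖L x‖ ^ 2 - ‖x‖ ^ 2) := by
  rw [map_smul, norm_smul, norm_smul, mul_pow, mul_pow, Real.norm_eq_abs, sq_abs]
  ring

/-- Polarization: a map that almost preserves norms almost preserves inner products. -/
lemma abs_inner_map_sub_le (L : E →ₗ[ℝ] F) (W : Submodule ℝ E) {δ : ℝ}
    (h : ∀ v ∈ W, |‖L v‖ ^ 2 - ‖v‖ ^ 2| ≤ δ * ‖v‖ ^ 2) {x y : E} (hx : x ∈ W) (hy : y ∈ W) :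
    |⟪L x, L y⟫_ℝ - ⟪x, y⟫_ℝ| ≤ δ * (‖x‖ * ‖y‖) := by
  rcases eq_or_ne x 0 with rfl | hx0
  · simp
  rcases eq_or_ne y 0 with rfl | hy0
  · simp
  have hx' : 0 < ‖x‖ := norm_pos_iff.mpr hx0
  have hy' : 0 < ‖y‖ := norm_pos_iff.mpr hy0
  set u := ‖y‖ • x with hu
  set v := ‖x‖ • y with hv
  have huW : u ∈ W := W.smul_mem _ hx
  have hvW : v ∈ W := W.smul_mem _ hy
  have hun : ‖u‖ = ‖x‖ * ‖y‖ := by rw [hu, norm_smul, norm_norm]; ring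
  have hvn : ‖v‖ = ‖x‖ * ‖y‖ := by rw [hv, norm_smul, norm_norm]
  have e1 := normSq_map_add_sub L u v
  have e2 := normSq_map_add_sub L u (-v)
  have e3 := normSq_map_smul L (-1) v
  rw [neg_one_smul] at e3
  rw [map_neg, inner_neg_right, inner_neg_right, ← map_neg, e3] at e2
  have b1 := abs_le.mp (h _ (W.add_mem huW hvW))
  have b2 := abs_le.mp (h _ (W.add_mem huW (W.neg_mem hvW)))
  have par := parallelogram_law_with_norm ℝ u v
  rw [← sub_eq_add_neg] at e2 b2
  have hin : ⟪L u, L v⟫_ℝ - ⟪u, v⟫_ℝ = (‖x‖ * ‖y‖) * (⟪L x, L y⟫_ℝ - ⟪x, y⟫_ℝ) := by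
    rw [hu, hv, map_smul, map_smul, real_inner_smul_left, real_inner_smul_right,
      real_inner_smul_left, real_inner_smul_right]
    ring
  have hpos : 0 < ‖x‖ * ‖y‖ := by positivity
  have e2' : ‖L (u - v)‖ ^ 2 - ‖u - v‖ ^ 2 = (‖L u‖ ^ 2 - ‖u‖ ^ 2)
      - 2 * (⟪L u, L v⟫_ℝ - ⟪u, v⟫_ℝ) + (‖L v‖ ^ 2 - ‖v‖ ^ 2) := by
    rw [e2]; ring
  rw [hin] at e1 e2'
  rw [hun, hvn] at par
  have key : (‖x‖ * ‖y‖) * |⟪L x, L y⟫_ℝ - ⟪x, y⟫_ℝ| ≤ (‖x‖ * ‖y‖) * (δ * (‖x‖ * ‖y‖)) := by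
    rw [← abs_of_pos hpos, ← abs_mul, abs_of_pos hpos, abs_le]
    have pe : δ * ‖u + v‖ ^ 2 + δ * ‖u - v‖ ^ 2 = 4 * (δ * ((‖x‖ * ‖y‖) * (‖x‖ * ‖y‖))) := by
      linear_combination δ * par
    constructor <;> linarith
  exact le_of_mul_le_mul_left key hpos

end Isometry

/-- The vectors supported in `S`. -/
def supportedIn {ι : Type*} [Fintype ι] (S : Set ι) : Submodule ℝ (EuclideanSpace ℝ ι) where
  carrier := {v | ∀ i, i ∉ S → v i = 0}
  add_mem' := fun ha hb i hi => by simp [ha i hi, hb i hi]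
  zero_mem' := fun i _ => by simp
  smul_mem' := fun c v hv i hi => by simp [hv i hi]

lemma supportedIn_mono {ι : Type*} [Fintype ι] {S T : Set ι} (h : S ⊆ T) :
    supportedIn S ≤ supportedIn T :=
  fun _ hv i hi => hv i fun hS => hi (h hS)

/-- The vector with the integer entries `z`. -/
noncomputable def intVector {ι : Type*} [Fintype ι] (z : ι → ℤ) : EuclideanSpace ℝ ι :=
  WithLp.toLp 2 fun i => (z i : ℝ)

/-- It suffices to test a map on the integer vectors of bounded norm. Scaled to norm
`10 * √s`, a vector is close to an integer vector, and the error is absorbed because the optimal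
constant for all real vectors improves on itself. -/
lemma almost_isometry_of_integer {ι : Type*} [Fintype ι] {F : Type*} [NormedAddCommGroup F]
    [InnerProductSpace ℝ F] (L : EuclideanSpace ℝ ι →ₗ[ℝ] F) (T : Finset ι) (s : ℕ) (hs : 1 ≤ s)
    (hT : T.card ≤ s)
    (h : ∀ z : ι → ℤ, (∀ i, i ∉ T → z i = 0) → ∑ i, z i ^ 2 ≤ (111 * s : ℤ) →
      |‖L (intVector z)‖ ^ 2 - ‖intVector z‖ ^ 2| ≤ 1 / 8 * ‖intVector z‖ ^ 2) :
    ∀ v ∈ supportedIn (T : Set ι), |‖L v‖ ^ 2 - ‖v‖ ^ 2| ≤ 1 / 4 * ‖v‖ ^ 2 := by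
  set W := supportedIn (T : Set ι) with hW
  set S : Set ℝ := {κ | 0 ≤ κ ∧ ∀ v ∈ W, |‖L v‖ ^ 2 - ‖v‖ ^ 2| ≤ κ * ‖v‖ ^ 2} with hS
  have hne : S.Nonempty := by
    refine ⟨‖LinearMap.toContinuousLinearMap L‖ ^ 2 + 1, by positivity, fun v _ => ?_⟩
    have h1 : ‖L v‖ ≤ ‖LinearMap.toContinuousLinearMap L‖ * ‖v‖ :=
      (LinearMap.toContinuousLinearMap L).le_opNorm v
    have h2 : ‖L v‖ ^ 2 ≤ ‖LinearMap.toContinuousLinearMap L‖ ^ 2 * ‖v‖ ^ 2 := by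
      rw [← mul_pow]; gcongr
    rw [abs_le]
    constructor <;> nlinarith [sq_nonneg ‖L v‖, sq_nonneg ‖v‖, sq_nonneg ‖LinearMap.toContinuousLinearMap L‖, mul_nonneg (sq_nonneg ‖LinearMap.toContinuousLinearMap L‖) (sq_nonneg ‖v‖)]
  have hbdd : BddBelow S := ⟨0, fun κ hκ => hκ.1⟩
  -- the optimal constant; the claim is that it is at most `1 / 4`
  set κ := sInf S with hκ
  have hκ0 : 0 ≤ κ := le_csInf hne fun _ h => h.1
  have hκS : ∀ v ∈ W, |‖L v‖ ^ 2 - ‖v‖ ^ 2| ≤ κ * ‖v‖ ^ 2 := by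
    intro v hv
    rcases eq_or_ne v 0 with rfl | hv0
    · simp
    have hp : 0 < ‖v‖ ^ 2 := by have := norm_pos_iff.mpr hv0; positivity
    rw [← div_le_iff₀ hp]
    exact le_csInf hne fun κ' h' => (div_le_iff₀ hp).mpr (h'.2 v hv)
  have hnext : 441 / 3200 + 43 / 400 * κ ∈ S := by
    refine ⟨by positivity, fun v hv => ?_⟩
    rcases eq_or_ne v 0 with rfl | hv0
    · simp
    have hvp : 0 < ‖v‖ := norm_pos_iff.mpr hv0
    have hsp : (0 : ℝ) < s := by exact_mod_cast hs
    -- scaled to the norm `ρ`, a vector is at distance at most `√s / 2 = ρ / 20` from the rounded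
    -- vector `w`
    set ρ := 10 * √(s : ℝ) with hρ
    have hρp : 0 < ρ := by positivity
    have hρ2 : ρ ^ 2 = 100 * s := by rw [hρ, mul_pow, sq_sqrt hsp.le]; norm_num
    set v' := (ρ / ‖v‖) • v with hv'
    have hv'W : v' ∈ W := W.smul_mem _ hv
    have hv'n : ‖v'‖ = ρ := by
      rw [hv', norm_smul, norm_div, norm_norm, Real.norm_of_nonneg hρp.le]
      field_simp
    set z : ι → ℤ := fun i => round (v' i) with hz
    have hzT : ∀ i, i ∉ T → z i = 0 := fun i hi => by
      have : v' i = 0 := hv'W i (by simpa using hi)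
      simp [hz, this]
    set w := intVector z with hw
    have hwW : w ∈ W := fun i hi => by
      have : z i = 0 := hzT i (by simpa using hi)
      simp [hw, intVector, this]
    set e := v' - w with he
    have heW : e ∈ W := W.sub_mem hv'W hwW
    have hen : ‖e‖ ≤ ρ / 20 := by
      have h1 : ‖e‖ ^ 2 ≤ (ρ / 20) ^ 2 := by
        rw [EuclideanSpace.norm_sq_eq, div_pow, hρ2]
        have h2 : ∑ i, ‖e i‖ ^ 2 ≤ ∑ i ∈ T, (1 / 4 : ℝ) := by
          rw [← Finset.sum_subset (Finset.subset_univ T) (f := fun i => ‖e i‖ ^ 2)]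
          · refine Finset.sum_le_sum fun i _ => ?_
            have h3 : |e i| ≤ 1 / 2 := by
              have := abs_sub_round (v' i)
              simpa [he, hw, intVector, hz] using this
            rw [Real.norm_eq_abs]
            have := abs_nonneg (e i)
            nlinarith
          · intro i _ hi
            have : e i = 0 := heW i (by simpa using hi)
            simp [this]
        rw [Finset.sum_const, nsmul_eq_mul] at h2
        have : (T.card : ℝ) ≤ s := by exact_mod_cast hT
        linarith
      exact le_of_sq_le_sq h1 (by positivity)
    have hwn : ‖w‖ ≤ 21 / 20 * ρ := by
      have : w = v' - e := by rw [he]; abel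
      rw [this]
      have := norm_sub_le v' e
      linarith
    have hzs : ∑ i, z i ^ 2 ≤ (111 * s : ℤ) := by
      have h1 : ‖w‖ ^ 2 ≤ (21 / 20 * ρ) ^ 2 := by gcongr
      rw [EuclideanSpace.norm_sq_eq, mul_pow, hρ2] at h1
      have h2 : ∀ i, ‖w i‖ ^ 2 = ((z i ^ 2 : ℤ) : ℝ) := by
        intro i; simp [hw, intVector]
      simp_rw [h2] at h1
      have h3 : ((∑ i, z i ^ 2 : ℤ) : ℝ) ≤ ((111 * s : ℤ) : ℝ) := by
        push_cast at h1 ⊢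
        nlinarith
      exact_mod_cast h3
    -- `w` is a test vector; the optimal constant `κ` applies to the other parts of `v' = w + e`
    have hi := h z hzT hzs
    have hpol := abs_inner_map_sub_le L W hκS hwW heW
    have hee := hκS e heW
    have hsum := normSq_map_add_sub L w e
    have hve : w + e = v' := by rw [he]; abel
    rw [hve] at hsum
    have hQ : |‖L v'‖ ^ 2 - ‖v'‖ ^ 2| ≤ (441 / 3200 + 43 / 400 * κ) * ρ ^ 2 := by
      rw [hsum]
      have t1 : 1 / 8 * ‖w‖ ^ 2 ≤ 1 / 8 * (21 / 20 * ρ) ^ 2 := by gcongr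
      have t2 : κ * (‖w‖ * ‖e‖) ≤ κ * ((21 / 20 * ρ) * (ρ / 20)) := by gcongr
      have t3 : κ * ‖e‖ ^ 2 ≤ κ * (ρ / 20) ^ 2 := by gcongr
      have a1 := abs_le.mp hi
      have a2 := abs_le.mp hpol
      have a3 := abs_le.mp hee
      rw [abs_le]
      constructor <;> linarith
    rw [hv', normSq_map_smul, abs_mul, abs_of_nonneg (sq_nonneg _), div_pow] at hQ
    have hv2 : 0 < ‖v‖ ^ 2 := by positivity
    have hr2 : 0 < ρ ^ 2 := by positivity
    rw [div_mul_eq_mul_div, div_le_iff₀ hv2] at hQ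
    have : ρ ^ 2 * |‖L v‖ ^ 2 - ‖v‖ ^ 2| ≤ ρ ^ 2 * ((441 / 3200 + 43 / 400 * κ) * ‖v‖ ^ 2) := by
      linarith
    exact le_of_mul_le_mul_left this hr2
  have hle : κ ≤ 441 / 3200 + 43 / 400 * κ := csInf_le hbdd hnext
  intro v hv
  exact (hκS v hv).trans (mul_le_mul_of_nonneg_right (by linarith) (sq_nonneg _))

/-- The linear map `v ↦ B v / √m`, where `B` is the `m × N` integer matrix with the entries `B r i`. -/
noncomputable def measureMap (m N : ℕ) (B : ℕ → ℕ → ℤ) :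
    EuclideanSpace ℝ (Fin N) →ₗ[ℝ] EuclideanSpace ℝ (Fin m) where
  toFun v := WithLp.toLp 2 fun r => (∑ i : Fin N, (B r i : ℝ) * v i) / √m
  map_add' u v := by
    ext r
    simp [mul_add, Finset.sum_add_distrib, add_div]
  map_smul' c v := by
    ext r
    simp only [PiLp.smul_apply, smul_eq_mul, RingHom.id_apply]
    rw [← mul_div_assoc, Finset.mul_sum]
    congr 1
    exact Finset.sum_congr rfl fun i _ => by ring

lemma measureMap_apply (m N : ℕ) (B : ℕ → ℕ → ℤ) (v : EuclideanSpace ℝ (Fin N)) (r : Fin m) :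
    measureMap m N B v r = (∑ i : Fin N, (B r i : ℝ) * v i) / √m := rfl

lemma normSq_measureMap (m N : ℕ) (B : ℕ → ℕ → ℤ) (v : EuclideanSpace ℝ (Fin N)) :
    ‖measureMap m N B v‖ ^ 2 = (∑ r : Fin m, (∑ i : Fin N, (B r i : ℝ) * v i) ^ 2) / m := by
  rw [EuclideanSpace.norm_sq_eq, Finset.sum_div]
  refine Finset.sum_congr rfl fun r _ => ?_
  rw [measureMap_apply, Real.norm_eq_abs, sq_abs, div_pow, sq_sqrt (Nat.cast_nonneg m)]

/-- The indices below `N` that lie in `T`. -/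
def finPart (N : ℕ) (T : Finset ℕ) : Finset (Fin N) := Finset.univ.filter fun i => (i : ℕ) ∈ T

lemma card_finPart_le (N : ℕ) (T : Finset ℕ) : (finPart N T).card ≤ T.card := by
  refine Finset.card_le_card_of_injOn (fun i : Fin N => (i : ℕ)) ?_ ?_
  · intro i hi
    exact (Finset.mem_filter.mp (Finset.mem_coe.mp hi)).2
  · intro i _ j _ h
    exact Fin.ext h

/-- `B / √m` preserves the squared norm up to `1 / 4` on every vector supported in a tree with at most
`s` nodes. -/
def TreeIsometry (m N s : ℕ) (B : ℕ → ℕ → ℤ) : Prop :=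
  ∀ T, HeapTree N T → T.card ≤ s → ∀ v ∈ supportedIn (finPart N T : Set (Fin N)),
    |‖measureMap m N B v‖ ^ 2 - ‖v‖ ^ 2| ≤ 1 / 4 * ‖v‖ ^ 2

/-- Sign matrices with a number of rows linear in the size of the trees exist: by a union bound over
the trees and the integer test vectors on them, whose number is exponential in `s`. -/
theorem exists_treeIsometry : ∃ c : ℕ, 0 < c ∧ ∀ N s : ℕ, 1 ≤ s →
    ∃ B : ℕ → ℕ → ℤ, (∀ r i, |B r i| ≤ 1) ∧ TreeIsometry (c * s) N s B := by
  classical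
  refine ⟨46592 * 82, by norm_num, fun N s hs => ?_⟩
  set m := 46592 * 82 * s with hm
  set trees := (Finset.Ico 1 N).powerset.filter fun T => HeapTree N T ∧ T.card ≤ s with htrees
  set tests : Finset ℕ → Finset (Fin N → ℤ) := fun T =>
    (integerBox (finPart N T) (111 * s)).filter fun z => ∑ i, z i ^ 2 ≤ ((111 * s : ℕ) : ℤ)
    with htests
  -- the sign matrices that distort the test vector `z`
  set bad : (Fin N → ℤ) → Finset (Fin m → Fin N → Bool) := fun z =>
    if ∀ i, z i = 0 then ∅ else
    Finset.univ.filter fun ω => (m : ℝ) / 8 <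
      |∑ r, signSum (ω r) (fun i => (z i : ℝ) / ‖intVector z‖) ^ 2 - m| with hbad
  have hnorm : ∀ z : Fin N → ℤ, (¬ ∀ i, z i = 0) → 0 < ‖intVector z‖ := by
    intro z hz
    rw [norm_pos_iff]
    intro h0
    exact hz fun i => by
      have := congrArg (fun v : EuclideanSpace ℝ (Fin N) => v i) h0
      simpa [intVector] using this
  have hunit : ∀ z : Fin N → ℤ, (¬ ∀ i, z i = 0) →
      ∑ i, ((z i : ℝ) / ‖intVector z‖) ^ 2 = 1 := by
    intro z hz
    have hp := hnorm z hz
    have e := EuclideanSpace.norm_sq_eq (intVector z)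
    have e2 : ∀ i, ‖intVector z i‖ ^ 2 = (z i : ℝ) ^ 2 := fun i => by simp [intVector]
    simp_rw [e2] at e
    simp_rw [div_pow]
    rw [← Finset.sum_div, ← e]
    field_simp
  have hbadcard : ∀ z, ((bad z).card : ℝ) ≤ 2 * 2 ^ (m * N) * exp (-(m : ℝ) / 46592) := by
    intro z
    by_cases hz : ∀ i, z i = 0
    · simp only [hbad, hz, implies_true, if_true, Finset.card_empty, Nat.cast_zero]
      positivity
    · simp only [hbad, hz, if_false]
      have := card_distorting_le m _ (hunit z hz)
      rwa [Fintype.card_fin] at this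
  -- all sign matrices that fail on some tree
  set U := trees.biUnion fun T => (tests T).biUnion bad with hU
  have hUcard : (U.card : ℝ) < 2 ^ (m * N) := by
    have h1 : (U.card : ℝ) ≤ ∑ T ∈ trees, ∑ z ∈ tests T, ((bad z).card : ℝ) := by
      have : U.card ≤ ∑ T ∈ trees, ∑ z ∈ tests T, (bad z).card :=
        Finset.card_biUnion_le.trans (Finset.sum_le_sum fun T _ => Finset.card_biUnion_le)
      exact_mod_cast this
    set q := 2 * 2 ^ (m * N) * exp (-(m : ℝ) / 46592) with hq
    have hq0 : 0 < q := by positivity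
    have h2 : ∀ T ∈ trees, ∑ z ∈ tests T, ((bad z).card : ℝ) ≤ 2 ^ (113 * s) * q := by
      intro T hT
      have hTc := (Finset.mem_filter.mp hT).2.2
      have hc := card_integerBox_filter_le (finPart N T) (111 * s)
      have hc2 : (4 : ℕ) ^ (finPart N T).card ≤ 2 ^ (2 * s) := by
        rw [pow_mul]
        exact Nat.pow_le_pow_right (by norm_num) ((card_finPart_le N T).trans hTc)
      have hc3 : (tests T).card ≤ 2 ^ (113 * s) := by
        calc (tests T).card ≤ 2 ^ (111 * s) * 4 ^ (finPart N T).card := hc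
          _ ≤ 2 ^ (111 * s) * 2 ^ (2 * s) := Nat.mul_le_mul_left _ hc2
          _ = _ := by rw [← pow_add]; congr 1; ring
      calc ∑ z ∈ tests T, ((bad z).card : ℝ) ≤ ∑ z ∈ tests T, q :=
            Finset.sum_le_sum fun z _ => hbadcard z
        _ = (tests T).card * q := by rw [Finset.sum_const, nsmul_eq_mul]
        _ ≤ _ := by
          gcongr
          exact_mod_cast hc3
    have h3 : (trees.card : ℝ) ≤ 2 ^ (2 * s + 1) := by exact_mod_cast card_heapTrees_le N s
    have h4 : (U.card : ℝ) ≤ 2 ^ (117 * s) * 2 ^ (m * N) * exp (-(m : ℝ) / 46592) := by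
      calc (U.card : ℝ) ≤ ∑ T ∈ trees, 2 ^ (113 * s) * q := h1.trans (Finset.sum_le_sum h2)
        _ = trees.card * (2 ^ (113 * s) * q) := by rw [Finset.sum_const, nsmul_eq_mul]
        _ ≤ 2 ^ (2 * s + 1) * (2 ^ (113 * s) * q) := by gcongr
        _ = 2 ^ (115 * s + 2) * 2 ^ (m * N) * exp (-(m : ℝ) / 46592) := by
          rw [hq]; ring_nf
        _ ≤ _ := by
          gcongr
          · norm_num
          · omega
    -- `117 * log 2 < 82`
    have h5 : (2 : ℝ) ^ (117 * s) * exp (-(m : ℝ) / 46592) < 1 := by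
      have e1 : (2 : ℝ) ≤ exp 0.7 := by
        rw [← Real.log_le_iff_le_exp (by norm_num)]
        linarith [Real.log_two_lt_d9]
      have e2 : (2 : ℝ) ^ (117 * s) ≤ exp (81.9 * s) := by
        calc (2 : ℝ) ^ (117 * s) ≤ exp 0.7 ^ (117 * s) := pow_le_pow_left₀ (by norm_num) e1 _
          _ = _ := by
            rw [← exp_nat_mul]; congr 1; push_cast; ring
      have e3 : exp (-(m : ℝ) / 46592) = exp (-(82 * s)) := by
        congr 1; rw [hm]; push_cast; ring
      rw [e3]
      calc _ ≤ exp (81.9 * s) * exp (-(82 * s)) := by gcongr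
        _ = exp (-(0.1 * s)) := by rw [← exp_add]; ring_nf
        _ < 1 := by
          rw [exp_lt_one_iff]
          have : (1 : ℝ) ≤ s := by exact_mod_cast hs
          linarith
    have h6 : (0 : ℝ) < 2 ^ (m * N) := by positivity
    nlinarith
  obtain ⟨ω, hω⟩ : ∃ ω, ω ∉ U := by
    by_contra hcon
    push Not at hcon
    have : U = Finset.univ := Finset.eq_univ_iff_forall.mpr hcon
    rw [this, Finset.card_univ] at hUcard
    simp only [Fintype.card_pi, Finset.prod_const, Finset.card_univ, Fintype.card_fin,
      Fintype.card_bool] at hUcard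
    rw [← pow_mul, mul_comm N m] at hUcard
    push_cast at hUcard
    exact lt_irrefl _ hUcard
  refine ⟨fun r i => if h : r < m ∧ i < N then (if ω ⟨r, h.1⟩ ⟨i, h.2⟩ then 1 else -1) else 0,
    ?_, ?_⟩
  · intro r i
    dsimp only
    split_ifs <;> simp
  · intro T hT hTs
    refine almost_isometry_of_integer _ (finPart N T) s hs ((card_finPart_le N T).trans hTs) ?_
    intro z hzT hzs
    by_cases hz : ∀ i, z i = 0
    · have : intVector z = 0 := by ext i; simp [intVector, hz]
      simp [this]
    have hztest : z ∈ tests T := by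
      refine Finset.mem_filter.mpr ⟨Fintype.mem_piFinset.mpr fun i => ?_, by exact_mod_cast hzs⟩
      split_ifs with hi
      · have h1 : z i ^ 2 ≤ 111 * s :=
          (Finset.single_le_sum (fun j _ => sq_nonneg (z j)) (Finset.mem_univ i)).trans hzs
        have h2 := Int.le_self_sq (z i)
        have h3 := Int.le_self_sq (-z i)
        rw [neg_sq] at h3
        rw [Finset.mem_Icc]
        push_cast
        constructor <;> linarith
      · simp [hzT i hi]
    have hωz : ω ∉ bad z := fun h => hω (Finset.mem_biUnion.mpr ⟨T, Finset.mem_filter.mpr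
      ⟨Finset.mem_powerset.mpr hT.1, hT, hTs⟩, Finset.mem_biUnion.mpr ⟨z, hztest, h⟩⟩)
    simp only [hbad, hz, if_false, Finset.mem_filter, Finset.mem_univ, true_and, not_lt] at hωz
    have hp := hnorm z hz
    have hmp : (0 : ℝ) < m := by
      have : 0 < m := by rw [hm]; positivity
      exact_mod_cast this
    rw [normSq_measureMap]
    have e : ∀ r : Fin m, (∑ i : Fin N, (((if h : (r : ℕ) < m ∧ (i : ℕ) < N then
        (if ω ⟨r, h.1⟩ ⟨i, h.2⟩ then 1 else -1) else 0 : ℤ)) : ℝ) * intVector z i) ^ 2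
        = ‖intVector z‖ ^ 2 * signSum (ω r) (fun i => (z i : ℝ) / ‖intVector z‖) ^ 2 := by
      intro r
      rw [← mul_pow, signSum, Finset.mul_sum]
      congr 1
      refine Finset.sum_congr rfl fun i _ => ?_
      rw [dif_pos ⟨r.2, i.2⟩]
      have h0 : ‖intVector z‖ ≠ 0 := hp.ne'
      have h1 : intVector z i = (z i : ℝ) := rfl
      have h2 : ‖intVector z‖ * ((z i : ℝ) / ‖intVector z‖) = z i := by field_simp
      rw [h1, mul_left_comm, h2, boolSign]
      split_ifs <;> simp
    simp_rw [e]
    rw [← Finset.mul_sum]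
    have e2 : ‖intVector z‖ ^ 2 * ∑ r, signSum (ω r) (fun i => (z i : ℝ) / ‖intVector z‖) ^ 2 / m
        - ‖intVector z‖ ^ 2 = ‖intVector z‖ ^ 2 / m *
          (∑ r, signSum (ω r) (fun i => (z i : ℝ) / ‖intVector z‖) ^ 2 - m) := by
      rw [← Finset.sum_div]
      field_simp
    rw [mul_div_assoc, Finset.sum_div, e2, abs_mul, abs_of_nonneg (by positivity)]
    calc _ ≤ ‖intVector z‖ ^ 2 / m * ((m : ℝ) / 8) := by gcongr
      _ = _ := by field_simp

end

/-! ### Iterative hard thresholding -/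

section

set_option linter.unusedSectionVars false
open Real
open scoped InnerProductSpace

section Thresholding

variable {ι : Type*} [Fintype ι] [DecidableEq ι] {F : Type*} [NormedAddCommGroup F]
  [InnerProductSpace ℝ F]

/-- The vector that agrees with `v` on `S` and vanishes elsewhere. -/
noncomputable def restrictTo (S : Finset ι) (v : EuclideanSpace ℝ ι) : EuclideanSpace ℝ ι :=
  WithLp.toLp 2 fun i => if i ∈ S then v i else 0

lemma restrictTo_apply (S : Finset ι) (v : EuclideanSpace ℝ ι) (i : ι) :
    restrictTo S v i = if i ∈ S then v i else 0 := rfl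

lemma restrictTo_mem (S : Finset ι) (v : EuclideanSpace ℝ ι) :
    restrictTo S v ∈ supportedIn (S : Set ι) := fun i hi => by
  rw [restrictTo_apply, if_neg (by simpa using hi)]

lemma normSq_restrictTo (S : Finset ι) (v : EuclideanSpace ℝ ι) :
    ‖restrictTo S v‖ ^ 2 = ∑ i ∈ S, v i ^ 2 := by
  rw [EuclideanSpace.norm_sq_eq, ← Finset.sum_subset (Finset.subset_univ S)]
  · refine Finset.sum_congr rfl fun i hi => ?_
    rw [restrictTo_apply, if_pos hi, Real.norm_eq_abs, sq_abs]
  · intro i _ hi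
    simp [restrictTo_apply, hi]

lemma norm_map_le_of_almost_isometry {L : EuclideanSpace ℝ ι →ₗ[ℝ] F} {v : EuclideanSpace ℝ ι}
    (h : |‖L v‖ ^ 2 - ‖v‖ ^ 2| ≤ 1 / 4 * ‖v‖ ^ 2) : ‖L v‖ ≤ 6 / 5 * ‖v‖ := by
  refine le_of_sq_le_sq ?_ (by positivity)
  have := (abs_le.mp h).2
  rw [mul_pow]
  nlinarith [sq_nonneg ‖v‖]

lemma norm_le_norm_map_of_almost_isometry {L : EuclideanSpace ℝ ι →ₗ[ℝ] F}
    {v : EuclideanSpace ℝ ι} (h : |‖L v‖ ^ 2 - ‖v‖ ^ 2| ≤ 1 / 4 * ‖v‖ ^ 2) :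
    ‖v‖ ≤ 6 / 5 * ‖L v‖ := by
  refine le_of_sq_le_sq ?_ (by positivity)
  have := (abs_le.mp h).1
  rw [mul_pow]
  nlinarith [sq_nonneg ‖v‖]

/-- One step of iterative hard thresholding. Here `a` is the gradient step at `z` for the measurement
`L u + e`, and `z'` keeps the entries of `a` on a set `S` that carries at least as much energy of `a`
as the support of `u`. -/
lemma thresholding_step (L : EuclideanSpace ℝ ι →ₗ[ℝ] F) (R S T : Finset ι)
    (hL : ∀ v ∈ supportedIn (R : Set ι), |‖L v‖ ^ 2 - ‖v‖ ^ 2| ≤ 1 / 4 * ‖v‖ ^ 2)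
    (hS : S ⊆ R) (hT : T ⊆ R) {z u a z' : EuclideanSpace ℝ ι} {e : F}
    (hz : z ∈ supportedIn (R : Set ι)) (hu : u ∈ supportedIn (T : Set ι))
    (ha : ∀ y : EuclideanSpace ℝ ι, ⟪y, a⟫_ℝ = ⟪y, z⟫_ℝ + ⟪L y, L u + e - L z⟫_ℝ)
    (hz' : z' = restrictTo S a) (hen : ∑ i ∈ T, a i ^ 2 ≤ ∑ i ∈ S, a i ^ 2) :
    ‖z' - u‖ ≤ 1 / 2 * ‖z - u‖ + 3 * ‖e‖ := by
  have huR : u ∈ supportedIn (R : Set ι) := supportedIn_mono (by simpa using hT) hu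
  have huT : ∀ i, i ∉ T → u i = 0 := fun i hi => hu i (by simpa using hi)
  -- `z' - u = y - y'`, where the choice of `S` makes `y'` no longer than `y`, and `y` is short by the
  -- isometry property on the support `R` of all vectors involved
  set y := restrictTo (S ∪ T) (a - u) with hy
  set y' := restrictTo (T \ S) a with hy'
  have hyR : y ∈ supportedIn (R : Set ι) :=
    supportedIn_mono (Finset.coe_subset.mpr (Finset.union_subset hS hT)) (restrictTo_mem _ _)
  have hdiff : z' - u = y - y' := by
    ext i
    simp only [hz', hy, hy', PiLp.sub_apply, restrictTo_apply, Finset.mem_union, Finset.mem_sdiff]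
    by_cases h1 : i ∈ S <;> by_cases h2 : i ∈ T <;> simp [h1, h2]
    simp [huT i h2]
  have hle : ‖y'‖ ≤ ‖y‖ := by
    refine le_of_sq_le_sq ?_ (norm_nonneg _)
    rw [hy, hy', normSq_restrictTo, normSq_restrictTo]
    have e1 : ∑ i ∈ T \ S, a i ^ 2 - ∑ i ∈ S \ T, a i ^ 2 = ∑ i ∈ T, a i ^ 2 - ∑ i ∈ S, a i ^ 2 :=
      Finset.sum_sdiff_sub_sum_sdiff
    have e2 : ∑ i ∈ S \ T, a i ^ 2 ≤ ∑ i ∈ S ∪ T, (a - u) i ^ 2 := by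
      refine le_trans (le_of_eq (Finset.sum_congr rfl fun i hi => ?_))
        (Finset.sum_le_sum_of_subset_of_nonneg (f := fun i => (a - u) i ^ 2)
          (Finset.sdiff_subset.trans Finset.subset_union_left) fun i _ _ => sq_nonneg _)
      rw [PiLp.sub_apply, huT i (Finset.mem_sdiff.mp hi).2, sub_zero]
    linarith
  have hyy : ‖y‖ ^ 2 = ⟪y, a - u⟫_ℝ := by
    rw [← real_inner_self_eq_norm_sq, PiLp.inner_apply, PiLp.inner_apply]
    refine Finset.sum_congr rfl fun i _ => ?_
    rw [hy, restrictTo_apply]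
    split_ifs <;> simp
  have hzu : z - u ∈ supportedIn (R : Set ι) := Submodule.sub_mem _ hz huR
  have hpol := abs_inner_map_sub_le L _ hL hyR hzu
  have hLy := norm_map_le_of_almost_isometry (hL y hyR)
  have hcs := real_inner_le_norm (L y) e
  have hexp : ‖y‖ ^ 2 = -(⟪L y, L (z - u)⟫_ℝ - ⟪y, z - u⟫_ℝ) + ⟪L y, e⟫_ℝ := by
    rw [hyy, inner_sub_right, ha y, map_sub, inner_sub_right, inner_sub_right, inner_sub_right,
      inner_add_right]
    ring
  have hmain : ‖y‖ * ‖y‖ ≤ (1 / 4 * ‖z - u‖ + 6 / 5 * ‖e‖) * ‖y‖ := by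
    have h1 := (abs_le.mp hpol).1
    have h2 : ‖L y‖ * ‖e‖ ≤ 6 / 5 * ‖y‖ * ‖e‖ := by gcongr
    nlinarith
  have hyb : ‖y‖ ≤ 1 / 4 * ‖z - u‖ + 6 / 5 * ‖e‖ := by
    rcases (norm_nonneg y).eq_or_lt with h0 | h0
    · rw [← h0]; positivity
    · exact le_of_mul_le_mul_right hmain h0
  rw [hdiff]
  have := norm_sub_le y y'
  linarith [norm_nonneg e]

/-! ### The noise caused by the tail -/

lemma exists_top_subset (f : ι → ℝ) (Q : Finset ι) (g : ℕ) (hg : g ≤ Q.card) :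
    ∃ G ⊆ Q, G.card = g ∧ ∀ i ∈ G, ∀ j ∈ Q \ G, f j ≤ f i := by
  induction g with
  | zero => exact ⟨∅, by simp, by simp, by simp⟩
  | succ g ih =>
    obtain ⟨G, hGQ, hGc, hG⟩ := ih (by omega)
    have hne : (Q \ G).Nonempty := by
      rw [← Finset.card_pos, Finset.card_sdiff_of_subset hGQ]; omega
    obtain ⟨x, hx, hmax⟩ := Finset.exists_max_image (Q \ G) f hne
    have hx' := Finset.mem_sdiff.mp hx
    refine ⟨insert x G, Finset.insert_subset hx'.1 hGQ, ?_, ?_⟩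
    · rw [Finset.card_insert_of_notMem hx'.2, hGc]
    · intro i hi j hj
      have hj' := Finset.mem_sdiff.mp hj
      have hjG : j ∈ Q \ G :=
        Finset.mem_sdiff.mpr ⟨hj'.1, fun h => hj'.2 (Finset.mem_insert_of_mem h)⟩
      rcases Finset.mem_insert.mp hi with rfl | hi
      · exact hmax j hjG
      · exact hG i hi j hjG

/-- A map that is bounded on all `g`-sparse vectors is controlled by the `ℓ₁` norm and the maximum of
its argument: cut the vector into blocks of `g` entries in decreasing order. -/
lemma norm_map_le_of_blocks (L : EuclideanSpace ℝ ι →ₗ[ℝ] F) (g : ℕ) (hg : 1 ≤ g) {c : ℝ}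
    (hc : 0 ≤ c) (Q : Finset ι)
    (hL : ∀ G ⊆ Q, G.card ≤ g → ∀ v ∈ supportedIn (G : Set ι), ‖L v‖ ≤ c * ‖v‖)
    (v : EuclideanSpace ℝ ι) (M : ℝ) (hM : ∀ i ∈ Q, |v i| ≤ M) (hM0 : 0 ≤ M) :
    ‖L (restrictTo Q v)‖ ≤ c * (√g * M + (∑ i ∈ Q, |v i|) / √g) := by
  have hgp : (0 : ℝ) < g := by exact_mod_cast hg
  have hblock : ∀ G ⊆ Q, G.card ≤ g → ∀ M', 0 ≤ M' → (∀ i ∈ G, |v i| ≤ M') →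
      ‖L (restrictTo G v)‖ ≤ c * (√g * M') := by
    intro G hG hGc M' hM'0 hM'
    refine (hL G hG hGc _ (restrictTo_mem G v)).trans (mul_le_mul_of_nonneg_left ?_ hc)
    refine le_of_sq_le_sq ?_ (by positivity)
    rw [normSq_restrictTo, mul_pow, sq_sqrt hgp.le]
    calc ∑ i ∈ G, v i ^ 2 ≤ ∑ i ∈ G, M' ^ 2 := by
          refine Finset.sum_le_sum fun i hi => ?_
          rw [← sq_abs (v i)]
          exact pow_le_pow_left₀ (abs_nonneg _) (hM' i hi) 2
      _ = G.card * M' ^ 2 := by rw [Finset.sum_const, nsmul_eq_mul]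
      _ ≤ g * M' ^ 2 := by gcongr
  induction hn : Q.card using Nat.strong_induction_on generalizing Q M with
  | _ n ih =>
    by_cases hQ : Q.card ≤ g
    · refine (hblock Q subset_rfl hQ M hM0 hM).trans ?_
      have : 0 ≤ (∑ i ∈ Q, |v i|) / √g := by positivity
      exact mul_le_mul_of_nonneg_left (by linarith) hc
    · push Not at hQ
      obtain ⟨G, hGQ, hGc, hG⟩ := exists_top_subset (fun i => |v i|) Q g hQ.le
      have hGne : G.Nonempty := by rw [← Finset.card_pos]; omega
      obtain ⟨x, hx, hmin⟩ := Finset.exists_min_image G (fun i => |v i|) hGne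
      have hsum : g * |v x| ≤ ∑ i ∈ G, |v i| := by
        rw [← hGc, ← nsmul_eq_mul, ← Finset.sum_const]
        exact Finset.sum_le_sum hmin
      have hrec := ih (Q \ G).card (by
          rw [Finset.card_sdiff_of_subset hGQ]; omega) (Q \ G)
        (fun G' hG' => hL G' (hG'.trans Finset.sdiff_subset)) |v x|
        (fun j hj => hG x hx j hj) (abs_nonneg _)
        (fun G' hG' => hblock G' (hG'.trans Finset.sdiff_subset)) rfl
      have hfirst := hblock G hGQ hGc.le M hM0 fun i hi => hM i (hGQ hi)
      have hsplit : restrictTo Q v = restrictTo G v + restrictTo (Q \ G) v := by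
        ext i
        simp only [PiLp.add_apply, restrictTo_apply, Finset.mem_sdiff]
        by_cases h1 : i ∈ G
        · simp [h1, hGQ h1]
        · simp [h1]
      rw [hsplit, map_add]
      have htot : ∑ i ∈ Q, |v i| = ∑ i ∈ Q \ G, |v i| + ∑ i ∈ G, |v i| :=
        (Finset.sum_sdiff hGQ).symm
      -- the maximum over the next block is at most the mean over this one
      have hx2 : √g * |v x| ≤ (∑ i ∈ G, |v i|) / √g := by
        rw [le_div_iff₀ (sqrt_pos.mpr hgp)]
        calc √g * |v x| * √g = (√g * √g) * |v x| := by ring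
          _ = g * |v x| := by rw [mul_self_sqrt hgp.le]
          _ ≤ _ := hsum
      calc _ ≤ c * (√g * M) + c * (√g * |v x| + (∑ i ∈ Q \ G, |v i|) / √g) :=
            (norm_add_le _ _).trans (add_le_add hfirst hrec)
        _ ≤ c * (√g * M) + c * ((∑ i ∈ G, |v i|) / √g + (∑ i ∈ Q \ G, |v i|) / √g) := by
            gcongr
        _ = _ := by rw [htot]; ring

/-- After the removal of a suitable set of `g` entries, the measurement of the rest of a vector is
bounded by its `ℓ₁` norm divided by `√g`. -/
lemma exists_norm_map_tail_le (L : EuclideanSpace ℝ ι →ₗ[ℝ] F) (g : ℕ) (hg : 1 ≤ g) {c : ℝ}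
    (hc : 0 ≤ c) (Q : Finset ι)
    (hL : ∀ G ⊆ Q, G.card ≤ g → ∀ v ∈ supportedIn (G : Set ι), ‖L v‖ ≤ c * ‖v‖)
    (v : EuclideanSpace ℝ ι) :
    ∃ G ⊆ Q, G.card ≤ g ∧ ∀ P ⊆ Q \ G,
      ‖L (restrictTo P v)‖ ≤ 2 * c * (∑ i ∈ Q, |v i|) / √g := by
  have hgp : (0 : ℝ) < g := by exact_mod_cast hg
  by_cases hQ : Q.card ≤ g
  · refine ⟨Q, subset_rfl, hQ, fun P hP => ?_⟩
    rw [Finset.sdiff_self, Finset.subset_empty] at hP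
    have : restrictTo P v = 0 := by ext i; simp [restrictTo_apply, hP]
    rw [this, map_zero, norm_zero]
    positivity
  · push Not at hQ
    obtain ⟨G, hGQ, hGc, hG⟩ := exists_top_subset (fun i => |v i|) Q g hQ.le
    refine ⟨G, hGQ, hGc.le, fun P hP => ?_⟩
    have hS0 : 0 ≤ ∑ i ∈ Q, |v i| := Finset.sum_nonneg fun _ _ => abs_nonneg _
    -- an entry outside the top `g` is at most their mean
    have hM : ∀ i ∈ P, |v i| ≤ (∑ i ∈ Q, |v i|) / g := by
      intro i hi
      rw [le_div_iff₀ hgp, mul_comm]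
      calc g * |v i| = ∑ j ∈ G, |v i| := by rw [Finset.sum_const, hGc, nsmul_eq_mul]
        _ ≤ ∑ j ∈ G, |v j| := Finset.sum_le_sum fun j hj => hG j hj i (hP hi)
        _ ≤ _ := Finset.sum_le_sum_of_subset_of_nonneg hGQ fun _ _ _ => abs_nonneg _
    have h := norm_map_le_of_blocks L g hg hc P
      (fun G' hG' => hL G' (hG'.trans (hP.trans Finset.sdiff_subset))) v _ hM (by positivity)
    refine h.trans ?_
    have h1 : √g * ((∑ i ∈ Q, |v i|) / g) = (∑ i ∈ Q, |v i|) / √g := by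
      have h0 : √(g : ℝ) ≠ 0 := (sqrt_pos.mpr hgp).ne'
      rw [eq_div_iff h0]
      calc √g * ((∑ i ∈ Q, |v i|) / g) * √g = (√g * √g) * ((∑ i ∈ Q, |v i|) / g) := by ring
        _ = _ := by rw [mul_self_sqrt hgp.le]; field_simp
    have h2 : ∑ i ∈ P, |v i| ≤ ∑ i ∈ Q, |v i| :=
      Finset.sum_le_sum_of_subset_of_nonneg (hP.trans Finset.sdiff_subset)
        fun _ _ _ => abs_nonneg _
    calc _ ≤ c * ((∑ i ∈ Q, |v i|) / √g + (∑ i ∈ Q, |v i|) / √g) := by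
          rw [h1]; gcongr
      _ = _ := by ring

/-- The `ℓ₁` error of a sparse approximation `z` of `u`, from the tail of `u` and the Euclidean error on
the rest. -/
lemma sum_abs_sub_le (S T : Finset ι) (s : ℕ) (hS : S.card ≤ s) (hT : T.card ≤ s)
    {z u : EuclideanSpace ℝ ι} (hz : z ∈ supportedIn (S : Set ι)) :
    ∑ i, |u i - z i| ≤ ∑ i ∈ Finset.univ \ T, |u i| + √(2 * s) * ‖z - restrictTo T u‖ := by
  set d := z - restrictTo T u with hd
  have h1 : ∀ i, |u i - z i| ≤ (if i ∈ T then 0 else |u i|) + |d i| := by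
    intro i
    rw [hd, PiLp.sub_apply, restrictTo_apply]
    split_ifs
    · rw [zero_add, abs_sub_comm]
    · rw [sub_zero]; exact abs_sub _ _
  have h2 : ∑ i, |d i| ≤ √(2 * s) * ‖d‖ := by
    have h3 : ∑ i, |d i| = ∑ i ∈ S ∪ T, |d i| := by
      symm
      refine Finset.sum_subset (Finset.subset_univ _) fun i _ hi => ?_
      rw [Finset.mem_union, not_or] at hi
      rw [hd, PiLp.sub_apply, restrictTo_apply, if_neg hi.2, hz i (by simpa using hi.1)]
      simp
    have h4 := sq_sum_le_card_mul_sum_sq (s := S ∪ T) (f := fun i => |d i|)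
    have h5 : ((S ∪ T).card : ℝ) ≤ 2 * s := by
      have := Finset.card_union_le S T
      have : (S ∪ T).card ≤ 2 * s := by omega
      exact_mod_cast this
    rw [h3]
    refine le_of_sq_le_sq ?_ (by positivity)
    rw [mul_pow, sq_sqrt (by positivity), EuclideanSpace.norm_sq_eq]
    refine h4.trans (mul_le_mul h5 ?_ (by positivity) (by positivity))
    simp only [Real.norm_eq_abs]
    exact Finset.sum_le_sum_of_subset_of_nonneg (Finset.subset_univ _) fun _ _ _ => sq_nonneg _
  calc ∑ i, |u i - z i| ≤ ∑ i, ((if i ∈ T then 0 else |u i|) + |d i|) :=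
        Finset.sum_le_sum fun i _ => h1 i
    _ = ∑ i ∈ Finset.univ \ T, |u i| + ∑ i, |d i| := by
        rw [Finset.sum_add_distrib]
        congr 1
        rw [Finset.sum_ite, Finset.sum_const_zero, zero_add]
        refine Finset.sum_congr ?_ fun _ _ => rfl
        ext i; simp
    _ ≤ _ := by gcongr

lemma restrictTo_add_sdiff (T : Finset ι) (u : EuclideanSpace ℝ ι) :
    restrictTo T u + restrictTo (Finset.univ \ T) u = u := by
  ext i
  simp only [PiLp.add_apply, restrictTo_apply, Finset.mem_sdiff, Finset.mem_univ, true_and]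
  split_ifs <;> simp

/-- A sparse vector that explains the measurement as well as `u` does is close to `u`. -/
lemma norm_sub_le_of_residual_le (L : EuclideanSpace ℝ ι →ₗ[ℝ] F) {z u : EuclideanSpace ℝ ι}
    {e b : F} (hL : |‖L (z - u)‖ ^ 2 - ‖z - u‖ ^ 2| ≤ 1 / 4 * ‖z - u‖ ^ 2) (hb : b = L u + e)
    (hz : ‖b - L z‖ ≤ ‖e‖) : ‖z - u‖ ≤ 3 * ‖e‖ := by
  have h1 := norm_le_norm_map_of_almost_isometry hL
  have h2 : L (z - u) = e - (b - L z) := by rw [hb, map_sub]; abel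
  have h3 := norm_sub_le e (b - L z)
  rw [← h2] at h3
  linarith [norm_nonneg e]

/-- Least squares over finitely many coordinate subspaces. -/
lemma exists_best_sparse (L : EuclideanSpace ℝ ι →ₗ[ℝ] F) (𝒯 : Finset (Finset ι))
    (hne : 𝒯.Nonempty) (b : F) :
    ∃ S ∈ 𝒯, ∃ z ∈ supportedIn (S : Set ι), ∀ T ∈ 𝒯, ∀ u ∈ supportedIn (T : Set ι),
      ‖b - L z‖ ≤ ‖b - L u‖ := by
  have h1 : ∀ T : Finset ι, ∃ z ∈ supportedIn (T : Set ι), ∀ u ∈ supportedIn (T : Set ι),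
      ‖b - L z‖ ≤ ‖b - L u‖ := by
    intro T
    have hfin : FiniteDimensional ℝ ((supportedIn (T : Set ι)).map L) := inferInstance
    obtain ⟨p, hp, hmin⟩ := Submodule.exists_norm_eq_iInf_of_complete_subspace
      ((supportedIn (T : Set ι)).map L) (Submodule.complete_of_finiteDimensional _) b
    obtain ⟨z, hz, rfl⟩ := Submodule.mem_map.mp hp
    refine ⟨z, hz, fun u hu => ?_⟩
    rw [hmin]
    exact ciInf_le ⟨0, by rintro _ ⟨w, rfl⟩; exact norm_nonneg _⟩
      (⟨L u, Submodule.mem_map_of_mem hu⟩ : ((supportedIn (T : Set ι)).map L))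
  choose zz hzz hmin using h1
  obtain ⟨S, hS, hSmin⟩ := Finset.exists_min_image 𝒯 (fun T => ‖b - L (zz T)‖) hne
  exact ⟨S, hS, zz S, hzz S, fun T hT u hu => (hSmin T hT).trans (hmin T u hu)⟩

end Thresholding

end

/-! ### Bounds for the Earth-Mover norm -/

section

open Real

section EarthMover

variable {Δ : ℕ}

lemma pixelDist_nonneg (p q : Pixel Δ) : 0 ≤ pixelDist p q := by
  unfold pixelDist; positivity

lemma pixelDist_self (p : Pixel Δ) : pixelDist p p = 0 := by simp [pixelDist]

lemma pixelDist_comm (p q : Pixel Δ) : pixelDist p q = pixelDist q p := by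
  simp only [pixelDist, abs_sub_comm]

lemma pixelDist_triangle (p q r : Pixel Δ) : pixelDist p r ≤ pixelDist p q + pixelDist q r := by
  unfold pixelDist
  linarith [abs_sub_le ((p.1 : ℕ) : ℝ) ((q.1 : ℕ) : ℝ) ((r.1 : ℕ) : ℝ),
    abs_sub_le ((p.2 : ℕ) : ℝ) ((q.2 : ℕ) : ℝ) ((r.2 : ℕ) : ℝ)]

lemma pixelDist_le (p q : Pixel Δ) : pixelDist p q ≤ 2 * (Δ : ℝ) := by
  have h : ∀ a b : Fin Δ, |((a : ℕ) : ℝ) - ((b : ℕ) : ℝ)| ≤ Δ := by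
    intro a b
    have ha : ((a : ℕ) : ℝ) ≤ Δ := by exact_mod_cast a.2.le
    have hb : ((b : ℕ) : ℝ) ≤ Δ := by exact_mod_cast b.2.le
    rw [abs_le]
    constructor <;> linarith [Nat.cast_nonneg (α := ℝ) (a : ℕ), Nat.cast_nonneg (α := ℝ) (b : ℕ)]
  unfold pixelDist
  linarith [h p.1 q.1, h p.2 q.2]

lemma l1Norm_nonneg (x : Pixel Δ → ℝ) : 0 ≤ l1Norm x :=
  Finset.sum_nonneg fun _ _ => abs_nonneg _

lemma emdStar_nonneg (x y : Pixel Δ → ℝ) : 0 ≤ emdStar x y := by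
  refine Real.sInf_nonneg ?_
  rintro v ⟨γ, hγ, rfl⟩
  exact Finset.sum_nonneg fun p _ => Finset.sum_nonneg fun q _ =>
    mul_nonneg (hγ.1 p q) (pixelDist_nonneg p q)

/-- Vectors of equal mass are joined by a flow, namely the product flow. -/
lemma exists_isFlow {x y : Pixel Δ → ℝ} (hx : ∀ p, 0 ≤ x p) (hy : ∀ p, 0 ≤ y p)
    (h : l1Norm x = l1Norm y) : ∃ γ, IsFlow x y γ := by
  have hx1 : l1Norm x = ∑ p, x p := Finset.sum_congr rfl fun p _ => abs_of_nonneg (hx p)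
  have hy1 : l1Norm y = ∑ p, y p := Finset.sum_congr rfl fun p _ => abs_of_nonneg (hy p)
  have hs : ∑ p, x p = ∑ p, y p := by rw [← hx1, ← hy1, h]
  refine ⟨fun p q => x p * y q / ∑ p, x p, fun p q => ?_, fun p => ?_, fun q => ?_⟩
  · exact div_nonneg (mul_nonneg (hx p) (hy q)) (Finset.sum_nonneg fun p _ => hx p)
  · rw [← Finset.sum_div, ← Finset.mul_sum, ← hs]
    by_cases h0 : ∑ p, x p = 0
    · rw [(Finset.sum_eq_zero_iff_of_nonneg fun p _ => hx p).mp h0 p (Finset.mem_univ p)]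
      simp
    · field_simp
  · rw [← Finset.sum_div, ← Finset.sum_mul]
    by_cases h0 : ∑ p, x p = 0
    · have h0' := hs.symm.trans h0
      rw [(Finset.sum_eq_zero_iff_of_nonneg fun p _ => hy p).mp h0' q (Finset.mem_univ q)]
      simp
    · field_simp

/-- Kantorovich duality, the easy direction: a bounded potential that is `1`-Lipschitz bounds the
Earth-Mover norm from below. -/
lemma sum_mul_le_emdNorm (w φ : Pixel Δ → ℝ) (hlip : ∀ p q, φ p - φ q ≤ pixelDist p q)
    (hbd : ∀ p, |φ p| ≤ 2 * (Δ : ℝ)) : ∑ p, w p * φ p ≤ emdNorm w := by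
  -- the set of costs is nonempty by the decomposition `w = 0 - 0 + w`
  refine le_csInf ⟨_, 0, 0, w, fun _ => le_rfl, fun _ => le_rfl, rfl, by simp, rfl⟩ ?_
  rintro v ⟨x, y, z, hx, hy, hxy, rfl, rfl⟩
  have h1 : ∑ p, (x p - y p) * φ p ≤ emdStar x y := by
    obtain ⟨γ₀, hγ₀⟩ := exists_isFlow hx hy hxy
    refine le_csInf ⟨_, γ₀, hγ₀, rfl⟩ ?_
    rintro v ⟨γ, hγ, rfl⟩
    have e : ∑ p, (x p - y p) * φ p = ∑ p, ∑ q, γ p q * (φ p - φ q) := by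
      simp_rw [sub_mul, mul_sub, Finset.sum_sub_distrib]
      congr 1
      · refine Finset.sum_congr rfl fun p _ => ?_
        rw [← hγ.2.1 p, Finset.sum_mul]
      · rw [Finset.sum_comm]
        refine Finset.sum_congr rfl fun q _ => ?_
        rw [← hγ.2.2 q, Finset.sum_mul]
    rw [e]
    exact Finset.sum_le_sum fun p _ => Finset.sum_le_sum fun q _ =>
      mul_le_mul_of_nonneg_left (hlip p q) (hγ.1 p q)
  have h2 : ∑ p, z p * φ p ≤ 2 * (Δ : ℝ) * l1Norm z := by
    rw [l1Norm, Finset.mul_sum]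
    refine Finset.sum_le_sum fun p _ => (le_abs_self _).trans ?_
    rw [abs_mul, mul_comm]
    exact mul_le_mul_of_nonneg_right (hbd p) (abs_nonneg _)
  have e : ∑ p, (x - y + z) p * φ p = ∑ p, (x p - y p) * φ p + ∑ p, z p * φ p := by
    rw [← Finset.sum_add_distrib]
    exact Finset.sum_congr rfl fun p _ => by simp only [Pi.add_apply, Pi.sub_apply]; ring
  rw [e]
  exact add_le_add h1 h2

/-- The cost of a given flow, and of the mass that is not transported, bounds the Earth-Mover norm of its
divergence. -/
lemma emdNorm_le_of_flow (γ : Pixel Δ → Pixel Δ → ℝ) (hγ : ∀ p q, 0 ≤ γ p q)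
    (z : Pixel Δ → ℝ) :
    emdNorm (fun p => ∑ q, γ p q - ∑ q, γ q p + z p)
      ≤ ∑ p, ∑ q, γ p q * pixelDist p q + 2 * (Δ : ℝ) * l1Norm z := by
  have hx : ∀ p, 0 ≤ ∑ q, γ p q := fun p => Finset.sum_nonneg fun q _ => hγ p q
  have hy : ∀ p, 0 ≤ ∑ q, γ q p := fun p => Finset.sum_nonneg fun q _ => hγ q p
  have hmem : emdStar (fun p => ∑ q, γ p q) (fun p => ∑ q, γ q p) + 2 * (Δ : ℝ) * l1Norm z ∈
      {v : ℝ | ∃ x y z' : Pixel Δ → ℝ, (∀ p, 0 ≤ x p) ∧ (∀ p, 0 ≤ y p) ∧ l1Norm x = l1Norm y ∧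
        x - y + z' = (fun p => ∑ q, γ p q - ∑ q, γ q p + z p) ∧
        v = emdStar x y + 2 * (Δ : ℝ) * l1Norm z'} := by
    refine ⟨_, _, z, hx, hy, ?_, rfl, rfl⟩
    simp only [l1Norm]
    simp_rw [fun p => abs_of_nonneg (hx p), fun p => abs_of_nonneg (hy p)]
    exact Finset.sum_comm
  refine (csInf_le ⟨0, ?_⟩ hmem).trans (add_le_add_left (csInf_le ⟨0, ?_⟩ ?_) _)
  · rintro v ⟨x, y, z', -, -, -, -, rfl⟩
    have := emdStar_nonneg x y
    have := l1Norm_nonneg z'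
    positivity
  · rintro v ⟨γ', hγ', rfl⟩
    exact Finset.sum_nonneg fun p _ => Finset.sum_nonneg fun q _ =>
      mul_nonneg (hγ'.1 p q) (pixelDist_nonneg p q)
  · exact ⟨γ, ⟨hγ, fun _ => rfl, fun _ => rfl⟩, rfl⟩

/-- Moving the (signed) mass `c i` from the pixel `b i` to the pixel `a i` changes a vector by at most
the transport cost in the Earth-Mover norm. -/
lemma emdNorm_le_of_moves {ι : Type*} (S : Finset ι) (c : ι → ℝ) (a b : ι → Pixel Δ)
    (z : Pixel Δ → ℝ) :
    emdNorm (fun p => ∑ i ∈ S, c i * ((if a i = p then 1 else 0) - (if b i = p then 1 else 0))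
        + z p)
      ≤ ∑ i ∈ S, |c i| * pixelDist (a i) (b i) + 2 * (Δ : ℝ) * l1Norm z := by
  -- positive mass flows from `a i` to `b i`, negative mass the other way
  set γ : Pixel Δ → Pixel Δ → ℝ := fun p q => ∑ i ∈ S,
    ((if a i = p ∧ b i = q then max (c i) 0 else 0)
      + (if b i = p ∧ a i = q then max (-c i) 0 else 0)) with hγ
  have hγ0 : ∀ p q, 0 ≤ γ p q := by
    intro p q
    refine Finset.sum_nonneg fun i _ => ?_
    split_ifs <;> simp
  have key : ∀ f : Pixel Δ → Pixel Δ → ℝ, ∑ p, ∑ q, γ p q * f p q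
      = ∑ i ∈ S, (max (c i) 0 * f (a i) (b i) + max (-c i) 0 * f (b i) (a i)) := by
    intro f
    simp only [hγ, Finset.sum_mul]
    simp_rw [Finset.sum_comm (t := S)]
    refine Finset.sum_congr rfl fun i _ => ?_
    simp_rw [add_mul, Finset.sum_add_distrib, ite_mul, zero_mul, ite_and]
    simp [Finset.sum_ite_eq]
  have hmax : ∀ t : ℝ, max t 0 - max (-t) 0 = t := by
    intro t
    rcases le_total 0 t with h | h
    · rw [max_eq_left h, max_eq_right (by linarith), sub_zero]
    · rw [max_eq_right h, max_eq_left (by linarith)]; ring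
  have hmax' : ∀ t : ℝ, max t 0 + max (-t) 0 = |t| := by
    intro t
    rcases le_total 0 t with h | h
    · rw [max_eq_left h, max_eq_right (by linarith), add_zero, abs_of_nonneg h]
    · rw [max_eq_right h, max_eq_left (by linarith), zero_add, abs_of_nonpos h]
  have hw : (fun p => ∑ i ∈ S, c i * ((if a i = p then 1 else 0) - (if b i = p then 1 else 0))
        + z p) = fun p => ∑ q, γ p q - ∑ q, γ q p + z p := by
    funext r
    congr 1
    have e1 : ∑ q, γ r q = ∑ p, ∑ q, γ p q * (if p = r then 1 else 0) := by
      simp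
    have e2 : ∑ q, γ q r = ∑ p, ∑ q, γ p q * (if q = r then 1 else 0) := by
      simp
    rw [e1, e2, key, key, ← Finset.sum_sub_distrib]
    refine Finset.sum_congr rfl fun i _ => ?_
    linear_combination ((if b i = r then (1 : ℝ) else 0) - (if a i = r then (1 : ℝ) else 0))
      * hmax (c i)
  have hcost : ∑ p, ∑ q, γ p q * pixelDist p q = ∑ i ∈ S, |c i| * pixelDist (a i) (b i) := by
    rw [key]
    refine Finset.sum_congr rfl fun i _ => ?_
    rw [pixelDist_comm (b i), ← add_mul, hmax']
  rw [hw, ← hcost]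
  exact emdNorm_le_of_flow γ hγ0 z

end EarthMover

/-! ### The quadtree in Morton order -/

/-- `spread n` has the binary digits of `n` in the even places. -/
def spread (n : ℕ) : ℕ := if h : n = 0 then 0 else 4 * spread (n / 2) + n % 2
decreasing_by omega

lemma spread_eq (n : ℕ) : spread n = 4 * spread (n / 2) + n % 2 := by
  by_cases h : n = 0
  · subst h; simp [spread]
  · rw [spread, dif_neg h]

/-- The largest code of a number below `2 ^ t` is `(4 ^ t - 1) / 3`. -/
lemma spread_lt {n t : ℕ} (h : n < 2 ^ t) : 3 * spread n + 1 ≤ 4 ^ t := by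
  induction t generalizing n with
  | zero =>
    have : n = 0 := by simpa using h
    subst this; simp [spread]
  | succ t ih =>
    have h1 := ih (n := n / 2) (by rw [pow_succ] at h; omega)
    rw [spread_eq n, pow_succ]
    omega

lemma spread_pair_inj {i j i' j' : ℕ} (h : 2 * spread i + spread j = 2 * spread i' + spread j') :
    i = i' ∧ j = j' := by
  induction hn : i + j + i' + j' using Nat.strong_induction_on generalizing i j i' j' with
  | _ n ih =>
    by_cases h0 : n = 0
    · omega
    · rw [spread_eq i, spread_eq j, spread_eq i', spread_eq j'] at h
      have := ih (i / 2 + j / 2 + i' / 2 + j' / 2) (by omega) (i := i / 2) (j := j / 2)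
        (i' := i' / 2) (j' := j' / 2) (by omega) rfl
      omega

/-- The leaf of the pixel `(i, j)` in the heap whose leaves are `4 ^ h, …, 2 * 4 ^ h - 1`. Its ancestors
are the dyadic squares and rectangles (two squares side by side) that contain the pixel. -/
def leaf (h i j : ℕ) : ℕ := 4 ^ h + (2 * spread i + spread j)

/-- The ancestor of a leaf at height `2 * t` is the dyadic square of side length `2 ^ t`. -/
lemma leaf_div_pow {h t : ℕ} (ht : t ≤ h) (i j : ℕ) :
    leaf h i j / 4 ^ t = leaf (h - t) (i / 2 ^ t) (j / 2 ^ t) := by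
  induction t with
  | zero => simp
  | succ t ih =>
    rw [pow_succ, ← Nat.div_div_eq_div_mul, ih (by omega)]
    have e : h - t = (h - (t + 1)) + 1 := by omega
    rw [e, leaf, leaf, spread_eq (i / 2 ^ t), spread_eq (j / 2 ^ t), Nat.div_div_eq_div_mul,
      Nat.div_div_eq_div_mul, ← pow_succ, pow_succ 4]
    omega

lemma leaf_inj {h i j i' j' : ℕ} (e : leaf h i j = leaf h i' j') : i = i' ∧ j = j' :=
  spread_pair_inj (by unfold leaf at e; omega)

lemma leaf_ge (h i j : ℕ) : 4 ^ h ≤ leaf h i j := Nat.le_add_right _ _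

lemma leaf_lt {h i j : ℕ} (hi : i < 2 ^ h) (hj : j < 2 ^ h) : leaf h i j < 2 * 4 ^ h := by
  have := spread_lt hi
  have := spread_lt hj
  unfold leaf
  omega

/-- The height of node `v` above the leaves. -/
def nodeHeight (h v : ℕ) : ℕ := 2 * h - Nat.log 2 v

/-- The side length of the cell of node `v`; cells of odd height are rectangles. -/
def nodeWeight (h v : ℕ) : ℕ := 2 ^ ((nodeHeight h v + 1) / 2)

/-- The pixel `p` lies in the cell of the node `v`. -/
def InCell {Δ : ℕ} (h v : ℕ) (p : Pixel Δ) : Prop :=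
  leaf h p.1 p.2 / 2 ^ nodeHeight h v = v

instance {Δ : ℕ} (h v : ℕ) (p : Pixel Δ) : Decidable (InCell h v p) :=
  inferInstanceAs (Decidable (_ = _))

section Cells

variable {Δ h : ℕ}

lemma nodeHeight_le (h v : ℕ) : nodeHeight h v ≤ 2 * h := Nat.sub_le _ _

lemma log_leaf (hΔ : Δ ≤ 2 ^ h) (p : Pixel Δ) : Nat.log 2 (leaf h p.1 p.2) = 2 * h := by
  rw [Nat.log_eq_iff (Or.inr ⟨by norm_num, by
    have := leaf_ge h p.1 p.2
    have : 0 < 4 ^ h := by positivity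
    omega⟩)]
  have h1 := leaf_ge h p.1 p.2
  have h2 := leaf_lt (h := h) (p.1.2.trans_le hΔ) (p.2.2.trans_le hΔ)
  rw [pow_succ, pow_mul]
  norm_num
  omega

lemma nodeHeight_ancestor (hΔ : Δ ≤ 2 ^ h) (p : Pixel Δ) {j : ℕ} (hj : j ≤ 2 * h) :
    nodeHeight h (leaf h p.1 p.2 / 2 ^ j) = j := by
  have e : Nat.log 2 (leaf h p.1 p.2 / 2 ^ j) = 2 * h - j := by
    rw [Nat.log_div_base_pow, log_leaf hΔ]
  rw [nodeHeight, e]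
  omega

lemma inCell_ancestor (hΔ : Δ ≤ 2 ^ h) (p : Pixel Δ) {j : ℕ} (hj : j ≤ 2 * h) :
    InCell h (leaf h p.1 p.2 / 2 ^ j) p := by
  rw [InCell, nodeHeight_ancestor hΔ p hj]

lemma InCell.mem_Ico (hΔ : Δ ≤ 2 ^ h) {v : ℕ} {p : Pixel Δ} (hv : InCell h v p) :
    v ∈ Finset.Ico 1 (2 * 4 ^ h) := by
  have h1 := leaf_ge h p.1 p.2
  have h2 := leaf_lt (h := h) (p.1.2.trans_le hΔ) (p.2.2.trans_le hΔ)
  have h3 := nodeHeight_le h v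
  rw [InCell] at hv
  rw [Finset.mem_Ico, ← hv]
  refine ⟨?_, (Nat.div_le_self _ _).trans_lt h2⟩
  rw [Nat.one_le_div_iff (by positivity)]
  refine le_trans ?_ h1
  rw [show (4 : ℕ) = 2 ^ 2 by norm_num, ← pow_mul]
  exact Nat.pow_le_pow_right (by norm_num) h3

lemma nodeHeight_of_lt {v c : ℕ} (hv : 1 ≤ v) (hv' : v < 4 ^ h) (hc : c / 2 = v) :
    nodeHeight h v = nodeHeight h c + 1 := by
  have h1 : Nat.log 2 c = Nat.log 2 v + 1 := by
    rw [← hc, Nat.log_div_base]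
    have : 0 < Nat.log 2 c := Nat.log_pos (by norm_num) (by omega)
    omega
  have h2 : Nat.log 2 v < 2 * h := Nat.log_lt_of_lt_pow (by omega) (by
    rw [pow_mul]; exact hv')
  rw [nodeHeight, nodeHeight, h1]
  omega

lemma inCell_iff_children {v : ℕ} (hv : 1 ≤ v) (hv' : v < 4 ^ h) (p : Pixel Δ) :
    InCell h v p ↔ InCell h (2 * v) p ∨ InCell h (2 * v + 1) p := by
  have e1 := nodeHeight_of_lt (c := 2 * v) hv hv' (by omega)
  have e2 := nodeHeight_of_lt (c := 2 * v + 1) hv hv' (by omega)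
  have e3 : nodeHeight h (2 * v + 1) = nodeHeight h (2 * v) := by omega
  rw [InCell, InCell, InCell, e3, e1, pow_succ, ← Nat.div_div_eq_div_mul]
  omega

lemma InCell.parent (hΔ : Δ ≤ 2 ^ h) {v : ℕ} {p : Pixel Δ} (hv : InCell h v p) (h1 : 1 < v) :
    InCell h (v / 2) p := by
  have := Finset.mem_Ico.mp (hv.mem_Ico hΔ)
  rw [inCell_iff_children (by omega) (by omega)]
  rcases Nat.mod_two_eq_zero_or_one v with h2 | h2
  · left; rwa [show 2 * (v / 2) = v by omega]
  · right; rwa [show 2 * (v / 2) + 1 = v by omega]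

lemma InCell.div_eq {v t : ℕ} {p q : Pixel Δ} (hp : InCell h v p) (hq : InCell h v q)
    (ht : nodeHeight h v ≤ 2 * t) (hth : t ≤ h) :
    (p.1 : ℕ) / 2 ^ t = (q.1 : ℕ) / 2 ^ t ∧ (p.2 : ℕ) / 2 ^ t = (q.2 : ℕ) / 2 ^ t := by
  have e : ∀ p : Pixel Δ, InCell h v p → leaf h p.1 p.2 / 4 ^ t
      = v / 2 ^ (2 * t - nodeHeight h v) := by
    intro p hp
    have e1 : 2 * t = nodeHeight h v + (2 * t - nodeHeight h v) := by omega
    have e2 : (4 : ℕ) ^ t = 2 ^ (2 * t) := by rw [pow_mul]; norm_num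
    rw [e2, e1, pow_add, ← Nat.div_div_eq_div_mul, show _ / _ = v from hp, Nat.add_sub_cancel_left]
  have := (e p hp).trans (e q hq).symm
  rw [leaf_div_pow hth, leaf_div_pow hth] at this
  exact leaf_inj this

lemma abs_sub_le_of_div_eq {a b w : ℕ} (hw : 0 < w) (h : a / w = b / w) :
    |(a : ℝ) - b| ≤ w := by
  have h1 := Nat.div_add_mod a w
  have h2 := Nat.div_add_mod b w
  have h3 := Nat.mod_lt a hw
  have h4 := Nat.mod_lt b hw
  rw [h] at h1
  have h5 : (a : ℝ) ≤ b + w := by exact_mod_cast (by omega : a ≤ b + w)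
  have h6 : (b : ℝ) ≤ a + w := by exact_mod_cast (by omega : b ≤ a + w)
  rw [abs_le]
  constructor <;> linarith

lemma pixelDist_le_of_inCell {v : ℕ} {p q : Pixel Δ} (hp : InCell h v p) (hq : InCell h v q) :
    pixelDist p q ≤ 2 * nodeWeight h v := by
  have hh := nodeHeight_le h v
  obtain ⟨h1, h2⟩ := hp.div_eq hq (t := (nodeHeight h v + 1) / 2) (by omega) (by omega)
  have h3 := abs_sub_le_of_div_eq (by positivity) h1
  have h4 := abs_sub_le_of_div_eq (by positivity) h2
  unfold pixelDist nodeWeight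
  linarith

lemma nodeWeight_parent_le {v : ℕ} (h1 : 1 < v) (hv : v < 2 * 4 ^ h) :
    nodeWeight h (v / 2) ≤ 2 * nodeWeight h v := by
  rw [nodeWeight, nodeWeight, nodeHeight_of_lt (by omega) (by omega) rfl, ← pow_succ']
  exact Nat.pow_le_pow_right (by norm_num) (by omega)

end Cells

section Pyramid

variable {Δ h : ℕ}

/-- The mass of `x` in the cell of the node `v`. -/
noncomputable def cellMass (h : ℕ) (x : Pixel Δ → ℝ) (v : ℕ) : ℝ :=
  ∑ p, if InCell h v p then x p else 0

lemma cellMass_nonneg {x : Pixel Δ → ℝ} (hx : ∀ p, 0 ≤ x p) (v : ℕ) : 0 ≤ cellMass h x v :=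
  Finset.sum_nonneg fun p _ => by
    split_ifs
    exacts [hx p, le_rfl]

lemma cellMass_eq_zero_of_notMem (hΔ : Δ ≤ 2 ^ h) (x : Pixel Δ → ℝ) {v : ℕ}
    (hv : v ∉ Finset.Ico 1 (2 * 4 ^ h)) : cellMass h x v = 0 :=
  Finset.sum_eq_zero fun _ _ => if_neg fun hp => hv (hp.mem_Ico hΔ)

lemma cellMass_eq_add_children (x : Pixel Δ → ℝ) {v : ℕ} (hv : 1 ≤ v) (hv' : v < 4 ^ h) :
    cellMass h x v = cellMass h x (2 * v) + cellMass h x (2 * v + 1) := by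
  rw [cellMass, cellMass, cellMass, ← Finset.sum_add_distrib]
  refine Finset.sum_congr rfl fun p _ => ?_
  have e1 := nodeHeight_of_lt (c := 2 * v) hv hv' (by omega)
  have e2 := nodeHeight_of_lt (c := 2 * v + 1) hv hv' (by omega)
  have hex : ¬ (InCell h (2 * v) p ∧ InCell h (2 * v + 1) p) := by
    rintro ⟨h1, h2⟩
    rw [InCell] at h1 h2
    rw [show nodeHeight h (2 * v + 1) = nodeHeight h (2 * v) by omega, h1] at h2
    omega
  have := inCell_iff_children hv hv' p
  by_cases h1 : InCell h (2 * v) p <;> by_cases h2 : InCell h (2 * v + 1) p <;>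
    simp_all

/-- The number of the pixel `p` in row-major order. -/
def pixelIndex (p : Pixel Δ) : ℕ := (p.1 : ℕ) * Δ + (p.2 : ℕ)

lemma pixelIndex_inj {p q : Pixel Δ} (e : pixelIndex p = pixelIndex q) : p = q := by
  have hp := p.2.2
  have hq := q.2.2
  unfold pixelIndex at e
  have h1 : (p.1 : ℕ) = q.1 := by
    have : ((p.1 : ℕ) * Δ + p.2) / Δ = ((q.1 : ℕ) * Δ + q.2) / Δ := congrArg (· / Δ) e
    rwa [mul_comm, mul_comm (q.1 : ℕ), Nat.mul_add_div (by omega), Nat.mul_add_div (by omega),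
      Nat.div_eq_of_lt hp, Nat.div_eq_of_lt hq, add_zero, add_zero] at this
  have h2 : (p.2 : ℕ) = q.2 := by
    rw [h1] at e; omega
  exact Prod.ext (Fin.ext h1) (Fin.ext h2)

/-- `rep v` is one more than the number of a pixel in the cell of `v`, or zero if there is none. -/
def IsRep (Δ h : ℕ) (rep : ℕ → ℕ) : Prop :=
  ∀ v ∈ Finset.Ico 1 (2 * 4 ^ h),
    (rep v = 0 ∧ ∀ p : Pixel Δ, ¬ InCell h v p) ∨
      ∃ p : Pixel Δ, rep v = pixelIndex p + 1 ∧ InCell h v p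

/-- The image with the cell masses `Y`, as far as they are consistent: what the children of a node do
not account for is put on the representative of the node. -/
noncomputable def rebuild (h : ℕ) (rep : ℕ → ℕ) (Y : ℕ → ℝ) (q : ℕ) : ℝ :=
  ∑ v ∈ Finset.Ico 1 (2 * 4 ^ h),
    if rep v - 1 = q then Y v - (Y (2 * v) + Y (2 * v + 1)) else 0

lemma sum_children (f : ℕ → ℝ) (N : ℕ) :
    ∑ v ∈ Finset.Ico 1 N, (f (2 * v) + f (2 * v + 1)) = ∑ c ∈ Finset.Ico 2 (2 * N), f c := by
  induction N with
  | zero => simp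
  | succ N ih =>
    rcases Nat.eq_zero_or_pos N with rfl | hN
    · simp
    · rw [Finset.sum_Ico_succ_top hN, ih, show 2 * (N + 1) = 2 * N + 1 + 1 by ring,
        Finset.sum_Ico_succ_top (by omega), Finset.sum_Ico_succ_top (by omega)]
      ring

/-- Consistent masses are reproduced: only the leaf of the pixel contributes, since the masses of the
children of an inner node add up to its own mass. -/
lemma rebuild_cellMass (hΔ : Δ ≤ 2 ^ h) {rep : ℕ → ℕ} (hrep : IsRep Δ h rep) (x : Pixel Δ → ℝ)
    (p : Pixel Δ) : rebuild h rep (cellMass h x) (pixelIndex p) = x p := by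
  have hleafcell : InCell h (leaf h p.1 p.2) p := by
    have := inCell_ancestor hΔ p (j := 0) (by omega)
    simpa using this
  have hmem := hleafcell.mem_Ico hΔ
  have hzero : ∀ v, 4 ^ h ≤ v → cellMass h x (2 * v) + cellMass h x (2 * v + 1) = 0 := by
    intro v hv
    rw [cellMass_eq_zero_of_notMem hΔ x (by simp; omega),
      cellMass_eq_zero_of_notMem hΔ x (by simp; omega), add_zero]
  have hleafht : ∀ v, 4 ^ h ≤ v → nodeHeight h v = 0 := by
    intro v hv
    have : 2 * h ≤ Nat.log 2 v := Nat.le_log_of_pow_le (by norm_num) (by rw [pow_mul]; exact hv)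
    rw [nodeHeight]; omega
  have huniq : ∀ v, 4 ^ h ≤ v → ∀ q : Pixel Δ, InCell h v q → leaf h q.1 q.2 = v := by
    intro v hv q hq
    rw [InCell, hleafht v hv] at hq
    simpa using hq
  have hleafmass : cellMass h x (leaf h p.1 p.2) = x p := by
    rw [cellMass, Finset.sum_eq_single p]
    · rw [if_pos hleafcell]
    · intro q _ hq
      refine if_neg fun hc => hq ?_
      have := leaf_inj (huniq _ (leaf_ge h p.1 p.2) q hc)
      exact Prod.ext (Fin.ext this.1) (Fin.ext this.2)
    · simp
  rw [rebuild, Finset.sum_eq_single (leaf h p.1 p.2)]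
  · rcases hrep _ hmem with ⟨-, h2⟩ | ⟨q, h1, h2⟩
    · exact absurd hleafcell (h2 p)
    · have := leaf_inj (huniq _ (leaf_ge h p.1 p.2) q h2)
      have hqp : q = p := Prod.ext (Fin.ext this.1) (Fin.ext this.2)
      rw [h1, hqp, Nat.add_sub_cancel, if_pos rfl, hzero _ (leaf_ge h p.1 p.2), sub_zero, hleafmass]
  · intro v hv hne
    have hv' := Finset.mem_Ico.mp hv
    split_ifs with hr
    · by_cases hlt : v < 4 ^ h
      · rw [cellMass_eq_add_children x hv'.1 hlt, sub_self]
      · push Not at hlt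
        rw [hzero v hlt, sub_zero]
        rcases hrep v hv with ⟨-, h2⟩ | ⟨q, h1, h2⟩
        · exact Finset.sum_eq_zero fun q _ => if_neg (h2 q)
        · rw [h1, Nat.add_sub_cancel] at hr
          have := huniq v hlt q h2
          rw [pixelIndex_inj hr] at this
          exact absurd this.symm hne
    · rfl
  · exact fun hn => absurd hmem hn

/-- The weighted `ℓ₁` distance of the cell masses bounds the Earth-Mover distance of the image: an
error in the mass of a cell amounts to moving this mass between the representatives of the cell and of
its parent. -/
lemma emdNorm_sub_rebuild_le (hΔ : Δ ≤ 2 ^ h) (hΔ0 : 0 < Δ) {rep : ℕ → ℕ} (hrep : IsRep Δ h rep)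
    (x : Pixel Δ → ℝ) (Y : ℕ → ℝ) (hY : ∀ v, 2 * 4 ^ h ≤ v → Y v = 0)
    (hY0 : ∀ v, rep v = 0 → Y v = 0) :
    emdNorm (x - fun p => rebuild h rep Y (pixelIndex p))
      ≤ 4 * ∑ v ∈ Finset.Ico 1 (2 * 4 ^ h), (nodeWeight h v : ℝ) * |cellMass h x v - Y v| := by
  classical
  set N := 2 * 4 ^ h with hN
  have hN2 : 2 ≤ N := by have : 0 < 4 ^ h := by positivity
                         omega
  set e : ℕ → ℝ := fun v => cellMass h x v - Y v with he
  have he0 : ∀ v, v ∈ Finset.Ico 1 N → rep v = 0 → e v = 0 := by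
    intro v hv h0
    rcases hrep v hv with ⟨-, h2⟩ | ⟨q, h1, -⟩
    · simp only [he]
      rw [hY0 v h0, sub_zero]
      exact Finset.sum_eq_zero fun q _ => if_neg (h2 q)
    · omega
  have heN : ∀ v, N ≤ v → e v = 0 := by
    intro v hv
    simp only [he]
    rw [hY v hv, cellMass_eq_zero_of_notMem hΔ x (by simp; omega), sub_zero]
  -- the representative as a pixel; the value for an empty cell is arbitrary
  set pt : ℕ → Pixel Δ := fun v =>
    if hp : ∃ p : Pixel Δ, rep v = pixelIndex p + 1 ∧ InCell h v p then hp.choose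
    else (⟨0, hΔ0⟩, ⟨0, hΔ0⟩) with hpt
  have hpt_spec : ∀ v ∈ Finset.Ico 1 N, rep v ≠ 0 →
      rep v = pixelIndex (pt v) + 1 ∧ InCell h v (pt v) := by
    intro v hv h0
    rcases hrep v hv with ⟨h1, -⟩ | hp
    · exact absurd h1 h0
    · simp only [hpt, dif_pos hp]
      exact hp.choose_spec
  have hind : ∀ v ∈ Finset.Ico 1 N, rep v ≠ 0 → ∀ p : Pixel Δ,
      (if rep v - 1 = pixelIndex p then (1 : ℝ) else 0) = if pt v = p then 1 else 0 := by
    intro v hv h0 p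
    have h1 := (hpt_spec v hv h0).1
    rw [h1, Nat.add_sub_cancel]
    by_cases hc : pt v = p
    · rw [if_pos hc, if_pos (by rw [hc])]
    · rw [if_neg hc, if_neg fun h' => hc (pixelIndex_inj h')]
  -- a cell with a pixel has a parent cell with a pixel
  have hlive : ∀ v ∈ Finset.Ico 1 N, 1 < v → rep v ≠ 0 → rep (v / 2) ≠ 0 := by
    intro v hv h1 h0 h2
    have h3 := Finset.mem_Ico.mp hv
    have hin := (hpt_spec v hv h0).2.parent hΔ h1
    rcases hrep (v / 2) (hin.mem_Ico hΔ) with ⟨-, h4⟩ | ⟨q, h4, -⟩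
    · exact h4 _ hin
    · omega
  -- by linearity of `rebuild`, the error is a sum of moves from each cell to its parent, and of the error
  -- at the root, which is not transported
  have hlin : (x - fun p => rebuild h rep Y (pixelIndex p))
      = fun p => ∑ v ∈ Finset.Ico 2 N, e v * ((if pt v = p then 1 else 0)
          - (if pt (v / 2) = p then 1 else 0)) + (if pt 1 = p then e 1 else 0) := by
    funext p
    have e1 : (x - fun p : Pixel Δ => rebuild h rep Y (pixelIndex p)) p
        = rebuild h rep e (pixelIndex p) := by
      rw [Pi.sub_apply, ← rebuild_cellMass hΔ hrep x p, rebuild, rebuild, rebuild,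
        ← Finset.sum_sub_distrib]
      refine Finset.sum_congr rfl fun v _ => ?_
      simp only [he]
      split_ifs <;> ring
    set f : ℕ → ℝ := fun v => if rep v - 1 = pixelIndex p then (1 : ℝ) else 0 with hf
    have e2 : rebuild h rep e (pixelIndex p)
        = ∑ v ∈ Finset.Ico 1 N, e v * f v
          - ∑ v ∈ Finset.Ico 1 N, (e (2 * v) * f (2 * v / 2) + e (2 * v + 1) * f ((2 * v + 1) / 2)) := by
      rw [rebuild, ← Finset.sum_sub_distrib]
      refine Finset.sum_congr rfl fun v _ => ?_
      rw [show 2 * v / 2 = v by omega, show (2 * v + 1) / 2 = v by omega]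
      simp only [hf]
      split_ifs <;> ring
    have e3 : ∑ c ∈ Finset.Ico 2 (2 * N), e c * f (c / 2) = ∑ c ∈ Finset.Ico 2 N, e c * f (c / 2) := by
      symm
      refine Finset.sum_subset (Finset.Ico_subset_Ico_right (by omega)) fun c hc hc' => ?_
      rw [Finset.mem_Ico] at hc hc'
      rw [heN c (by omega), zero_mul]
    rw [e1, e2, sum_children (fun c => e c * f (c / 2)), e3,
      Finset.sum_eq_sum_Ico_succ_bot (by omega : 1 < N), add_sub_assoc, ← Finset.sum_sub_distrib,
      add_comm]
    congr 1
    · refine Finset.sum_congr rfl fun v hv => ?_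
      have hv2 := Finset.mem_Ico.mp hv
      have hv' : v ∈ Finset.Ico 1 N := Finset.mem_Ico.mpr ⟨by omega, by omega⟩
      by_cases h0 : rep v = 0
      · rw [he0 v hv' h0]; ring
      · have h2 := hlive v hv' (by omega) h0
        simp only [hf]
        rw [hind v hv' h0 p, hind (v / 2) (Finset.mem_Ico.mpr ⟨by omega, by omega⟩) h2 p]
        ring
    · have h1 : 1 ∈ Finset.Ico 1 N := Finset.mem_Ico.mpr ⟨le_rfl, by omega⟩
      by_cases h0 : rep 1 = 0
      · rw [he0 1 h1 h0]; simp
      · simp only [hf]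
        rw [hind 1 h1 h0 p]; simp
  rw [hlin]
  refine (emdNorm_le_of_moves _ _ _ _ _).trans ?_
  have hroot : l1Norm (fun p => if pt 1 = p then e 1 else 0) = |e 1| := by
    rw [l1Norm, Finset.sum_eq_single (pt 1)]
    · simp
    · intro q _ hq
      simp [Ne.symm hq]
    · simp
  have hw1 : (2 : ℝ) * Δ ≤ 4 * nodeWeight h 1 := by
    have : nodeWeight h 1 = 2 ^ h := by
      rw [nodeWeight, nodeHeight]
      simp only [Nat.log_one_right]
      congr 1; omega
    rw [this]
    have : (Δ : ℝ) ≤ ((2 ^ h : ℕ) : ℝ) := by exact_mod_cast hΔ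
    have h0 : (0 : ℝ) ≤ ((2 ^ h : ℕ) : ℝ) := Nat.cast_nonneg _
    linarith
  have hmoves : ∑ v ∈ Finset.Ico 2 N, |e v| * pixelDist (pt v) (pt (v / 2))
      ≤ ∑ v ∈ Finset.Ico 2 N, 4 * ((nodeWeight h v : ℝ) * |e v|) := by
    refine Finset.sum_le_sum fun v hv => ?_
    have hv2 := Finset.mem_Ico.mp hv
    have hv' : v ∈ Finset.Ico 1 N := Finset.mem_Ico.mpr ⟨by omega, by omega⟩
    by_cases h0 : rep v = 0
    · rw [he0 v hv' h0]; simp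
    · have h2 := hlive v hv' (by omega) h0
      have h3 := ((hpt_spec v hv' h0).2).parent hΔ (by omega)
      have h4 := (hpt_spec (v / 2) (Finset.mem_Ico.mpr ⟨by omega, by omega⟩) h2).2
      have h5 := pixelDist_le_of_inCell h3 h4
      have h6 : (nodeWeight h (v / 2) : ℝ) ≤ 2 * nodeWeight h v := by
        exact_mod_cast nodeWeight_parent_le (by omega) hv2.2
      calc |e v| * pixelDist (pt v) (pt (v / 2)) ≤ |e v| * (4 * nodeWeight h v) := by
            gcongr; linarith
        _ = _ := by ring
  rw [hroot, Finset.sum_eq_sum_Ico_succ_bot (by omega : 1 < N), mul_add, Finset.mul_sum]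
  have : 2 * (Δ : ℝ) * |e 1| ≤ 4 * ((nodeWeight h 1 : ℝ) * |e 1|) := by
    rw [← mul_assoc]; gcongr
  linarith

end Pyramid

end

/-! ### The tree of a sparse approximation -/

section

open Real
open scoped InnerProductSpace

/-- The number of levels of the heap with the nodes `1, …, N - 1` below the first `κ` nodes, up to a
constant. -/
def levelCount (N κ : ℕ) : ℕ := Nat.log 2 (N / κ) + 2

/-- After `levelCount N κ - 1` steps towards the root every node is among the first `κ`. -/
lemma div_pow_levelCount_lt {N κ g : ℕ} (hκ : 1 ≤ κ) (hg : g < N) :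
    g / 2 ^ (levelCount N κ - 1) < κ := by
  rw [levelCount, show Nat.log 2 (N / κ) + 2 - 1 = Nat.log 2 (N / κ) + 1 by omega,
    Nat.div_lt_iff_lt_mul (by positivity)]
  have h1 : N / κ < 2 ^ (Nat.log 2 (N / κ) + 1) := Nat.lt_pow_succ_log_self (by norm_num) _
  have h2 := Nat.div_add_mod N κ
  have h3 := Nat.mod_lt N hκ
  calc g < N := hg
    _ < κ * (N / κ + 1) := by rw [mul_add]; omega
    _ ≤ _ := Nat.mul_le_mul_left _ h1

open Classical in
/-- The first `κ` nodes of the heap and the ancestors of the members of `G` below them. -/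
noncomputable def pathClosure (N κ : ℕ) (G : Finset ℕ) : Finset ℕ :=
  (Finset.Ico 1 N).filter fun v => v < κ ∨ ∃ g ∈ G, ∃ j < levelCount N κ, v = g / 2 ^ j

lemma heapTree_pathClosure {N κ : ℕ} (hκ : 1 ≤ κ) {G : Finset ℕ} (hG : G ⊆ Finset.Ico 1 N) :
    HeapTree N (pathClosure N κ G) := by
  refine ⟨Finset.filter_subset _ _, fun v hv h1 => ?_⟩
  obtain ⟨hv1, hv2⟩ := Finset.mem_filter.mp hv
  have hv3 := Finset.mem_Ico.mp hv1
  refine Finset.mem_filter.mpr ⟨Finset.mem_Ico.mpr ⟨by omega, by omega⟩, ?_⟩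
  rcases hv2 with h2 | ⟨g, hg, j, hj, rfl⟩
  · left; omega
  · by_cases hj' : j + 1 < levelCount N κ
    · exact Or.inr ⟨g, hg, j + 1, hj', by rw [pow_succ, Nat.div_div_eq_div_mul]⟩
    · left
      have := div_pow_levelCount_lt hκ (Finset.mem_Ico.mp (hG hg)).2
      rw [show levelCount N κ - 1 = j by omega] at this
      omega

lemma subset_pathClosure {N κ : ℕ} {G : Finset ℕ} (hG : G ⊆ Finset.Ico 1 N) :
    G ⊆ pathClosure N κ G := fun g hg =>
  Finset.mem_filter.mpr ⟨hG hg, Or.inr ⟨g, hg, 0, by unfold levelCount; omega, by simp⟩⟩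

lemma card_pathClosure_le (N κ : ℕ) (G : Finset ℕ) :
    (pathClosure N κ G).card ≤ κ + G.card * levelCount N κ := by
  classical
  have hsub : pathClosure N κ G ⊆ Finset.range κ ∪
      (G ×ˢ Finset.range (levelCount N κ)).image fun q => q.1 / 2 ^ q.2 := by
    intro v hv
    rcases (Finset.mem_filter.mp hv).2 with h | ⟨g, hg, j, hj, rfl⟩
    · exact Finset.mem_union_left _ (Finset.mem_range.mpr h)
    · exact Finset.mem_union_right _ (Finset.mem_image.mpr
        ⟨(g, j), Finset.mem_product.mpr ⟨hg, Finset.mem_range.mpr hj⟩, rfl⟩)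
  refine (Finset.card_le_card hsub).trans ((Finset.card_union_le _ _).trans ?_)
  rw [Finset.card_range]
  refine Nat.add_le_add_left (Finset.card_image_le.trans ?_) _
  rw [Finset.card_product, Finset.card_range]

section Model

variable {Δ h : ℕ}

open Classical in
/-- The first `κ` nodes and all nodes whose cell contains a pixel within `ρ` side lengths of one of the
centres `C`. -/
noncomputable def nearTree (h κ ρ : ℕ) (C : Finset (Pixel Δ)) : Finset ℕ :=
  (Finset.Ico 1 (2 * 4 ^ h)).filter fun v => v < κ ∨
    ∃ c ∈ C, ∃ p : Pixel Δ, InCell h v p ∧ pixelDist p c ≤ ρ * nodeWeight h v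

lemma heapTree_nearTree (hΔ : Δ ≤ 2 ^ h) (κ ρ : ℕ) (C : Finset (Pixel Δ)) :
    HeapTree (2 * 4 ^ h) (nearTree h κ ρ C) := by
  refine ⟨Finset.filter_subset _ _, fun v hv h1 => ?_⟩
  obtain ⟨hv1, hv2⟩ := Finset.mem_filter.mp hv
  have hv3 := Finset.mem_Ico.mp hv1
  refine Finset.mem_filter.mpr ⟨Finset.mem_Ico.mpr ⟨by omega, by omega⟩, ?_⟩
  rcases hv2 with h2 | ⟨c, hc, p, hp, hd⟩
  · left; omega
  · refine Or.inr ⟨c, hc, p, hp.parent hΔ h1, hd.trans ?_⟩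
    have : nodeWeight h v ≤ nodeWeight h (v / 2) := by
      rw [nodeWeight, nodeWeight, nodeHeight_of_lt (by omega) (by omega) rfl]
      exact Nat.pow_le_pow_right (by norm_num) (by omega)
    gcongr

/-- At every height only `25 * ρ ^ 2` cells are within `ρ` side lengths of a given pixel. -/
lemma exists_near_cells {ρ : ℕ} (hρ : 1 ≤ ρ) (c : Pixel Δ) (j : ℕ) :
    ∃ S : Finset ℕ, S.card ≤ 25 * ρ ^ 2 ∧ ∀ v, nodeHeight h v = j → ∀ p : Pixel Δ,
      InCell h v p → pixelDist p c ≤ ρ * nodeWeight h v → v ∈ S := by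
  classical
  set t := j / 2 with ht
  -- the range of the coordinates of the cells, in units of the side length
  set I : ℕ → Finset ℕ := fun a => Finset.Icc (a / 2 ^ t - 2 * ρ) (a / 2 ^ t + 2 * ρ) with hI
  have hIc : ∀ a, (I a).card ≤ 5 * ρ := by
    intro a
    rw [hI, Nat.card_Icc]
    omega
  refine ⟨(I c.1 ×ˢ I c.2).image fun q => leaf (h - t) q.1 q.2 / 2 ^ (j - 2 * t), ?_, ?_⟩
  · refine Finset.card_image_le.trans ?_
    rw [Finset.card_product]
    calc _ ≤ (5 * ρ) * (5 * ρ) := Nat.mul_le_mul (hIc _) (hIc _)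
      _ = _ := by ring
  · intro v hv p hp hd
    have hj := nodeHeight_le h v
    have hmemI : ∀ a b : ℕ, |(a : ℝ) - b| ≤ ρ * nodeWeight h v → a / 2 ^ t ∈ I b := by
      intro a b hab
      have hw : nodeWeight h v ≤ 2 * 2 ^ t := by
        rw [nodeWeight, hv, ← pow_succ']
        exact Nat.pow_le_pow_right (by norm_num) (by omega)
      have h1 : ρ * nodeWeight h v ≤ 2 ^ t * (2 * ρ) := by
        calc _ ≤ ρ * (2 * 2 ^ t) := Nat.mul_le_mul_left _ hw
          _ = _ := by ring
      have h2 := abs_le.mp hab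
      have h3 : a ≤ b + 2 ^ t * (2 * ρ) := by
        have : (a : ℝ) ≤ ((b + ρ * nodeWeight h v : ℕ) : ℝ) := by push_cast; linarith
        have : a ≤ b + ρ * nodeWeight h v := by exact_mod_cast this
        omega
      have h4 : b ≤ a + 2 ^ t * (2 * ρ) := by
        have : (b : ℝ) ≤ ((a + ρ * nodeWeight h v : ℕ) : ℝ) := by push_cast; linarith
        have : b ≤ a + ρ * nodeWeight h v := by exact_mod_cast this
        omega
      have hp : 0 < 2 ^ t := by positivity
      have h5 := Nat.div_le_div_right (c := 2 ^ t) h3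
      have h6 := Nat.div_le_div_right (c := 2 ^ t) h4
      rw [Nat.add_mul_div_left _ _ hp] at h5 h6
      rw [hI, Finset.mem_Icc]
      generalize a / 2 ^ t = u at *
      generalize b / 2 ^ t = w at *
      omega
    have hd1 : |((p.1 : ℕ) : ℝ) - ((c.1 : ℕ) : ℝ)| ≤ ρ * nodeWeight h v :=
      le_trans (by unfold pixelDist; linarith [abs_nonneg (((p.2 : ℕ) : ℝ) - ((c.2 : ℕ) : ℝ))]) hd
    have hd2 : |((p.2 : ℕ) : ℝ) - ((c.2 : ℕ) : ℝ)| ≤ ρ * nodeWeight h v :=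
      le_trans (by unfold pixelDist; linarith [abs_nonneg (((p.1 : ℕ) : ℝ) - ((c.1 : ℕ) : ℝ))]) hd
    refine Finset.mem_image.mpr ⟨((p.1 : ℕ) / 2 ^ t, (p.2 : ℕ) / 2 ^ t),
      Finset.mem_product.mpr ⟨hmemI _ _ hd1, hmemI _ _ hd2⟩, ?_⟩
    simp only
    rw [← leaf_div_pow (by omega), Nat.div_div_eq_div_mul, show (4 : ℕ) ^ t = 2 ^ (2 * t) by
      rw [pow_mul]; norm_num, ← pow_add, show 2 * t + (j - 2 * t) = j by omega]
    rw [InCell, hv] at hp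
    exact hp

lemma nodeHeight_lt_levelCount {κ v : ℕ} (hκ : 1 ≤ κ) (hv : κ ≤ v) (hvN : v < 2 * 4 ^ h) :
    nodeHeight h v < levelCount (2 * 4 ^ h) κ := by
  have h1 : v < 2 ^ (Nat.log 2 v + 1) := Nat.lt_pow_succ_log_self (by norm_num) _
  have h2 : Nat.log 2 v ≤ 2 * h := by
    have : Nat.log 2 v < 2 * h + 1 := Nat.log_lt_of_lt_pow (by omega) (by
      rw [pow_succ, pow_mul]; norm_num; omega)
    omega
  have h3 : κ * 2 ^ nodeHeight h v ≤ 2 * 4 ^ h := by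
    calc κ * 2 ^ nodeHeight h v ≤ 2 ^ (Nat.log 2 v + 1) * 2 ^ nodeHeight h v :=
          Nat.mul_le_mul_right _ (hv.trans h1.le)
      _ = 2 * 4 ^ h := by
          rw [← pow_add, nodeHeight, show Nat.log 2 v + 1 + (2 * h - Nat.log 2 v) = 2 * h + 1 by omega,
            pow_succ, pow_mul]
          norm_num [mul_comm]
  have h4 : 2 ^ nodeHeight h v ≤ 2 * 4 ^ h / κ := by
    rw [Nat.le_div_iff_mul_le hκ, mul_comm]; exact h3
  have h5 := Nat.le_log_of_pow_le (by norm_num) h4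
  rw [levelCount]
  omega

lemma card_nearTree_le {κ ρ k : ℕ} (hρ : 1 ≤ ρ) (hκ : 1 ≤ κ)
    {C : Finset (Pixel Δ)} (hC : C.card ≤ k) :
    (nearTree h κ ρ C).card ≤ κ + k * (levelCount (2 * 4 ^ h) κ * (25 * ρ ^ 2)) := by
  classical
  choose S hS hSmem using fun (c : Pixel Δ) (j : ℕ) => exists_near_cells (h := h) hρ c j
  have hsub : nearTree h κ ρ C ⊆ Finset.range κ ∪
      C.biUnion fun c => (Finset.range (levelCount (2 * 4 ^ h) κ)).biUnion fun j => S c j := by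
    intro v hv
    obtain ⟨hv1, hv2⟩ := Finset.mem_filter.mp hv
    by_cases hvκ : v < κ
    · exact Finset.mem_union_left _ (Finset.mem_range.mpr hvκ)
    · obtain ⟨c, hc, p, hp, hd⟩ := hv2.resolve_left hvκ
      exact Finset.mem_union_right _ (Finset.mem_biUnion.mpr ⟨c, hc, Finset.mem_biUnion.mpr
        ⟨nodeHeight h v, Finset.mem_range.mpr (nodeHeight_lt_levelCount hκ (by omega)
          (Finset.mem_Ico.mp hv1).2), hSmem c _ v rfl p hp hd⟩⟩)
  refine (Finset.card_le_card hsub).trans ((Finset.card_union_le _ _).trans ?_)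
  rw [Finset.card_range]
  refine Nat.add_le_add_left (Finset.card_biUnion_le.trans ?_) _
  calc _ ≤ ∑ c ∈ C, levelCount (2 * 4 ^ h) κ * (25 * ρ ^ 2) := by
        refine Finset.sum_le_sum fun c _ => Finset.card_biUnion_le.trans ?_
        refine (Finset.sum_le_sum fun j _ => hS c j).trans ?_
        simp
    _ = C.card * (levelCount (2 * 4 ^ h) κ * (25 * ρ ^ 2)) := by simp
    _ ≤ _ := Nat.mul_le_mul_right _ hC

/-- The distance of a pixel from the nearest centre. -/
noncomputable def centreDist (C : Finset (Pixel Δ)) (hC : C.Nonempty) (p : Pixel Δ) : ℝ :=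
  C.inf' hC (pixelDist p)

lemma centreDist_nonneg (C : Finset (Pixel Δ)) (hC : C.Nonempty) (p : Pixel Δ) :
    0 ≤ centreDist C hC p :=
  (Finset.le_inf'_iff hC _).mpr fun c _ => pixelDist_nonneg p c

lemma centreDist_of_mem {C : Finset (Pixel Δ)} (hC : C.Nonempty) {p : Pixel Δ} (hp : p ∈ C) :
    centreDist C hC p = 0 :=
  le_antisymm ((Finset.inf'_le _ hp).trans_eq (pixelDist_self p)) (centreDist_nonneg C hC p)

/-- The distance to the support of `x'` is a potential that bounds the distance from `x` to `x'`. -/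
lemma sum_mul_centreDist_le_emdNorm {C : Finset (Pixel Δ)} (hC : C.Nonempty) (x x' : Pixel Δ → ℝ)
    (hx' : ∀ p, p ∉ C → x' p = 0) : ∑ p, x p * centreDist C hC p ≤ emdNorm (x - x') := by
  refine le_trans (le_of_eq ?_) (sum_mul_le_emdNorm (x - x') (centreDist C hC) ?_ ?_)
  · refine Finset.sum_congr rfl fun p _ => ?_
    rw [Pi.sub_apply]
    by_cases hp : p ∈ C
    · rw [centreDist_of_mem hC hp]; simp
    · rw [hx' p hp, sub_zero]
  · intro p q
    obtain ⟨c, hc, hmin⟩ := Finset.exists_mem_eq_inf' hC (pixelDist q)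
    have h1 : centreDist C hC p ≤ pixelDist p c := Finset.inf'_le _ hc
    have h2 : centreDist C hC q = pixelDist q c := hmin
    linarith [pixelDist_triangle p q c]
  · intro p
    rw [abs_of_nonneg (centreDist_nonneg C hC p)]
    obtain ⟨c, hc⟩ := hC
    exact (Finset.inf'_le _ hc).trans (pixelDist_le p c)

/-- The sum of the side lengths of the cells of height at most `J` around a pixel. -/
lemma sum_range_two_pow_half_le (J : ℕ) :
    ∑ j ∈ Finset.range (J + 1), (2 : ℝ) ^ ((j + 1) / 2) ≤ 4 * 2 ^ ((J + 1) / 2) := by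
  have h1 : ∀ q : ℕ, ∑ j ∈ Finset.range (2 * q + 1), (2 : ℝ) ^ ((j + 1) / 2) = 4 * 2 ^ q - 3 := by
    intro q
    induction q with
    | zero => norm_num
    | succ q ih =>
      rw [show 2 * (q + 1) + 1 = 2 * q + 1 + 1 + 1 by ring, Finset.sum_range_succ,
        Finset.sum_range_succ, ih, show (2 * q + 1 + 1) / 2 = q + 1 by omega,
        show (2 * q + 1 + 1 + 1) / 2 = q + 1 by omega, pow_succ]
      ring
  rcases Nat.even_or_odd' J with ⟨q, rfl | rfl⟩
  · rw [h1, show (2 * q + 1) / 2 = q by omega]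
    linarith
  · rw [Finset.sum_range_succ, h1, show (2 * q + 1 + 1) / 2 = q + 1 by omega, pow_succ]
    have : (0 : ℝ) < 2 ^ q := by positivity
    linarith

lemma sum_filter_two_pow_half_le (n : ℕ) {X : ℝ} (hX : 0 ≤ X) :
    ∑ j ∈ (Finset.range n).filter (fun j => (2 : ℝ) ^ ((j + 1) / 2) < X), (2 : ℝ) ^ ((j + 1) / 2)
      ≤ 4 * X := by
  rcases Finset.eq_empty_or_nonempty
    ((Finset.range n).filter (fun j => (2 : ℝ) ^ ((j + 1) / 2) < X)) with he | hne
  · rw [he]; simp; linarith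
  · have hmax := Finset.max'_mem _ hne
    set J := Finset.max' _ hne
    have hJ := (Finset.mem_filter.mp hmax).2
    have hsub : (Finset.range n).filter (fun j => (2 : ℝ) ^ ((j + 1) / 2) < X)
        ⊆ Finset.range (J + 1) := fun j hj =>
      Finset.mem_range.mpr (Nat.lt_succ_of_le (Finset.le_max' _ j hj))
    refine (Finset.sum_le_sum_of_subset_of_nonneg hsub fun _ _ _ => by positivity).trans ?_
    exact (sum_range_two_pow_half_le J).trans (by linarith)

/-- The weight outside the tree is small: a pixel at distance `d` from the centres contributes only
through the cells that contain it and have side length less than `d / ρ`. -/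
lemma sum_weight_notMem_nearTree_le {κ ρ : ℕ} (hρ : 1 ≤ ρ) {C : Finset (Pixel Δ)}
    (hC : C.Nonempty) {x : Pixel Δ → ℝ} (hx : ∀ p, 0 ≤ x p) :
    ∑ v ∈ Finset.Ico 1 (2 * 4 ^ h) \ nearTree h κ ρ C, (nodeWeight h v : ℝ) * cellMass h x v
      ≤ 4 / ρ * ∑ p, x p * centreDist C hC p := by
  classical
  have hρ0 : (0 : ℝ) < ρ := by exact_mod_cast hρ
  have e : ∑ v ∈ Finset.Ico 1 (2 * 4 ^ h) \ nearTree h κ ρ C, (nodeWeight h v : ℝ) * cellMass h x v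
      = ∑ p, x p * ∑ v ∈ (Finset.Ico 1 (2 * 4 ^ h) \ nearTree h κ ρ C).filter (fun v => InCell h v p),
          (nodeWeight h v : ℝ) := by
    simp_rw [cellMass, Finset.mul_sum, Finset.sum_filter]
    rw [Finset.sum_comm]
    refine Finset.sum_congr rfl fun p _ => Finset.sum_congr rfl fun v _ => ?_
    split_ifs <;> ring
  rw [e, Finset.mul_sum]
  refine Finset.sum_le_sum fun p _ => ?_
  have hdiv : 0 ≤ centreDist C hC p / ρ := div_nonneg (centreDist_nonneg C hC p) hρ0.le
  have key : ∑ v ∈ (Finset.Ico 1 (2 * 4 ^ h) \ nearTree h κ ρ C).filter (fun v => InCell h v p),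
      (nodeWeight h v : ℝ) ≤ 4 * (centreDist C hC p / ρ) := by
    refine le_trans ?_ (sum_filter_two_pow_half_le (2 * h + 1) hdiv)
    set V := (Finset.Ico 1 (2 * 4 ^ h) \ nearTree h κ ρ C).filter (fun v => InCell h v p) with hV
    -- the cells around `p` are determined by their heights
    have hinj : Set.InjOn (nodeHeight h) (V : Set ℕ) := by
      intro v hv w hw hvw
      have h1 : leaf h p.1 p.2 / 2 ^ nodeHeight h v = v := (Finset.mem_filter.mp hv).2
      have h2 : leaf h p.1 p.2 / 2 ^ nodeHeight h w = w := (Finset.mem_filter.mp hw).2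
      rw [← h1, ← h2, hvw]
    have e2 : ∑ v ∈ V, (nodeWeight h v : ℝ) = ∑ j ∈ V.image (nodeHeight h), (2 : ℝ) ^ ((j + 1) / 2) := by
      rw [Finset.sum_image hinj]
      refine Finset.sum_congr rfl fun v _ => ?_
      simp [nodeWeight]
    rw [e2]
    refine Finset.sum_le_sum_of_subset_of_nonneg ?_ fun _ _ _ => by positivity
    intro j hj
    obtain ⟨v, hv, rfl⟩ := Finset.mem_image.mp hj
    obtain ⟨hv1, hv2⟩ := Finset.mem_filter.mp hv
    obtain ⟨hv3, hv4⟩ := Finset.mem_sdiff.mp hv1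
    refine Finset.mem_filter.mpr ⟨Finset.mem_range.mpr (by have := nodeHeight_le h v; omega), ?_⟩
    rw [lt_div_iff₀ hρ0, mul_comm]
    obtain ⟨c, hc, hmin⟩ := Finset.exists_mem_eq_inf' hC (pixelDist p)
    rw [centreDist, hmin]
    by_contra hcon
    push Not at hcon
    refine hv4 (Finset.mem_filter.mpr ⟨hv3, Or.inr ⟨c, hc, p, hv2, hcon.trans (le_of_eq ?_)⟩⟩)
    simp [nodeWeight]
  calc x p * _ ≤ x p * (4 * (centreDist C hC p / ρ)) := mul_le_mul_of_nonneg_left key (hx p)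
    _ = _ := by ring

/-- The weighted cell masses of the image `x`. -/
noncomputable def pyramid (h : ℕ) (x : Pixel Δ → ℝ) : EuclideanSpace ℝ (Fin (2 * 4 ^ h)) :=
  WithLp.toLp 2 fun v => (nodeWeight h v : ℝ) * cellMass h x v

/-- The weighted cell masses of `x` outside a tree of `28 * κ * D` nodes, where `κ = k * ρ ^ 2` and `D` is
the number of levels, are small compared with the distance from `x` to the centres, both in the `ℓ₁` norm and
after the measurement. The second bound holds since any `κ` nodes lie in a tree with `2 * κ * D` nodes. -/
lemma exists_tree_approximation (hΔ : Δ ≤ 2 ^ h) {k ρ m : ℕ} (hρ : 1 ≤ ρ) (hk : 1 ≤ k)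
    {B : ℕ → ℕ → ℤ} {s : ℕ} (hs : s = 28 * (k * ρ ^ 2) * levelCount (2 * 4 ^ h) (k * ρ ^ 2))
    (hB : TreeIsometry m (2 * 4 ^ h) (3 * s) B) {C : Finset (Pixel Δ)} (hC : C.Nonempty)
    (hCk : C.card ≤ k) {x : Pixel Δ → ℝ} (hx : ∀ p, 0 ≤ x p) :
    ∃ T, HeapTree (2 * 4 ^ h) T ∧ T.card ≤ s ∧
      ∑ i ∈ Finset.univ \ finPart (2 * 4 ^ h) T, |pyramid h x i|
        ≤ 4 / ρ * ∑ p, x p * centreDist C hC p ∧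
      ‖measureMap m (2 * 4 ^ h) B (restrictTo (Finset.univ \ finPart (2 * 4 ^ h) T) (pyramid h x))‖
        ≤ 10 / (ρ * √(k * ρ ^ 2 : ℕ)) * ∑ p, x p * centreDist C hC p ∧
      (2 * 4 ^ h ≤ s → restrictTo (Finset.univ \ finPart (2 * 4 ^ h) T) (pyramid h x) = 0) := by
  classical
  set N := 2 * 4 ^ h with hN
  set κ := k * ρ ^ 2 with hκ
  set D := levelCount N κ with hD
  set E := ∑ p, x p * centreDist C hC p with hE
  have hκ1 : 1 ≤ κ := Nat.mul_pos hk (by positivity)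
  have hD2 : 2 ≤ D := by rw [hD, levelCount]; omega
  have hρ0 : (0 : ℝ) < ρ := by exact_mod_cast hρ
  have hE0 : 0 ≤ E := Finset.sum_nonneg fun p _ => mul_nonneg (hx p) (centreDist_nonneg C hC p)
  have hu : ∀ i : Fin N, 0 ≤ pyramid h x i := fun i =>
    mul_nonneg (Nat.cast_nonneg _) (cellMass_nonneg hx _)
  have hu0 : ∀ i : Fin N, (i : ℕ) = 0 → pyramid h x i = 0 := by
    intro i hi
    have : cellMass h x (i : ℕ) = 0 := cellMass_eq_zero_of_notMem hΔ x (by simp [hi])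
    simp [pyramid, this]
  -- if the budget admits the whole heap, nothing is left
  by_cases hbig : N ≤ s
  · refine ⟨Finset.Ico 1 N, ⟨subset_rfl, fun v hv h1 => ?_⟩, ?_, ?_⟩
    · rw [Finset.mem_Ico] at hv ⊢; omega
    · rw [Nat.card_Ico]; omega
    · have hz : ∀ i ∈ Finset.univ \ finPart N (Finset.Ico 1 N), pyramid h x i = 0 := by
        intro i hi
        refine hu0 i ?_
        by_contra h0
        refine (Finset.mem_sdiff.mp hi).2 (Finset.mem_filter.mpr ⟨Finset.mem_univ _, ?_⟩)
        exact Finset.mem_Ico.mpr ⟨by omega, i.2⟩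
      have hr : restrictTo (Finset.univ \ finPart N (Finset.Ico 1 N)) (pyramid h x) = 0 := by
        ext i
        rw [restrictTo_apply]
        split_ifs with hi
        · exact hz i hi
        · rfl
      refine ⟨?_, ?_, fun _ => hr⟩
      · rw [Finset.sum_eq_zero fun i hi => by rw [hz i hi, abs_zero]]
        positivity
      · rw [hr, map_zero, norm_zero]
        positivity
  · set T₀ := nearTree h κ ρ C with hT₀
    set Q := finPart N (Finset.Ico 1 N \ T₀) with hQ
    have hvals : ∀ G ⊆ Q, G.image (fun i : Fin N => (i : ℕ)) ⊆ Finset.Ico 1 N := by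
      intro G hG v hv
      obtain ⟨i, hi, rfl⟩ := Finset.mem_image.mp hv
      exact (Finset.mem_sdiff.mp (Finset.mem_filter.mp (hG hi)).2).1
    have hcl : ∀ G ⊆ Q, G.card ≤ κ →
        (pathClosure N κ (G.image fun i : Fin N => (i : ℕ))).card ≤ 2 * κ * D := by
      intro G hG hGc
      refine (card_pathClosure_le _ _ _).trans ?_
      have h1 : (G.image fun i : Fin N => (i : ℕ)).card ≤ κ := Finset.card_image_le.trans hGc
      calc κ + _ * D ≤ κ * D + κ * D :=
            Nat.add_le_add (Nat.le_mul_of_pos_right _ (by omega)) (Nat.mul_le_mul_right _ h1)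
        _ = _ := by ring
    have hgκ : ∀ G ⊆ Q, G.card ≤ κ → ∀ v ∈ supportedIn (G : Set (Fin N)),
        ‖measureMap m N B v‖ ≤ 6 / 5 * ‖v‖ := by
      intro G hG hGc v hv
      refine norm_map_le_of_almost_isometry (hB _ (heapTree_pathClosure hκ1 (hvals G hG))
        ((hcl G hG hGc).trans ?_) v (supportedIn_mono ?_ hv))
      · rw [hs]
        calc 2 * κ * D ≤ 84 * (κ * D) := by rw [mul_assoc]; omega
          _ = _ := by ring
      · intro i hi
        exact Finset.mem_coe.mpr (Finset.mem_filter.mpr ⟨Finset.mem_univ _,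
          subset_pathClosure (hvals G hG) (Finset.mem_image_of_mem _ hi)⟩)
    obtain ⟨G, hGQ, hGc, hG⟩ := exists_norm_map_tail_le (measureMap m N B) κ hκ1
      (by norm_num : (0 : ℝ) ≤ 6 / 5) Q hgκ (pyramid h x)
    -- the cells near the centres and those that carry the largest remaining weights
    set T := T₀ ∪ pathClosure N κ (G.image fun i : Fin N => (i : ℕ)) with hT
    have htailQ : ∑ i ∈ Q, |pyramid h x i| ≤ 4 / ρ * E := by
      refine le_trans (le_of_eq ?_) (sum_weight_notMem_nearTree_le (h := h) (κ := κ) hρ hC hx)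
      have : ∑ i ∈ Q, |pyramid h x i| = ∑ i ∈ Q, (nodeWeight h (i : ℕ) : ℝ) * cellMass h x (i : ℕ) :=
        Finset.sum_congr rfl fun i _ => abs_of_nonneg (hu i)
      rw [this]
      refine Finset.sum_bij (fun (i : Fin N) _ => (i : ℕ)) ?_ ?_ ?_ ?_
      · intro i hi; exact (Finset.mem_filter.mp hi).2
      · intro i _ j _ hij; exact Fin.ext hij
      · intro v hv
        have hv' := Finset.mem_Ico.mp (Finset.mem_sdiff.mp hv).1
        exact ⟨⟨v, hv'.2⟩, Finset.mem_filter.mpr ⟨Finset.mem_univ _, hv⟩, rfl⟩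
      · intro i _; rfl
    have hcomp : ∀ i ∈ Finset.univ \ finPart N T, i ∉ Q \ G → pyramid h x i = 0 := by
      intro i hi hi'
      refine hu0 i ?_
      by_contra h0
      have hiT : (i : ℕ) ∉ T := fun hc => (Finset.mem_sdiff.mp hi).2
        (Finset.mem_filter.mpr ⟨Finset.mem_univ _, hc⟩)
      rw [hT, Finset.mem_union, not_or] at hiT
      refine hi' (Finset.mem_sdiff.mpr ⟨Finset.mem_filter.mpr ⟨Finset.mem_univ _,
        Finset.mem_sdiff.mpr ⟨Finset.mem_Ico.mpr ⟨by omega, i.2⟩, hiT.1⟩⟩, fun hiG => hiT.2 ?_⟩)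
      exact subset_pathClosure (hvals G hGQ) (Finset.mem_image_of_mem _ hiG)
    refine ⟨T, (heapTree_nearTree hΔ κ ρ C).union (heapTree_pathClosure hκ1 (hvals G hGQ)), ?_, ?_,
      ?_, fun h' => absurd h' hbig⟩
    · refine (Finset.card_union_le _ _).trans ?_
      have h1 : T₀.card ≤ κ + k * (levelCount (2 * 4 ^ h) κ * (25 * ρ ^ 2)) :=
        card_nearTree_le hρ hκ1 hCk
      have h2 := hcl G hGQ hGc
      have h3 : k * (D * (25 * ρ ^ 2)) = 25 * (κ * D) := by rw [hκ]; ring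
      have h4 : κ ≤ κ * D := Nat.le_mul_of_pos_right _ (by omega)
      have h5 : 2 * κ * D = 2 * (κ * D) := by ring
      have h6 : s = 28 * (κ * D) := by rw [hs]; ring
      rw [← hN, ← hD, h3] at h1
      omega
    · refine le_trans ?_ htailQ
      rw [← Finset.sum_subset (Finset.inter_subset_left : (Finset.univ \ finPart N T) ∩ Q ⊆ _)]
      · exact Finset.sum_le_sum_of_subset_of_nonneg Finset.inter_subset_right
          fun _ _ _ => abs_nonneg _
      · intro i hi hi'
        rw [hcomp i hi fun hc => hi' (Finset.mem_inter.mpr ⟨hi, (Finset.mem_sdiff.mp hc).1⟩), abs_zero]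
    · have e : restrictTo (Finset.univ \ finPart N T) (pyramid h x)
          = restrictTo ((Finset.univ \ finPart N T) ∩ (Q \ G)) (pyramid h x) := by
        ext i
        rw [restrictTo_apply, restrictTo_apply]
        by_cases h1 : i ∈ Finset.univ \ finPart N T
        · by_cases h2 : i ∈ Q \ G
          · rw [if_pos h1, if_pos (Finset.mem_inter.mpr ⟨h1, h2⟩)]
          · rw [if_pos h1, if_neg fun hc => h2 (Finset.mem_inter.mp hc).2, hcomp i h1 h2]
        · rw [if_neg h1, if_neg fun hc => h1 (Finset.mem_inter.mp hc).1]
      rw [e]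
      refine (hG _ Finset.inter_subset_right).trans ?_
      have hκ0 : 0 < √(κ : ℝ) := sqrt_pos.mpr (by exact_mod_cast hκ1)
      calc 2 * (6 / 5) * (∑ i ∈ Q, |pyramid h x i|) / √(κ : ℝ)
          ≤ 2 * (6 / 5) * (4 / ρ * E) / √(κ : ℝ) := by gcongr
        _ = (48 / 5) / (ρ * √(κ : ℝ)) * E := by field_simp; ring
        _ ≤ _ := by gcongr; norm_num

end Model

end

/-! ### A program logic for the real RAM -/

/-- Started in `s`, the program `P` halts after at most `T` steps in a store with the property `Q`. -/
def Exec (P : Prog) (s : Store) (T : ℕ) (Q : Store → Prop) : Prop :=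
  ∃ t s', Runs P s t s' ∧ t ≤ T ∧ Q s'

lemma Exec.mono {P : Prog} {s : Store} {T T' : ℕ} {Q Q' : Store → Prop} (h : Exec P s T Q)
    (hT : T ≤ T') (hQ : ∀ s', Q s' → Q' s') : Exec P s T' Q' := by
  obtain ⟨t, s', hr, ht, hq⟩ := h
  exact ⟨t, s', hr, ht.trans hT, hQ s' hq⟩

lemma Exec.seq {P R : Prog} {s : Store} {T U : ℕ} {Q : Store → Prop}
    (h : Exec P s T fun s' => Exec R s' U Q) : Exec (.seq P R) s (T + U) Q := by
  obtain ⟨t, s', hr, ht, u, s'', hr', hu, hq⟩ := h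
  exact ⟨t + u, s'', hr.seq hr', add_le_add ht hu, hq⟩

/-- The arrays of natural numbers that a program may write. -/
def Prog.writesIdx : Prog → ℕ → Bool
  | .skip, _ => false
  | .setIdx b _ _, a => a == b
  | .setVal _ _ _, _ => false
  | .seq P Q, a => P.writesIdx a || Q.writesIdx a
  | .cond _ P Q, a => P.writesIdx a || Q.writesIdx a
  | .loop _ P, a => P.writesIdx a

/-- The arrays of reals that a program may write. -/
def Prog.writesVal : Prog → ℕ → Bool
  | .skip, _ => false
  | .setIdx _ _ _, _ => false
  | .setVal b _ _, a => a == b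
  | .seq P Q, a => P.writesVal a || Q.writesVal a
  | .cond _ P Q, a => P.writesVal a || Q.writesVal a
  | .loop _ P, a => P.writesVal a

/-- `s'` differs from `s` only in arrays that `P` may write. -/
def Framed (P : Prog) (s s' : Store) : Prop :=
  (∀ a, P.writesIdx a = false → s'.idx a = s.idx a) ∧
    ∀ a, P.writesVal a = false → s'.val a = s.val a

lemma Framed.refl (P : Prog) (s : Store) : Framed P s s := ⟨fun _ _ => rfl, fun _ _ => rfl⟩

lemma Framed.trans {P : Prog} {s s' s'' : Store} (h : Framed P s s') (h' : Framed P s' s'') :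
    Framed P s s'' :=
  ⟨fun a ha => (h'.1 a ha).trans (h.1 a ha), fun a ha => (h'.2 a ha).trans (h.2 a ha)⟩

lemma Framed.weaken {P R : Prog} {s s' : Store} (h : Framed P s s')
    (hI : ∀ a, R.writesIdx a = false → P.writesIdx a = false)
    (hV : ∀ a, R.writesVal a = false → P.writesVal a = false) : Framed R s s' :=
  ⟨fun a ha => h.1 a (hI a ha), fun a ha => h.2 a (hV a ha)⟩

lemma Runs.framed {P : Prog} {s s' : Store} {t : ℕ} (h : Runs P s t s') : Framed P s s' := by
  induction h with
  | skip s => exact Framed.refl _ _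
  | setIdx a i e s =>
    refine ⟨fun b hb => ?_, fun _ _ => rfl⟩
    have : b ≠ a := by simpa [Prog.writesIdx] using hb
    exact Function.update_of_ne this _ _
  | setVal a i e s =>
    refine ⟨fun _ _ => rfl, fun b hb => ?_⟩
    have : b ≠ a := by simpa [Prog.writesVal] using hb
    exact Function.update_of_ne this _ _
  | seq _ _ h₁ h₂ =>
    refine (h₁.weaken ?_ ?_).trans (h₂.weaken ?_ ?_) <;>
      · intro a ha
        simp only [Prog.writesIdx, Prog.writesVal, Bool.or_eq_false_iff] at ha
        first | exact ha.1 | exact ha.2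
  | condTrue _ _ h =>
    refine h.weaken ?_ ?_ <;>
      · intro a ha
        simp only [Prog.writesIdx, Prog.writesVal, Bool.or_eq_false_iff] at ha
        exact ha.1
  | condFalse _ _ h =>
    refine h.weaken ?_ ?_ <;>
      · intro a ha
        simp only [Prog.writesIdx, Prog.writesVal, Bool.or_eq_false_iff] at ha
        exact ha.2
  | loopTrue _ _ _ h₁ h₂ => exact (h₁.weaken (fun _ h => h) fun _ h => h).trans h₂
  | loopFalse _ => exact Framed.refl _ _

/-- The arrays that a program never writes keep their content. -/
lemma Exec.frame {P : Prog} {s : Store} {T : ℕ} {Q : Store → Prop} (h : Exec P s T Q) :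
    Exec P s T fun s' => Framed P s s' ∧ Q s' := by
  obtain ⟨t, s', hr, ht, hq⟩ := h
  exact ⟨t, s', hr, ht, hr.framed, hq⟩

/-- The program contains no loop. -/
def Prog.loopFree : Prog → Bool
  | .seq P Q => P.loopFree && Q.loopFree
  | .cond _ P Q => P.loopFree && Q.loopFree
  | .loop _ _ => false
  | _ => true

open Classical in
/-- The final store of a program without loops. -/
noncomputable def Prog.run : Prog → Store → Store
  | .skip, s => s
  | .setIdx a i e, s => s.writeIdx a (i.eval s) (e.eval s)
  | .setVal a i e, s => s.writeVal a (i.eval s) (e.eval s)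
  | .seq P Q, s => Q.run (P.run s)
  | .cond b P Q, s => if b.Holds s then P.run s else Q.run s
  | .loop _ _, s => s

/-- A bound for the number of steps of a program without loops. -/
def Prog.flatCost : Prog → ℕ
  | .skip => 1
  | .setIdx _ i e => 1 + i.cost + e.cost
  | .setVal _ i e => 1 + i.cost + e.cost
  | .seq P Q => P.flatCost + Q.flatCost
  | .cond b P Q => 1 + b.cost + (P.flatCost + Q.flatCost)
  | .loop _ _ => 0

/-- A program without loops can be evaluated instead of executed. -/
lemma exec_run {P : Prog} (hP : P.loopFree = true) (s : Store) :
    Exec P s P.flatCost fun s' => s' = P.run s := by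
  induction P generalizing s with
  | skip => exact ⟨1, s, .skip s, le_rfl, rfl⟩
  | setIdx a i e => exact ⟨_, _, .setIdx a i e s, le_rfl, rfl⟩
  | setVal a i e => exact ⟨_, _, .setVal a i e s, le_rfl, rfl⟩
  | seq P Q ihP ihQ =>
    simp only [Prog.loopFree, Bool.and_eq_true] at hP
    refine Exec.seq ((ihP hP.1 s).mono le_rfl ?_)
    rintro _ rfl
    exact ihQ hP.2 _
  | cond b P Q ihP ihQ =>
    simp only [Prog.loopFree, Bool.and_eq_true] at hP
    by_cases hb : b.Holds s
    · obtain ⟨t, s', hr, ht, rfl⟩ := ihP hP.1 s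
      refine ⟨_, _, .condTrue hb hr, ?_, ?_⟩
      · simp only [Prog.flatCost]; omega
      · simp [Prog.run, hb]
    · obtain ⟨t, s', hr, ht, rfl⟩ := ihQ hP.2 s
      refine ⟨_, _, .condFalse hb hr, ?_, ?_⟩
      · simp only [Prog.flatCost]; omega
      · simp [Prog.run, hb]
  | loop b P _ => simp [Prog.loopFree] at hP

lemma Exec.of_run {P : Prog} {s : Store} {Q : Store → Prop} (hP : P.loopFree = true)
    (h : Q (P.run s)) : Exec P s P.flatCost Q :=
  (exec_run hP s).mono le_rfl fun _ e => e ▸ h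

lemma Exec.flat {P : Prog} {s : Store} {T : ℕ} {Q : Store → Prop} (hP : P.loopFree = true)
    (hT : P.flatCost ≤ T) (h : Q (P.run s)) : Exec P s T Q :=
  (Exec.of_run hP h).mono hT fun _ h => h

/-- A loop whose body is executed `count` times. -/
lemma Exec.loop {b : Test} {P : Prog} {T : ℕ} {Inv : ℕ → Store → Prop} {Q : Store → Prop}
    (count : ℕ) {s : Store} (h0 : Inv 0 s)
    (hstep : ∀ i < count, ∀ s', Framed P s s' → Inv i s' →
      b.Holds s' ∧ Exec P s' T (Inv (i + 1)))
    (hend : ∀ s', Framed P s s' → Inv count s' → ¬ b.Holds s' ∧ Q s') :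
    Exec (.loop b P) s (count * (1 + b.cost + T) + (1 + b.cost)) Q := by
  suffices H : ∀ k i, i + k = count → ∀ s', Framed P s s' → Inv i s' →
      Exec (.loop b P) s' (k * (1 + b.cost + T) + (1 + b.cost)) Q by
    exact H count 0 (by omega) s (Framed.refl _ _) h0
  intro k
  induction k with
  | zero =>
    intro i hi s' hf hs'
    rw [add_zero] at hi
    subst hi
    obtain ⟨h1, h2⟩ := hend s' hf hs'
    exact ⟨_, s', .loopFalse h1, by omega, h2⟩
  | succ k ih =>
    intro i hi s' hf hs'
    obtain ⟨h1, t, s'', hr, ht, hs''⟩ := hstep i (by omega) s' hf hs'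
    obtain ⟨u, s₃, hr', hu, hq⟩ := ih (i + 1) (by omega) s'' (hf.trans hr.framed) hs''
    refine ⟨_, s₃, .loopTrue h1 hr hr', ?_, hq⟩
    rw [add_mul, one_mul]
    omega

/-- `for iv in [0, n) do P`, where the counter is cell `0` of the array `iv`. -/
def forProg (iv : ℕ) (n : IExp) (P : Prog) : Prog :=
  .seq (.setIdx iv (.const 0) (.const 0))
    (.loop (.idxLt (.get iv (.const 0)) n)
      (.seq P (.setIdx iv (.const 0) (.add (.get iv (.const 0)) (.const 1)))))

lemma Exec.forProg {iv : ℕ} {n : IExp} {P : Prog} {T : ℕ} {Inv : ℕ → Store → Prop}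
    {Q : Store → Prop} {s : Store} (count : ℕ) (hiv : P.writesIdx iv = false)
    (hn : ∀ s', Framed (forProg iv n P) s s' → n.eval s' = count)
    (hinv : ∀ i s' j, Inv i s' → Inv i (s'.writeIdx iv 0 j)) (h0 : Inv 0 s)
    (hstep : ∀ i < count, ∀ s', Framed (EMDRecovery.forProg iv n P) s s' → s'.idx iv 0 = i → Inv i s' →
      Exec P s' T (Inv (i + 1)))
    (hend : ∀ s', Framed (EMDRecovery.forProg iv n P) s s' → Inv count s' → Q s') :
    Exec (EMDRecovery.forProg iv n P) s (count * (T + n.cost + 10) + n.cost + 10) Q := by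
  have hfr : ∀ s', Framed (.seq P (.setIdx iv (.const 0) (.add (.get iv (.const 0)) (.const 1))))
      (s.writeIdx iv 0 0) s' → Framed (EMDRecovery.forProg iv n P) s s' := by
    intro s' hs'
    refine Framed.trans (s' := s.writeIdx iv 0 0) ⟨fun a ha => ?_, fun a _ => rfl⟩
      (hs'.weaken (fun a ha => ?_) fun a ha => ?_)
    · have : a ≠ iv := by
        simp only [EMDRecovery.forProg, Prog.writesIdx, Bool.or_eq_false_iff] at ha
        simpa using ha.1
      exact Function.update_of_ne this _ _
    · simp only [EMDRecovery.forProg, Prog.writesIdx, Bool.or_eq_false_iff] at ha ⊢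
      exact ha.2
    · simp only [EMDRecovery.forProg, Prog.writesVal, Bool.or_eq_false_iff] at ha ⊢
      exact ha.2
  have main := Exec.loop (b := .idxLt (.get iv (.const 0)) n)
    (P := .seq P (.setIdx iv (.const 0) (.add (.get iv (.const 0)) (.const 1))))
    (T := T + 6) (Inv := fun i s' => s'.idx iv 0 = i ∧ Inv i s') (Q := Q) count
    (s := s.writeIdx iv 0 0) ⟨by simp [Store.writeIdx], hinv _ _ _ h0⟩ ?_ ?_
  · refine (Exec.seq (T := 3) ⟨3, _, .setIdx iv (.const 0) (.const 0) s, le_rfl,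
      main⟩).mono ?_ fun _ h => h
    simp only [Test.cost, IExp.cost]
    have : count * (1 + (1 + (1 + 1) + n.cost) + (T + 6)) ≤ count * (T + n.cost + 10) :=
      Nat.mul_le_mul_left _ (by omega)
    omega
  · rintro i hi s' hf ⟨h1, h2⟩
    refine ⟨?_, ?_⟩
    · simp only [Test.Holds, IExp.eval, h1, hn s' (hfr s' hf)]
      exact hi
    · refine Exec.seq ((hstep i hi s' (hfr s' hf) h1 h2).frame.mono le_rfl ?_)
      rintro s'' ⟨hf', h3⟩
      refine ⟨_, _, .setIdx _ _ _ _, by simp [IExp.cost], ?_, ?_⟩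
      · have : s''.idx iv 0 = i := by rw [hf'.1 iv hiv, h1]
        simp [Store.writeIdx, IExp.eval, this]
      · exact hinv _ _ _ h3
  · rintro s' hf ⟨h1, h2⟩
    refine ⟨?_, hend s' (hfr s' hf) h2⟩
    simp only [Test.Holds, IExp.eval, h1, hn s' (hfr s' hf)]
    exact lt_irrefl _

@[simp] lemma Store.writeIdx_val (s : Store) (a i v : ℕ) : (s.writeIdx a i v).val = s.val := rfl

@[simp] lemma Store.writeVal_idx (s : Store) (a i : ℕ) (v : ℝ) :
    (s.writeVal a i v).idx = s.idx := rfl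

lemma Store.writeIdx_idx (s : Store) (a i v b j : ℕ) :
    (s.writeIdx a i v).idx b j = if b = a ∧ j = i then v else s.idx b j := by
  simp only [Store.writeIdx, Function.update_apply]
  by_cases h1 : b = a
  · subst h1; by_cases h2 : j = i <;> simp [h2]
  · simp [h1]

lemma Store.writeVal_val (s : Store) (a i : ℕ) (v : ℝ) (b j : ℕ) :
    (s.writeVal a i v).val b j = if b = a ∧ j = i then v else s.val b j := by
  simp only [Store.writeVal, Function.update_apply]
  by_cases h1 : b = a
  · subst h1; by_cases h2 : j = i <;> simp [h2]
  · simp [h1]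

@[simp] lemma Store.writeIdx_idx_of_ne (s : Store) (a i v : ℕ) {b : ℕ} (h : b ≠ a) :
    (s.writeIdx a i v).idx b = s.idx b :=
  Function.update_of_ne h _ _

@[simp] lemma Store.writeVal_val_of_ne (s : Store) (a i : ℕ) (v : ℝ) {b : ℕ} (h : b ≠ a) :
    (s.writeVal a i v).val b = s.val b :=
  Function.update_of_ne h _ _

/-- The sum of `e` over `iv` in `[0, n)`, accumulated in cell `0` of the real array `8`. -/
def sumProg (iv : ℕ) (n : IExp) (e : RExp) : Prog :=
  .seq (.setVal 8 (.const 0) (.ofIdx (.const 0)))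
    (forProg iv n (.setVal 8 (.const 0) (.add (.get 8 (.const 0)) e)))

lemma Exec.sumProg {iv : ℕ} {n : IExp} {e : RExp} {s : Store} (count : ℕ) (f : ℕ → ℝ)
    (hn : ∀ s', Framed (sumProg iv n e) s s' → n.eval s' = count)
    (he : ∀ i < count, ∀ s', Framed (EMDRecovery.sumProg iv n e) s s' → s'.idx iv 0 = i →
      e.eval s' = f i) :
    Exec (EMDRecovery.sumProg iv n e) s (count * (e.cost + n.cost + 20) + n.cost + 20)
      fun s' => s'.val 8 0 = ∑ i ∈ Finset.range count, f i := by
  have hfr : ∀ s', Framed (EMDRecovery.forProg iv n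
      (.setVal 8 (.const 0) (.add (.get 8 (.const 0)) e))) (s.writeVal 8 0 0) s' →
      Framed (EMDRecovery.sumProg iv n e) s s' := by
    refine fun s' h => Framed.trans (s' := s.writeVal 8 0 0) ⟨fun _ _ => rfl, fun a ha => ?_⟩
      (h.weaken (fun a ha => ?_) fun a ha => ?_)
    · simp only [EMDRecovery.sumProg, Prog.writesVal, Bool.or_eq_false_iff, beq_eq_false_iff_ne] at ha
      simp [ha.1]
    · simpa [EMDRecovery.sumProg, Prog.writesIdx] using ha
    · simp only [EMDRecovery.sumProg, Prog.writesVal, Bool.or_eq_false_iff] at ha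
      exact ha.2
  refine (Exec.seq (T := 4) (U := count * (5 + e.cost + n.cost + 10) + n.cost + 10)
    ((Exec.of_run (P := .setVal 8 (.const 0) (.ofIdx (.const 0)))
      (Q := fun s' => s' = s.writeVal 8 0 0) rfl (by simp [Prog.run, IExp.eval, RExp.eval])).mono
      (by simp [Prog.flatCost, IExp.cost, RExp.cost]) ?_)).mono ?_ fun _ h => h
  · rintro _ rfl
    refine Exec.forProg (T := 5 + e.cost)
      (Inv := fun i s' => s'.val 8 0 = ∑ j ∈ Finset.range i, f j) count rfl
      (fun s' h => hn s' (hfr s' h)) (fun _ _ _ h => h)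
      (by simp [Store.writeVal_val]) ?_ fun _ _ h => h
    intro i hi s' h hiv hs'
    refine (Exec.of_run rfl ?_).mono (by simp [Prog.flatCost, IExp.cost, RExp.cost]; omega)
      fun _ h => h
    simp [Prog.run, Store.writeVal_val, RExp.eval, IExp.eval, Finset.sum_range_succ, hs',
      he i hi s' (hfr s' h) hiv]
  · have : count * (5 + e.cost + n.cost + 10) ≤ count * (e.cost + n.cost + 20) :=
      Nat.mul_le_mul_left _ (by omega)
    omega

/-! ### Programs that set up the parameters and the tables -/

/-!
The programs use the memory as follows. For natural numbers, the array `0` holds the input `Δ, k, m`,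
and the following numbers are kept in cell `0` of the array named: in `1` the number `n = Δ ^ 2` of
pixels, in `2` and `16` the side `2 ^ h` of the grid of leaves and its square, in `3` the budget `s`
of tree nodes, in `4` the number `N` of nodes, in `5` the number `m₀` of measurements that are used,
in `6` the number `J` of rounds; `7`, `8`, `10` and `18` are loop counters, `9` is the current node,
`15` the result of the check and `17` the best split found. The array `11` holds Morton codes, `12`
the representatives of the cells, `13` the splits found by the dynamic program and `14` the budgets
allotted to the nodes.

The real arrays `0`, `1`, `2` hold the input `ε`, the matrix and the sketch, and `3` the output; `4`
is the iterate, `5` the iterate after the gradient step, `6` the residual, `7` the table of optimal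
values, `8` the accumulator of sums, `9` the powers of two, `10` the weights of the nodes, `11` the
rounded masses and later those that are output, `12` the best value found and `13` the bound `β`.
-/

/-- The content of cell `0` of the `a`-th array of natural numbers. -/
def reg (a : ℕ) : IExp := .get a (.const 0)

@[simp] lemma reg_eval (a : ℕ) (s : Store) : (reg a).eval s = s.idx a 0 := rfl

@[simp] lemma reg_cost (a : ℕ) : (reg a).cost = 2 := rfl

/-- The real counterpart of `reg`. -/
def vreg (a : ℕ) : RExp := .get a (.const 0)

@[simp] lemma vreg_eval (a : ℕ) (s : Store) : (vreg a).eval s = s.val a 0 := rfl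

@[simp] lemma vreg_cost (a : ℕ) : (vreg a).cost = 2 := rfl

/-- Doubling the register `2`, starting from `1`, until it reaches `Δ`. -/
def sideProg : Prog :=
  .seq (.setIdx 2 (.const 0) (.const 1))
    (.loop (.idxLt (reg 2) (reg 0)) (.setIdx 2 (.const 0) (.add (reg 2) (reg 2))))

/-- After `i` rounds the register holds `2 ^ i`, so that `Nat.clog 2 Δ` rounds are made. -/
lemma exec_sideProg (s : Store) :
    Exec sideProg s (Nat.clog 2 (s.idx 0 0) * 13 + 13) fun s' =>
      s'.idx 2 0 = 2 ^ Nat.clog 2 (s.idx 0 0) := by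
  have h1 : Exec (.setIdx 2 (.const 0) (.const 1)) s 3 fun s' =>
      s'.idx 2 0 = 1 ∧ s'.idx 0 = s.idx 0 := by
    refine Exec.of_run rfl ?_
    simp [Prog.run, Store.writeIdx_idx, IExp.eval]
  refine (Exec.seq (U := Nat.clog 2 (s.idx 0 0) * (1 + (1 + 2 + 2) + 7) + (1 + (1 + 2 + 2)))
    (h1.mono le_rfl ?_)).mono ?_ fun _ h => h
  · rintro s₁ ⟨e1, e2⟩
    refine Exec.loop (b := .idxLt (reg 2) (reg 0)) (T := 7)
      (Inv := fun i s' => s'.idx 2 0 = 2 ^ i) _ (by simpa using e1) ?_ ?_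
    · intro i hi s' F hs'
      refine ⟨?_, Exec.of_run rfl ?_⟩
      · simp only [Test.Holds, reg_eval, hs', F.1 0 rfl, e2]
        exact (Nat.lt_clog_iff_pow_lt (by norm_num)).mp hi
      · simp [Prog.run, Store.writeIdx_idx, IExp.eval, hs', pow_succ]
        ring
    · intro s' F hs'
      refine ⟨?_, hs'⟩
      simp only [Test.Holds, reg_eval, hs', F.1 0 rfl, e2, not_lt]
      exact Nat.le_pow_clog (by norm_num) _
  · omega

/-- Increasing the register `3` until `27 * c * s` reaches the number of measurements. -/
def budgetProg (c : ℕ) : Prog :=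
  .seq (.setIdx 3 (.const 0) (.const 0))
    (.loop (.idxLt (.mul (.const (27 * c)) (reg 3)) (.get 0 (.const 2)))
      (.setIdx 3 (.const 0) (.add (reg 3) (.const 1))))

lemma exec_budgetProg {c : ℕ} (hc : 0 < c) (t : ℕ) (s : Store) (hm : s.idx 0 2 = 27 * c * t) :
    Exec (budgetProg c) s (t * 14 + 14) fun s' => s'.idx 3 0 = t := by
  have h1 : Exec (.setIdx 3 (.const 0) (.const 0)) s 3 fun s' =>
      s'.idx 3 0 = 0 ∧ s'.idx 0 = s.idx 0 := by
    refine Exec.of_run rfl ?_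
    simp [Prog.run, Store.writeIdx_idx, IExp.eval]
  refine (Exec.seq (U := t * (1 + (1 + (1 + 1 + 2) + 2) + 6) + (1 + (1 + (1 + 1 + 2) + 2)))
    (h1.mono le_rfl ?_)).mono (by omega) fun _ h => h
  rintro s₁ ⟨e1, e2⟩
  refine Exec.loop (b := .idxLt (.mul (.const (27 * c)) (reg 3)) (.get 0 (.const 2))) (T := 6)
    (Inv := fun i s' => s'.idx 3 0 = i) t e1 ?_ ?_
  · intro i hi s' F hs'
    refine ⟨?_, Exec.of_run rfl ?_⟩
    · simp only [Test.Holds, IExp.eval, reg_eval, hs', F.1 0 rfl, e2, hm]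
      exact Nat.mul_lt_mul_of_pos_left hi (by omega)
    · simp [Prog.run, Store.writeIdx_idx, IExp.eval, hs']
  · intro s' F hs'
    refine ⟨?_, hs'⟩
    simp [Test.Holds, IExp.eval, hs', F.1 0 rfl, e2, hm]

/-- The parameters `n`, `H`, `4 ^ h`, `N`, `s` and `m₀` in the registers `1`, `2`, `16`, `4`, `3`
and `5`. -/
def setupProg (c : ℕ) : Prog :=
  .seq sideProg (.seq (budgetProg c)
    (.seq (.setIdx 1 (.const 0) (.mul (reg 0) (reg 0)))
      (.seq (.setIdx 16 (.const 0) (.mul (reg 2) (reg 2)))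
        (.seq (.setIdx 4 (.const 0) (.add (reg 16) (reg 16)))
          (.setIdx 5 (.const 0) (.mul (.const (3 * c)) (reg 3)))))))

lemma exec_setupProg {c : ℕ} (hc : 0 < c) (t : ℕ) (s : Store) (hm : s.idx 0 2 = 27 * c * t) :
    Exec (setupProg c) s (Nat.clog 2 (s.idx 0 0) * 13 + t * 14 + 60) fun s' =>
      s'.idx 1 0 = s.idx 0 0 * s.idx 0 0 ∧ s'.idx 2 0 = 2 ^ Nat.clog 2 (s.idx 0 0) ∧
      s'.idx 16 0 = 4 ^ Nat.clog 2 (s.idx 0 0) ∧ s'.idx 4 0 = 2 * 4 ^ Nat.clog 2 (s.idx 0 0) ∧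
      s'.idx 3 0 = t ∧ s'.idx 5 0 = 3 * c * t := by
  refine (Exec.seq (U := (t * 14 + 14) + 30) ((exec_sideProg s).frame.mono le_rfl ?_)).mono
    (by omega) fun _ h => h
  rintro s₁ ⟨F₁, h₁⟩
  have e0 := F₁.1 0 rfl
  refine Exec.seq ((exec_budgetProg hc t s₁ (by rw [e0, hm])).frame.mono le_rfl ?_)
  rintro s₂ ⟨F₂, h₂⟩
  have e1 := F₂.1 0 rfl
  have e2 := F₂.1 2 rfl
  refine (Exec.of_run rfl ?_).mono (by simp [Prog.flatCost, IExp.cost]) fun _ h => h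
  have h4 : (4 : ℕ) ^ Nat.clog 2 (s.idx 0 0) = 2 ^ Nat.clog 2 (s.idx 0 0)
      * 2 ^ Nat.clog 2 (s.idx 0 0) := by rw [← mul_pow]; norm_num
  simp only [Prog.run, Store.writeIdx_idx, IExp.eval, reg_eval]
  simp [e1, e2, e0, h₁, h₂, h4]
  ring

/-- The table of the Morton codes in the array `11`. -/
def spreadProg : Prog :=
  forProg 7 (reg 2) (.seq
    (.setIdx 11 (.add (reg 7) (reg 7)) (.mul (.const 4) (.get 11 (reg 7))))
    (.setIdx 11 (.add (.add (reg 7) (reg 7)) (.const 1))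
      (.add (.mul (.const 4) (.get 11 (reg 7))) (.const 1))))

lemma exec_spreadProg (s : Store) (h0 : s.idx 11 0 = 0) :
    Exec spreadProg s (s.idx 2 0 * 45 + 12) fun s' =>
      ∀ j < 2 * s.idx 2 0, s'.idx 11 j = spread j := by
  have z0 : spread 0 = 0 := by simp [spread]
  refine (Exec.forProg (T := 29) (Inv := fun i s' =>
    ∀ j < max 1 (2 * i), s'.idx 11 j = spread j) (s.idx 2 0) rfl
    (fun s' F => by rw [reg_eval, F.1 2 rfl]) (fun i s' j h => by simpa using h)
    (fun j hj => by
      obtain rfl : j = 0 := by omega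
      rw [h0, z0]) ?_ fun _ _ h j hj => h j (by omega)).mono (by simp; omega) fun _ h => h
  rintro i hi s' F hiv hs'
  refine (Exec.of_run rfl ?_).mono (by simp [Prog.flatCost, IExp.cost]) fun _ h => h
  have e1 : spread (i + i) = 4 * spread i := by
    rw [spread_eq, show (i + i) / 2 = i by omega, show (i + i) % 2 = 0 by omega, add_zero]
  have e2 : spread (i + i + 1) = 4 * spread i + 1 := by
    rw [spread_eq, show (i + i + 1) / 2 = i by omega, show (i + i + 1) % 2 = 1 by omega]
  intro j hj
  have h7 : ∀ j, (7 = 11 ∧ j) = False := fun j => by simp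
  simp only [Prog.run, Store.writeIdx_idx, IExp.eval, reg_eval, h7, if_false, hiv, true_and]
  rw [hs' i (by omega)]
  -- the first write does not destroy the entry that the second one reads, even for `i = 0`
  have e3 : (if i = i + i then 4 * spread i else spread i) = spread i := by
    split_ifs with h
    · obtain rfl : i = 0 := by omega
      simp [z0]
    · rfl
  rw [e3]
  split_ifs with h1 h2
  · rw [h1, e2]
  · rw [h2, e1]
  · exact hs' j (by omega)

/-- The first pixel numbers: the leaf of the pixel `(i, j)` receives `i * Δ + j + 1`. -/
def leafRepProg : Prog :=
  forProg 7 (reg 0) (forProg 8 (reg 0)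
    (.setIdx 12 (.add (reg 16) (.add (.mul (.const 2) (.get 11 (reg 7))) (.get 11 (reg 8))))
      (.add (.add (.mul (reg 7) (reg 0)) (reg 8)) (.const 1))))

lemma exec_leafRepProg {Δ h : ℕ} (hΔ : Δ ≤ 2 ^ h) (s : Store) (h0 : s.idx 0 0 = Δ)
    (h16 : s.idx 16 0 = 4 ^ h) (h11 : ∀ j < 2 * 2 ^ h, s.idx 11 j = spread j)
    (h12 : ∀ v, s.idx 12 v = 0) :
    Exec leafRepProg s (Δ * (Δ * 40 + 30) + 12) fun s' =>
      (∀ v, s'.idx 12 v = 0 ∨ ∃ p : Pixel Δ, v = leaf h p.1 p.2 ∧ s'.idx 12 v = pixelIndex p + 1) ∧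
        ∀ p : Pixel Δ, s'.idx 12 (leaf h p.1 p.2) ≠ 0 := by
  refine (Exec.forProg (T := Δ * 40 + 12) (Inv := fun i s' =>
    (∀ v, s'.idx 12 v = 0 ∨ ∃ p : Pixel Δ, v = leaf h p.1 p.2 ∧ s'.idx 12 v = pixelIndex p + 1) ∧
        ∀ p : Pixel Δ, (p.1 : ℕ) < i → s'.idx 12 (leaf h p.1 p.2) ≠ 0) Δ rfl
    (fun s' F => by rw [reg_eval, F.1 0 rfl, h0]) (fun i s' j h => by simpa using h)
    ⟨fun v => Or.inl (h12 v), by simp⟩ ?_ fun s' F h => ⟨h.1, fun p => h.2 p p.1.2⟩).mono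
    (by simp only [reg_cost]; linarith) fun _ h => h
  rintro i hi s₁ F₁ hiv ⟨hs₁, hs₁'⟩
  refine (Exec.forProg (T := 24) (Inv := fun j s' =>
    (∀ v, s'.idx 12 v = 0 ∨ ∃ p : Pixel Δ, v = leaf h p.1 p.2 ∧ s'.idx 12 v = pixelIndex p + 1) ∧
        ∀ p : Pixel Δ, (p.1 : ℕ) < i ∨ (p.1 : ℕ) = i ∧ (p.2 : ℕ) < j →
          s'.idx 12 (leaf h p.1 p.2) ≠ 0) Δ rfl
    (fun s' F => by rw [reg_eval, F.1 0 rfl, F₁.1 0 rfl, h0]) (fun i s' j h => by simpa using h)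
    ⟨hs₁, fun p hp => hs₁' p (by omega)⟩ ?_
    fun s' F h => ⟨h.1, fun p hp => h.2 p (by have := p.2.2; omega)⟩).mono
    (by simp; omega) fun _ h => h
  rintro j hj s₂ F₂ hjv ⟨hs₂, hs₂'⟩
  refine Exec.flat rfl (by decide) ?_
  have e7 : s₂.idx 7 0 = i := by rw [F₂.1 7 rfl, hiv]
  have e0 : s₂.idx 0 0 = Δ := by rw [F₂.1 0 rfl, F₁.1 0 rfl, h0]
  have e16 : s₂.idx 16 0 = 4 ^ h := by rw [F₂.1 16 rfl, F₁.1 16 rfl, h16]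
  have e11 : s₂.idx 11 = s.idx 11 := by rw [F₂.1 11 rfl, F₁.1 11 rfl]
  have key : ∀ v, (Prog.run (.setIdx 12
      (.add (reg 16) (.add (.mul (.const 2) (.get 11 (reg 7))) (.get 11 (reg 8))))
      (.add (.add (.mul (reg 7) (reg 0)) (reg 8)) (.const 1))) s₂).idx 12 v =
      if v = leaf h i j then i * Δ + j + 1 else s₂.idx 12 v := by
    intro v
    simp only [Prog.run, Store.writeIdx_idx, IExp.eval, reg_eval, true_and, e7, e0, e16, e11, hjv,
      h11 i (by omega), h11 j (by omega), leaf]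
    rfl
  refine ⟨fun v => ?_, fun p hp => ?_⟩
  · rw [key]
    split_ifs with hv
    · exact Or.inr ⟨(⟨i, hi⟩, ⟨j, hj⟩), hv, rfl⟩
    · exact hs₂ v
  · rw [key]
    split_ifs with hv
    · omega
    · refine hs₂' p ?_
      rcases hp with hp | ⟨hp, hp'⟩
      · exact Or.inl hp
      · refine Or.inr ⟨hp, ?_⟩
        have : (p.2 : ℕ) ≠ j := fun e => hv (by rw [hp, e])
        omega

/-- The weights of the leaves. -/
def leafWeightProg : Prog :=
  forProg 7 (reg 16) (.setVal 10 (.add (reg 16) (reg 7)) (.ofIdx (.const 1)))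

lemma exec_leafWeightProg (s : Store) :
    Exec leafWeightProg s (s.idx 16 0 * 20 + 12) fun s' =>
      ∀ v, s.idx 16 0 ≤ v → v < 2 * s.idx 16 0 → s'.val 10 v = 1 := by
  refine (Exec.forProg (T := 8) (Inv := fun i s' =>
    ∀ v, s.idx 16 0 ≤ v → v < s.idx 16 0 + i → s'.val 10 v = 1) (s.idx 16 0) rfl
    (fun s' F => by rw [reg_eval, F.1 16 rfl]) (fun i s' j h => by simpa using h)
    (fun v h1 h2 => by omega) ?_ fun s' F h v h1 h2 => h v h1 (by omega)).mono
    (by simp) fun _ h => h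
  intro i hi s' F hiv hs'
  refine (Exec.of_run rfl ?_).mono (by simp [Prog.flatCost, IExp.cost, RExp.cost]) fun _ h => h
  intro v h1 h2
  simp only [Prog.run, Store.writeVal_val, IExp.eval, RExp.eval, reg_eval, true_and, hiv,
    F.1 16 rfl, Nat.cast_one]
  split_ifs with hv
  · rfl
  · exact hs' v h1 (by omega)

/-- Representative pixel and weight of the inner node `4 ^ h - 1 - i`, where `i` is the content of
the register `7`, from those of its children and grandchildren. -/
def treeTableBody : Prog :=
  .seq (.setIdx 9 (.const 0) (.sub (.sub (reg 16) (.const 1)) (reg 7)))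
    (.seq
      (.cond (.idxLt (.const 0) (.get 12 (.mul (.const 2) (reg 9))))
        (.setIdx 12 (reg 9) (.get 12 (.mul (.const 2) (reg 9))))
        (.setIdx 12 (reg 9) (.get 12 (.add (.mul (.const 2) (reg 9)) (.const 1)))))
      (.cond (.idxLe (reg 16) (.mul (.const 2) (reg 9)))
        (.setVal 10 (reg 9) (.ofIdx (.const 2)))
        (.setVal 10 (reg 9) (.mul (.ofIdx (.const 2)) (.get 10 (.mul (.const 4) (reg 9)))))))

/-- Representative pixels and weights of the inner nodes, from the bottom to the top. -/
def treeTableProg : Prog :=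
  forProg 7 (.sub (reg 16) (.const 1)) treeTableBody

lemma nodeHeight_of_leaf {h v : ℕ} (hv : 4 ^ h ≤ v) : nodeHeight h v = 0 := by
  have : 2 * h ≤ Nat.log 2 v := by
    refine Nat.le_log_of_pow_le (by norm_num) ?_
    rwa [pow_mul]
  unfold nodeHeight
  omega

lemma nodeWeight_grandchild {h v : ℕ} (hv : 1 ≤ v) (hv' : 2 * v < 4 ^ h) :
    nodeWeight h v = 2 * nodeWeight h (4 * v) := by
  rw [nodeWeight, nodeHeight_of_lt (c := 2 * v) hv (by omega) (by omega),
    nodeHeight_of_lt (c := 4 * v) (by omega) hv' (by omega), nodeWeight, ← pow_succ']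
  congr 1
  omega

lemma nodeWeight_of_children_leaf {h v : ℕ} (hv : 1 ≤ v) (hv' : v < 4 ^ h) (hc : 4 ^ h ≤ 2 * v) :
    nodeWeight h v = 2 := by
  rw [nodeWeight, nodeHeight_of_lt (c := 2 * v) hv hv' (by omega), nodeHeight_of_leaf hc]
  norm_num

lemma exec_treeTableProg {Δ h : ℕ} (s : Store) (h16 : s.idx 16 0 = 4 ^ h)
    (h12 : ∀ v, s.idx 12 v = 0 ∨ ∃ p : Pixel Δ, v = leaf h p.1 p.2 ∧ s.idx 12 v = pixelIndex p + 1)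
    (h12' : ∀ p : Pixel Δ, s.idx 12 (leaf h p.1 p.2) ≠ 0)
    (h10 : ∀ v, 4 ^ h ≤ v → v < 2 * 4 ^ h → s.val 10 v = 1) :
    Exec treeTableProg s (4 ^ h * 80 + 20) fun s' =>
      IsRep Δ h (s'.idx 12) ∧ ∀ v ∈ Finset.Ico 1 (2 * 4 ^ h), s'.val 10 v = nodeWeight h v := by
  have hM : 0 < 4 ^ h := by positivity
  -- after `i` rounds the tables are correct from the node `4 ^ h - i` on
  refine (Exec.forProg (T := 60) (Inv := fun i s' => ∀ v, 4 ^ h ≤ v + i → 1 ≤ v → v < 2 * 4 ^ h →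
      ((s'.idx 12 v = 0 ∧ ∀ p : Pixel Δ, ¬ InCell h v p) ∨
        ∃ p : Pixel Δ, s'.idx 12 v = pixelIndex p + 1 ∧ InCell h v p) ∧
      s'.val 10 v = nodeWeight h v) (4 ^ h - 1) rfl
    (fun s' F => by simp [IExp.eval, F.1 16 rfl, h16]) (fun i s' j h => by simpa using h)
    (fun v h1 h3 h2 => ?_) ?_ fun s' F k =>
      ⟨fun v hv => have hv' := Finset.mem_Ico.mp hv; (k v (by omega) hv'.1 hv'.2).1,
      fun v hv => have hv' := Finset.mem_Ico.mp hv; (k v (by omega) hv'.1 hv'.2).2⟩).mono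
    ?_ fun _ h => h
  · rw [add_zero] at h1
    refine ⟨?_, ?_⟩
    · have e : ∀ p : Pixel Δ, InCell h v p ↔ leaf h p.1 p.2 = v := by
        intro p
        rw [InCell, nodeHeight_of_leaf h1, pow_zero, Nat.div_one]
      rcases h12 v with h3 | ⟨p, hp, hp'⟩
      · exact Or.inl ⟨h3, fun p hp => h12' p (by rw [(e p).mp hp, h3])⟩
      · exact Or.inr ⟨p, hp', (e p).mpr hp.symm⟩
    · rw [h10 v h1 h2, nodeWeight, nodeHeight_of_leaf h1]
      norm_num
  · intro i hi s' F hiv hs'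
    refine Exec.flat rfl (by decide) ?_
    obtain ⟨w, hw⟩ : ∃ w, w = 4 ^ h - 1 - i := ⟨_, rfl⟩
    have hw1 : 1 ≤ w := by omega
    have hw2 : w < 4 ^ h := by omega
    have e16 : s'.idx 16 0 = 4 ^ h := by rw [F.1 16 rfl, h16]
    have hrun : (treeTableBody.run s').idx 12 = Function.update (s'.idx 12) w
          (if 0 < s'.idx 12 (2 * w) then s'.idx 12 (2 * w) else s'.idx 12 (2 * w + 1)) ∧
        (treeTableBody.run s').val 10 = Function.update (s'.val 10) w
          (if 4 ^ h ≤ 2 * w then 2 else 2 * s'.val 10 (4 * w)) := by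
      refine ⟨funext fun v => ?_, funext fun v => ?_⟩ <;> by_cases c1 : 0 < s'.idx 12 (2 * w) <;>
        by_cases c2 : 4 ^ h ≤ 2 * w <;>
        simp [treeTableBody, Prog.run, Test.Holds, IExp.eval, RExp.eval, Store.writeIdx_idx,
          Store.writeVal_val, Function.update_apply, c1, c2, e16, hiv, ← hw]
    have hA := hs' (2 * w) (by omega) (by omega) (by omega)
    have hB := hs' (2 * w + 1) (by omega) (by omega) (by omega)
    intro v h1 h3 h2
    rw [hrun.1, hrun.2]
    by_cases hv : v = w
    · subst hv
      have hcell : ∀ p : Pixel Δ, _ := inCell_iff_children (h := h) hw1 hw2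
      rw [Function.update_self, Function.update_self]
      refine ⟨?_, ?_⟩
      · split_ifs with hc
        · rcases hA.1 with hA' | ⟨p, hp, hp'⟩
          · omega
          · exact Or.inr ⟨p, hp, (hcell p).mpr (Or.inl hp')⟩
        · rcases hA.1 with hA' | ⟨p, hp, hp'⟩
          · rcases hB.1 with hB' | ⟨p, hp, hp'⟩
            · exact Or.inl ⟨hB'.1, fun p hp => ((hcell p).mp hp).elim (hA'.2 p) (hB'.2 p)⟩
            · exact Or.inr ⟨p, hp, (hcell p).mpr (Or.inr hp')⟩
          · omega
      · split_ifs with hc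
        · rw [nodeWeight_of_children_leaf hw1 hw2 hc]
          norm_num
        · rw [nodeWeight_grandchild hw1 (by omega),
            (hs' (4 * v) (by omega) (by omega) (by omega)).2]
          push_cast
          ring
    · have h4 : 4 ^ h ≤ v + i := by clear hA hB; omega
      rw [Function.update_of_ne hv, Function.update_of_ne hv]
      exact hs' v h4 h3 h2
  · simp only [IExp.cost, reg_cost]
    omega

/-- All tables. -/
def tableProg : Prog :=
  .seq spreadProg (.seq leafRepProg (.seq leafWeightProg treeTableProg))

lemma exec_tableProg {Δ h : ℕ} (hΔ : Δ ≤ 2 ^ h) (s : Store) (h0 : s.idx 0 0 = Δ)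
    (h2 : s.idx 2 0 = 2 ^ h) (h16 : s.idx 16 0 = 4 ^ h) (h11 : s.idx 11 0 = 0)
    (h12 : ∀ v, s.idx 12 v = 0) :
    Exec tableProg s (300 * 4 ^ h) fun s' =>
      IsRep Δ h (s'.idx 12) ∧ ∀ v ∈ Finset.Ico 1 (2 * 4 ^ h), s'.val 10 v = nodeWeight h v := by
  have hM : 0 < 2 ^ h := by positivity
  have hM' : 4 ^ h = 2 ^ h * 2 ^ h := by rw [← mul_pow]; norm_num
  have c1 : 2 ^ h ≤ 4 ^ h := by nlinarith
  have c2 : Δ * Δ ≤ 4 ^ h := by rw [hM']; exact Nat.mul_le_mul hΔ hΔ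
  refine (Exec.seq (U := (Δ * (Δ * 40 + 30) + 12) + ((4 ^ h * 20 + 12) + (4 ^ h * 80 + 20)))
    ((exec_spreadProg s h11).frame.mono le_rfl ?_)).mono ?_ fun _ h => h
  swap
  · rw [h2, mul_add, ← mul_assoc]
    nlinarith
  rintro s₁ ⟨F₁, k₁⟩
  rw [h2] at k₁
  refine Exec.seq ((exec_leafRepProg hΔ s₁ (by rw [F₁.1 0 rfl, h0]) (by rw [F₁.1 16 rfl, h16]) k₁
    (by rw [F₁.1 12 rfl]; exact h12)).frame.mono le_rfl ?_)
  rintro s₂ ⟨F₂, k₂, k₂'⟩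
  have e16 : s₂.idx 16 0 = 4 ^ h := by rw [F₂.1 16 rfl, F₁.1 16 rfl, h16]
  refine Exec.seq ((exec_leafWeightProg s₂).frame.mono (by rw [e16]) ?_)
  rintro s₃ ⟨F₃, k₃⟩
  rw [e16] at k₃
  exact exec_treeTableProg s₃ (by rw [F₃.1 16 rfl, e16]) (by rw [F₃.1 12 rfl]; exact k₂)
    (by rw [F₃.1 12 rfl]; exact k₂') k₃

/-- The number `β = 1 + ∑ b_r ^ 2 / m₀`, then the powers of two up to the first one that is at
least `β * N ^ 2`; its exponent goes to the register `6`. -/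
def powerProg : Prog :=
  .seq (sumProg 7 (reg 5) (.mul (.get 2 (reg 7)) (.get 2 (reg 7))))
    (.seq (.seq (.setVal 13 (.const 0)
        (.add (.ofIdx (.const 1)) (.div (vreg 8) (.ofIdx (reg 5)))))
      (.seq (.setVal 9 (.const 0) (.ofIdx (.const 1))) (.setIdx 6 (.const 0) (.const 0))))
      (.loop (.valLt (.get 9 (reg 6))
          (.mul (vreg 13) (.mul (.ofIdx (reg 4)) (.ofIdx (reg 4)))))
        (.seq (.setVal 9 (.add (reg 6) (.const 1)) (.add (.get 9 (reg 6)) (.get 9 (reg 6))))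
          (.setIdx 6 (.const 0) (.add (reg 6) (.const 1))))))

lemma exec_powerProg (s : Store) {b : ℕ → ℝ} {m N : ℕ} (hb : s.val 2 = b) (h5 : s.idx 5 0 = m)
    (h4 : s.idx 4 0 = N) {J : ℕ}
    (hJ : J = Nat.clog 2 ⌈(1 + (∑ r ∈ Finset.range m, b r * b r) / m) * (N * N)⌉₊) :
    Exec powerProg s (m * 31 + J * 40 + 60) fun s' =>
      s'.idx 6 0 = J ∧ ∀ j ≤ J, s'.val 9 j = 2 ^ j := by
  set β : ℝ := 1 + (∑ r ∈ Finset.range m, b r * b r) / m with hβ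
  refine (Exec.seq (T := m * 29 + 22) (U := 18 + (J * 34 + 15)) ((Exec.sumProg m (fun r => b r * b r)
    (fun s' F => by rw [reg_eval, F.1 5 rfl, h5]) fun i hi s' F hiv => by
      simp [RExp.eval, F.2 2 rfl, hb, hiv]).frame.mono
      (by simp [RExp.cost]) ?_)).mono (by omega) fun _ h => h
  rintro s₁ ⟨F₁, k₁⟩
  refine Exec.seq ((Exec.of_run (Q := fun s' => s'.val 13 0 = β ∧ s'.val 9 0 = 1 ∧ s'.idx 6 0 = 0 ∧
    s'.idx 4 0 = N) rfl ?_).mono (by decide) ?_)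
  · simp [Prog.run, RExp.eval, IExp.eval, Store.writeVal_val, Store.writeIdx_idx, k₁, F₁.1 5 rfl,
      F₁.1 4 rfl, h4, h5, hβ]
  rintro s₂ ⟨e1, e2, e3, e4⟩
  have hpow : ∀ i : ℕ, (2 : ℝ) ^ i < β * (N * N) ↔ i < J := by
    intro i
    rw [hJ, Nat.lt_clog_iff_pow_lt (by norm_num), Nat.lt_ceil]
    push_cast
    rfl
  refine (Exec.loop (T := 19) (Inv := fun i s' => s'.idx 6 0 = i ∧ ∀ j ≤ i, s'.val 9 j = 2 ^ j) J
    ⟨e3, fun j hj => by rw [Nat.le_zero.mp hj, e2, pow_zero]⟩ ?_ ?_).mono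
    (by simp [Test.cost, RExp.cost]) fun _ h => h
  · rintro i hi s' F ⟨k1, k2⟩
    refine ⟨?_, Exec.flat rfl (by decide) ?_⟩
    · simp only [Test.Holds, RExp.eval, reg_eval, vreg_eval, k1, k2 i le_rfl,
        F.2 13 rfl, F.1 4 rfl, e1, e4]
      exact (hpow i).mpr hi
    · simp only [Prog.run, Store.writeIdx_idx, Store.writeVal_val, RExp.eval, IExp.eval, reg_eval,
        Store.writeIdx_val, Store.writeVal_idx, k1, k2 i le_rfl, true_and, if_true]
      intro j hj
      split_ifs with h
      · rw [h, pow_succ]; ring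
      · exact k2 j (by omega)
  · rintro s' F ⟨k1, k2⟩
    refine ⟨?_, k1, k2⟩
    simp only [Test.Holds, RExp.eval, reg_eval, vreg_eval, k1, k2 J le_rfl,
        F.2 13 rfl, F.1 4 rfl, e1, e4]
    rw [hpow]
    exact lt_irrefl _

/-! ### Optimal subtrees by dynamic programming -/

/-- Induction from the leaves of the heap to its root. -/
lemma heap_induction {P : ℕ → Prop} (N : ℕ) (hN : ∀ v, N ≤ v → P v)
    (hP : ∀ v, 1 ≤ v → v < N → P (2 * v) → P (2 * v + 1) → P v) (v : ℕ) (hv : 1 ≤ v) : P v := by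
  induction hd : N - v using Nat.strong_induction_on generalizing v with
  | _ d ih =>
    by_cases h : N ≤ v
    · exact hN v h
    · exact hP v hv (by omega) (ih _ (by omega) (2 * v) (by omega) rfl)
        (ih _ (by omega) (2 * v + 1) (by omega) rfl)

section SubtreeSum

variable {R : Type*} [AddCommMonoid R]

/-- The sum of `g` over the descendants of the node `v` in the heap with the nodes
`1, …, N - 1`. -/
def subtreeSum (N : ℕ) (g : ℕ → R) (v : ℕ) : R :=
  if 1 ≤ v ∧ v < N then g v + (subtreeSum N g (2 * v) + subtreeSum N g (2 * v + 1)) else 0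
termination_by N - v

lemma subtreeSum_of_le {N : ℕ} (g : ℕ → R) {v : ℕ} (hv : N ≤ v) : subtreeSum N g v = 0 := by
  rw [subtreeSum, if_neg (by omega)]

lemma subtreeSum_eq {N : ℕ} (g : ℕ → R) {v : ℕ} (h1 : 1 ≤ v) (h2 : v < N) :
    subtreeSum N g v = g v + (subtreeSum N g (2 * v) + subtreeSum N g (2 * v + 1)) := by
  rw [subtreeSum, if_pos ⟨h1, h2⟩]

/-- The frontier of a breadth-first search splits the sum over the whole heap. -/
lemma subtreeSum_one {N : ℕ} (hN : 1 ≤ N) (g : ℕ → R) :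
    subtreeSum N g 1 = ∑ v ∈ Finset.Ico 1 N, g v := by
  have key : ∀ i, 1 ≤ i → i ≤ N → ∑ v ∈ Finset.Ico 1 i, g v
      + ∑ v ∈ Finset.Ico i (2 * i), subtreeSum N g v = subtreeSum N g 1 := by
    intro i hi
    induction i, hi using Nat.le_induction with
    | base => simp
    | succ i hi ih =>
      intro hiN
      rw [← ih (by omega), Finset.sum_Ico_succ_top hi, Finset.sum_eq_sum_Ico_succ_bot
        (show i < 2 * i by omega), subtreeSum_eq g hi (by omega), show 2 * (i + 1) = 2 * i + 1 + 1
        by omega, Finset.sum_Ico_succ_top (by omega), Finset.sum_Ico_succ_top (by omega)]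
      abel
  rw [← key N hN le_rfl, Finset.sum_eq_zero (s := Finset.Ico N (2 * N)), add_zero]
  intro v hv
  exact subtreeSum_of_le g (Finset.mem_Ico.mp hv).1

end SubtreeSum

/-- The table of the dynamic program. Cell `v * (s + 1) + b` of `F` holds the largest energy of `a` on
a subtree of at most `b` nodes with root `v`; for `b ≥ 1` the same cell of `S` holds the part of the
budget `b - 1` that the left child receives. Only the entries `(v, b + 1)` with `D v b` have been
computed. -/
def DPSpec (N s : ℕ) (a F : ℕ → ℝ) (S : ℕ → ℕ) (D : ℕ → ℕ → Prop) : Prop :=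
  (∀ v b, b ≤ s → N ≤ v ∨ b = 0 → F (v * (s + 1) + b) = 0) ∧
    ∀ v b, 1 ≤ v → v < N → b < s → D v b →
      S (v * (s + 1) + (b + 1)) ≤ b ∧
      F (v * (s + 1) + (b + 1)) = a v * a v + (F (2 * v * (s + 1) + S (v * (s + 1) + (b + 1)))
        + F ((2 * v + 1) * (s + 1) + (b - S (v * (s + 1) + (b + 1))))) ∧
      ∀ i ≤ b, a v * a v + (F (2 * v * (s + 1) + i) + F ((2 * v + 1) * (s + 1) + (b - i)))
        ≤ F (v * (s + 1) + (b + 1))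

lemma mul_succ_add_inj {s v w b c : ℕ} (hb : b ≤ s) (hc : c ≤ s)
    (h : v * (s + 1) + b = w * (s + 1) + c) : v = w ∧ b = c := by
  have h1 : (v * (s + 1) + b) / (s + 1) = v := by
    rw [mul_comm, Nat.mul_add_div (by omega), Nat.div_eq_of_lt (by omega), add_zero]
  have h2 : (w * (s + 1) + c) / (s + 1) = w := by
    rw [mul_comm, Nat.mul_add_div (by omega), Nat.div_eq_of_lt (by omega), add_zero]
  have : v = w := by rw [← h1, ← h2, h]
  subst this
  exact ⟨rfl, by omega⟩

/-- Filling in one entry of the tables. -/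
lemma DPSpec.step {N s : ℕ} {a F : ℕ → ℝ} {S : ℕ → ℕ} {w j : ℕ} (hw : 1 ≤ w) (hw' : w < N)
    (hj : j < s) (H : DPSpec N s a F S fun v b => w < v ∨ v = w ∧ b < j) {σ : ℕ} (hσ : σ ≤ j)
    (hmax : ∀ i ≤ j, F (2 * w * (s + 1) + i) + F ((2 * w + 1) * (s + 1) + (j - i))
      ≤ F (2 * w * (s + 1) + σ) + F ((2 * w + 1) * (s + 1) + (j - σ))) :
    DPSpec N s a (Function.update F (w * (s + 1) + (j + 1)) (a w * a w +
      (F (2 * w * (s + 1) + σ) + F ((2 * w + 1) * (s + 1) + (j - σ)))))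
      (Function.update S (w * (s + 1) + (j + 1)) σ) fun v b => w < v ∨ v = w ∧ b < j + 1 := by
  have hne : ∀ {v b : ℕ}, b ≤ s → (v ≠ w ∨ b ≠ j + 1) →
      v * (s + 1) + b ≠ w * (s + 1) + (j + 1) := by
    intro v b hb hvb e
    obtain ⟨h1, h2⟩ := mul_succ_add_inj hb (by omega) e
    omega
  refine ⟨fun v b hb hvb => ?_, fun v b hv hv' hb hD => ?_⟩
  · rw [Function.update_of_ne (hne hb (by omega))]
    exact H.1 v b hb hvb
  · by_cases h : v = w ∧ b = j
    · obtain ⟨rfl, rfl⟩ := h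
      rw [Function.update_self, Function.update_self, Function.update_of_ne (hne (by omega) (by omega)),
        Function.update_of_ne (hne (by omega) (by omega))]
      refine ⟨hσ, rfl, fun i hi => ?_⟩
      rw [Function.update_of_ne (hne (by omega) (by omega)),
        Function.update_of_ne (hne (by omega) (by omega))]
      linarith [hmax i hi]
    · obtain ⟨k1, k2, k3⟩ := H.2 v b hv hv' hb (by omega)
      have e : v ≠ w ∨ b + 1 ≠ j + 1 := by omega
      rw [Function.update_of_ne (hne (by omega) e), Function.update_of_ne (hne (by omega) e),
        Function.update_of_ne (hne (by omega) (by omega)),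
        Function.update_of_ne (hne (by omega) (by omega))]
      refine ⟨k1, k2, fun i hi => ?_⟩
      rw [Function.update_of_ne (hne (by omega) (by omega)),
        Function.update_of_ne (hne (by omega) (by omega))]
      exact k3 i hi

/-- The rule by which the budgets are passed down the heap. -/
def BudgetSpec (N s : ℕ) (S β : ℕ → ℕ) : Prop :=
  β 1 = s ∧ ∀ v, 1 ≤ v → v < N →
    β (2 * v) = (if 0 < β v then S (v * (s + 1) + β v) else 0) ∧
    β (2 * v + 1) = (if 0 < β v then β v - 1 - S (v * (s + 1) + β v) else 0)

/-- The nodes with a positive budget form a heap tree of largest energy. -/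
lemma DPSpec.optimal {N s : ℕ} (hN : 1 ≤ N) {a F : ℕ → ℝ} {S β : ℕ → ℕ}
    (H : DPSpec N s a F S fun _ _ => True) (hβ : BudgetSpec N s S β) :
    HeapTree N ({v ∈ Finset.Ico 1 N | 0 < β v}) ∧
    ({v ∈ Finset.Ico 1 N | 0 < β v} : Finset ℕ).card ≤ s ∧
    ∀ T, HeapTree N T → T.card ≤ s →
      ∑ v ∈ T, a v ^ 2 ≤ ∑ v ∈ ({v ∈ Finset.Ico 1 N | 0 < β v} : Finset ℕ), a v ^ 2 := by
  -- a larger budget does not decrease the energy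
  have hmono : ∀ v, 1 ≤ v → ∀ b < s, F (v * (s + 1) + b) ≤ F (v * (s + 1) + (b + 1)) := by
    refine heap_induction N (fun v hv b hb => ?_) fun v h1 h2 hl hr b hb => ?_
    · rw [H.1 v b hb.le (Or.inl hv), H.1 v (b + 1) hb (Or.inl hv)]
    · rcases Nat.eq_zero_or_pos b with rfl | hb0
      · have := (H.2 v 0 h1 h2 hb trivial).2.2 0 le_rfl
        rw [H.1 (2 * v) 0 (by omega) (Or.inr rfl), Nat.sub_zero,
          H.1 (2 * v + 1) 0 (by omega) (Or.inr rfl)] at this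
        rw [H.1 v 0 (by omega) (Or.inr rfl)]
        nlinarith [mul_self_nonneg (a v)]
      · obtain ⟨c, rfl⟩ : ∃ c, b = c + 1 := ⟨b - 1, by omega⟩
        obtain ⟨k1, k2, -⟩ := H.2 v c h1 h2 (by omega) trivial
        have k3 := (H.2 v (c + 1) h1 h2 hb trivial).2.2 _ (k1.trans (Nat.le_succ c))
        have k4 := hr (c - S (v * (s + 1) + (c + 1))) (by omega)
        rw [show c - S (v * (s + 1) + (c + 1)) + 1 = c + 1 - S (v * (s + 1) + (c + 1)) by omega]
          at k4
        linarith
  have hmono' : ∀ c ≤ s, F (1 * (s + 1) + c) ≤ F (1 * (s + 1) + s) := by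
    intro c hc
    induction hd : s - c generalizing c with
    | zero => rw [show c = s by omega]
    | succ d ih => exact (hmono 1 le_rfl c (by omega)).trans (ih (c + 1) (by omega) (by omega))
  -- the nodes with a positive budget below `v` use the budget of `v` and attain the energy in the table
  have hS : ∀ v, 1 ≤ v → β v ≤ s →
      subtreeSum N (fun v => if 0 < β v then 1 else 0) v ≤ β v ∧
      subtreeSum N (fun v => if 0 < β v then a v ^ 2 else 0) v = F (v * (s + 1) + β v) := by
    refine heap_induction N (fun v hv hb => ?_) fun v h1 h2 hl hr hb => ?_
    · rw [subtreeSum_of_le _ hv, subtreeSum_of_le _ hv, H.1 v _ hb (Or.inl hv)]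
      exact ⟨Nat.zero_le _, rfl⟩
    · obtain ⟨e1, e2⟩ := hβ.2 v h1 h2
      rw [subtreeSum_eq _ h1 h2, subtreeSum_eq _ h1 h2]
      by_cases h : 0 < β v
      · obtain ⟨b, hb'⟩ : ∃ b, β v = b + 1 := ⟨β v - 1, by omega⟩
        obtain ⟨k1, k2, -⟩ := H.2 v b h1 h2 (by omega) trivial
        rw [if_pos h, hb'] at e1 e2
        obtain ⟨l1, l2⟩ := hl (by omega)
        obtain ⟨r1, r2⟩ := hr (by omega)
        rw [if_pos h, if_pos h, l2, r2, hb', k2, e1, e2, Nat.add_sub_cancel]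
        refine ⟨?_, by ring⟩
        rw [e1] at l1
        rw [e2] at r1
        omega
      · rw [if_neg h] at e1 e2
        obtain ⟨l1, l2⟩ := hl (by omega)
        obtain ⟨r1, r2⟩ := hr (by omega)
        rw [if_neg h, if_neg h, l2, r2, e1, e2, H.1 _ 0 (by omega) (Or.inr rfl),
          H.1 _ 0 (by omega) (Or.inr rfl), H.1 v _ hb (Or.inr (by omega))]
        refine ⟨?_, by ring⟩
        omega
  obtain ⟨c1, c2⟩ := hS 1 le_rfl hβ.1.le
  rw [subtreeSum_one hN, hβ.1] at c1 c2
  refine ⟨⟨Finset.filter_subset _ _, fun v hv h1 => ?_⟩, ?_, fun T hT hTs => ?_⟩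
  · simp only [Finset.mem_filter, Finset.mem_Ico] at hv ⊢
    refine ⟨by omega, ?_⟩
    by_contra h0
    obtain ⟨e1, e2⟩ := hβ.2 (v / 2) (by omega) (by omega)
    rw [if_neg h0] at e1 e2
    rcases Nat.mod_two_eq_zero_or_one v with h | h
    · rw [show 2 * (v / 2) = v by omega] at e1; omega
    · rw [show 2 * (v / 2) + 1 = v by omega] at e2; omega
  · rw [Finset.card_filter]
    exact c1
  · rw [Finset.sum_filter, c2]
    -- below a node outside of the tree `T` there is nothing of `T`
    have hout : ∀ v, 1 ≤ v → v ∉ T → subtreeSum N (fun v => if v ∈ T then 1 else 0) v = 0 ∧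
        subtreeSum N (fun v => if v ∈ T then a v ^ 2 else 0) v = 0 := by
      refine heap_induction N (fun v hv _ => ⟨subtreeSum_of_le _ hv, subtreeSum_of_le _ hv⟩)
        fun v h1 h2 hl hr hv => ?_
      have nl := hl fun h => hv (by
        have := hT.2 _ h (by omega); rwa [show 2 * v / 2 = v by omega] at this)
      have nr := hr fun h => hv (by
        have := hT.2 _ h (by omega); rwa [show (2 * v + 1) / 2 = v by omega] at this)
      rw [subtreeSum_eq _ h1 h2, subtreeSum_eq _ h1 h2, if_neg hv, if_neg hv, nl.1, nl.2, nr.1,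
        nr.2]
      simp
    -- the part of `T` below `v` has at most the energy in the table
    have hle : ∀ v, 1 ≤ v → subtreeSum N (fun v => if v ∈ T then 1 else 0) v ≤ s →
        subtreeSum N (fun v => if v ∈ T then a v ^ 2 else 0) v
          ≤ F (v * (s + 1) + subtreeSum N (fun v => if v ∈ T then 1 else 0) v) := by
      refine heap_induction N (fun v hv hb => ?_) fun v h1 h2 hl hr hb => ?_
      · rw [subtreeSum_of_le _ hv, H.1 v _ hb (Or.inl hv)]
      · by_cases hv : v ∈ T
        · rw [subtreeSum_eq _ h1 h2, if_pos hv] at hb ⊢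
          rw [subtreeSum_eq _ h1 h2, if_pos hv]
          have l1 := hl (by omega)
          have r1 := hr (by omega)
          generalize subtreeSum N (fun v => if v ∈ T then 1 else 0) (2 * v) = x at *
          generalize subtreeSum N (fun v => if v ∈ T then 1 else 0) (2 * v + 1) = y at *
          have k := (H.2 v (x + y) h1 h2 (by omega) trivial).2.2 x (by omega)
          rw [Nat.add_sub_cancel_left] at k
          rw [add_comm 1 (x + y)]
          nlinarith
        · obtain ⟨e1, e2⟩ := hout v h1 hv
          rw [e1, e2, H.1 v 0 (by omega) (Or.inr rfl)]
    have hcard : subtreeSum N (fun v => if v ∈ T then 1 else 0) 1 = T.card := by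
      rw [subtreeSum_one hN, ← Finset.sum_filter, Finset.filter_mem_eq_inter,
        Finset.inter_eq_right.mpr hT.1, Finset.card_eq_sum_ones]
    have := hle 1 le_rfl (by rw [hcard]; exact hTs)
    rw [hcard, subtreeSum_one hN, ← Finset.sum_filter, Finset.filter_mem_eq_inter,
        Finset.inter_eq_right.mpr hT.1] at this
    exact this.trans (hmono' _ hTs)

/-! ### The thresholding iteration as a program -/

/-- The entry `(r, v)` of the matrix `B`, which is stored in the rows of the measurement matrix below
the first `m₀`, eight rows of length `n` for each row of length `N ≤ 8 * n`. -/
def entry (r v : IExp) : RExp :=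
  .get 1 (.add (.mul (.add (reg 5) (.mul (.const 8) r)) (reg 1)) v)

/-- The residual `b - B z` in the array `6`. -/
def residualProg : Prog :=
  forProg 7 (reg 5)
    (.seq (sumProg 8 (reg 4) (.mul (entry (reg 7) (reg 8)) (.get 4 (reg 8))))
      (.setVal 6 (reg 7) (.sub (.get 2 (reg 7)) (vreg 8))))

/-- The store holds the sketch `b`, the parameters, and the matrix `B`. -/
structure HasData (n N s m : ℕ) (B : ℕ → ℕ → ℝ) (b : ℕ → ℝ) (σ : Store) : Prop where
  n_eq : σ.idx 1 0 = n
  s_eq : σ.idx 3 0 = s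
  N_eq : σ.idx 4 0 = N
  m_eq : σ.idx 5 0 = m
  b_eq : σ.val 2 = b
  B_eq : ∀ r < m, ∀ v < N, σ.val 1 ((m + 8 * r) * n + v) = B r v

lemma HasData.congr {n N s m : ℕ} {B : ℕ → ℕ → ℝ} {b : ℕ → ℝ} {σ σ' : Store}
    (h : HasData n N s m B b σ) (h1 : σ'.idx 1 = σ.idx 1) (h3 : σ'.idx 3 = σ.idx 3)
    (h4 : σ'.idx 4 = σ.idx 4) (h5 : σ'.idx 5 = σ.idx 5) (k1 : σ'.val 1 = σ.val 1)
    (k2 : σ'.val 2 = σ.val 2) : HasData n N s m B b σ' :=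
  ⟨by rw [h1, h.n_eq], by rw [h3, h.s_eq], by rw [h4, h.N_eq], by rw [h5, h.m_eq],
    by rw [k2, h.b_eq], by rw [k1]; exact h.B_eq⟩

lemma HasData.frame {n N s m : ℕ} {B : ℕ → ℕ → ℝ} {b : ℕ → ℝ} {σ σ' : Store} {P : Prog}
    (h : HasData n N s m B b σ) (F : Framed P σ σ')
    (hP : (!P.writesIdx 1 && !P.writesIdx 3 && !P.writesIdx 4 && !P.writesIdx 5 &&
      !P.writesVal 1 && !P.writesVal 2) = true) : HasData n N s m B b σ' := by
  simp only [Bool.and_eq_true, Bool.not_eq_true'] at hP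
  obtain ⟨⟨⟨⟨⟨p1, p3⟩, p4⟩, p5⟩, q1⟩, q2⟩ := hP
  exact h.congr (F.1 1 p1) (F.1 3 p3) (F.1 4 p4) (F.1 5 p5) (F.2 1 q1) (F.2 2 q2)

lemma HasData.entry_eval {n N s m : ℕ} {B : ℕ → ℕ → ℝ} {b : ℕ → ℝ} {σ : Store}
    (h : HasData n N s m B b σ) {r v : IExp} (hr : r.eval σ < m) (hv : v.eval σ < N) :
    (entry r v).eval σ = B (r.eval σ) (v.eval σ) := by
  simp only [entry, RExp.eval, IExp.eval, reg_eval, h.n_eq, h.m_eq]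
  exact h.B_eq _ hr _ hv

/-- Each row costs `O(N)` steps. -/
lemma exec_residualProg {n N s m : ℕ} {B : ℕ → ℕ → ℝ} {b : ℕ → ℝ} {σ : Store}
    (h : HasData n N s m B b σ) :
    Exec residualProg σ (m * (N * 50 + 60) + 12) fun σ' =>
      ∀ r < m, σ'.val 6 r = b r - ∑ v ∈ Finset.range N, B r v * σ.val 4 v := by
  refine (Exec.forProg (T := (N * 40 + 22) + 9) (Inv := fun i σ' =>
    ∀ r < i, σ'.val 6 r = b r - ∑ v ∈ Finset.range N, B r v * σ.val 4 v) m rfl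
    (fun σ' F => by rw [reg_eval, F.1 5 rfl, h.m_eq]) (fun i σ' j k => k)
    (by simp) ?_ fun σ' F k => k).mono ?_ fun _ h => h
  · intro i hi σ₁ F₁ hiv k₁
    refine Exec.seq (((Exec.sumProg N (fun v => B i v * σ.val 4 v) ?_ ?_).frame).mono
      (by simp [RExp.cost, entry, IExp.cost]) ?_)
    · intro σ' F
      rw [reg_eval, F.1 4 rfl, F₁.1 4 rfl, h.N_eq]
    · intro v hv σ' F hvv
      have h' := (h.frame F₁ rfl).frame F rfl
      have e7 : σ'.idx 7 0 = i := by rw [F.1 7 rfl, hiv]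
      rw [RExp.eval, h'.entry_eval (by rw [reg_eval, e7]; exact hi)
        (by rw [reg_eval, hvv]; exact hv)]
      simp only [reg_eval, RExp.eval, e7, hvv, F.2 4 rfl, F₁.2 4 rfl]
    · rintro σ₂ ⟨F₂, k₂⟩
      refine Exec.flat rfl (by decide) ?_
      have e7 : σ₂.idx 7 0 = i := by rw [F₂.1 7 rfl, hiv]
      have e2 : σ₂.val 2 = b := by rw [F₂.2 2 rfl, F₁.2 2 rfl, h.b_eq]
      intro r hr
      simp only [Prog.run, Store.writeVal_val, RExp.eval, reg_eval, vreg_eval, e7, e2, k₂, true_and,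
        F₂.2 6 rfl]
      split_ifs with hri
      · rw [hri]
      · exact k₁ r (by omega)
  · simp only [reg_cost]
    nlinarith

/-- The vector `a = z + Bᵀ r / m₀`, for the residual `r`, in the array `5`. -/
def gradientProg : Prog :=
  forProg 7 (reg 4)
    (.seq (sumProg 8 (reg 5) (.mul (entry (reg 8) (reg 7)) (.get 6 (reg 8))))
      (.setVal 5 (reg 7) (.add (.get 4 (reg 7)) (.div (vreg 8) (.ofIdx (reg 5))))))

lemma exec_gradientProg {n N s m : ℕ} {B : ℕ → ℕ → ℝ} {b : ℕ → ℝ} {σ : Store}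
    (h : HasData n N s m B b σ) :
    Exec gradientProg σ (N * (m * 50 + 60) + 12) fun σ' =>
      ∀ v < N, σ'.val 5 v = σ.val 4 v + (∑ r ∈ Finset.range m, B r v * σ.val 6 r) / m := by
  refine (Exec.forProg (T := (m * 40 + 22) + 13) (Inv := fun i σ' =>
    ∀ v < i, σ'.val 5 v = σ.val 4 v + (∑ r ∈ Finset.range m, B r v * σ.val 6 r) / m) N rfl
    (fun σ' F => by rw [reg_eval, F.1 4 rfl, h.N_eq]) (fun i σ' j k => k)
    (by simp) ?_ fun σ' F k => k).mono ?_ fun _ h => h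
  · intro i hi σ₁ F₁ hiv k₁
    refine Exec.seq (((Exec.sumProg m (fun r => B r i * σ.val 6 r) ?_ ?_).frame).mono
      (by simp [RExp.cost, entry, IExp.cost]) ?_)
    · intro σ' F
      rw [reg_eval, F.1 5 rfl, F₁.1 5 rfl, h.m_eq]
    · intro v hv σ' F hvv
      have h' := (h.frame F₁ rfl).frame F rfl
      have e7 : σ'.idx 7 0 = i := by rw [F.1 7 rfl, hiv]
      rw [RExp.eval, h'.entry_eval (by rw [reg_eval, hvv]; exact hv)
        (by rw [reg_eval, e7]; exact hi)]
      simp only [reg_eval, RExp.eval, e7, hvv, F.2 6 rfl, F₁.2 6 rfl]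
    · rintro σ₂ ⟨F₂, k₂⟩
      refine Exec.flat rfl (by decide) ?_
      have e7 : σ₂.idx 7 0 = i := by rw [F₂.1 7 rfl, hiv]
      have e5 : σ₂.idx 5 0 = m := by rw [F₂.1 5 rfl, F₁.1 5 rfl, h.m_eq]
      have e4 : σ₂.val 4 = σ.val 4 := by rw [F₂.2 4 rfl, F₁.2 4 rfl]
      intro v hv
      simp only [Prog.run, Store.writeVal_val, RExp.eval, reg_eval, vreg_eval, e7, e5, e4, k₂,
        true_and, F₂.2 5 rfl]
      split_ifs with hvi
      · rw [hvi]
      · exact k₁ v (by omega)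
  · simp only [reg_cost]
    nlinarith

/-- The address of the entry `(v, b)` of a table with `s + 1` columns. -/
def cell (v b : IExp) : IExp := .add (.mul v (.add (reg 3) (.const 1))) b

/-- The value of a split of the budget: the left child of the node in register `9` receives `i`, the
right child what remains of the content of register `8`. -/
def splitValue (i : IExp) : RExp :=
  .add (.get 7 (cell (.mul (.const 2) (reg 9)) i))
    (.get 7 (cell (.add (.mul (.const 2) (reg 9)) (.const 1)) (.sub (reg 8) i)))

/-- The best split of a budget. -/
def bestSplitProg : Prog :=
  .seq (.seq (.setVal 12 (.const 0) (splitValue (.const 0))) (.setIdx 17 (.const 0) (.const 0)))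
    (forProg 10 (.add (reg 8) (.const 1))
      (.cond (.valLt (vreg 12) (splitValue (reg 10)))
        (.seq (.setVal 12 (.const 0) (splitValue (reg 10))) (.setIdx 17 (.const 0) (reg 10)))
        .skip))

/-- The value of `splitValue` as a function. -/
noncomputable def splitFun (s : ℕ) (F : ℕ → ℝ) (w j i : ℕ) : ℝ :=
  F (2 * w * (s + 1) + i) + F ((2 * w + 1) * (s + 1) + (j - i))

lemma splitValue_eval (σ : Store) (i : IExp) :
    (splitValue i).eval σ = splitFun (σ.idx 3 0) (σ.val 7) (σ.idx 9 0) (σ.idx 8 0) (i.eval σ) :=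
  rfl

lemma exec_bestSplitProg (σ : Store) :
    Exec bestSplitProg σ (σ.idx 8 0 * 110 + 180) fun σ' =>
      σ'.idx 17 0 ≤ σ.idx 8 0 ∧
      σ'.val 12 0 = splitFun (σ.idx 3 0) (σ.val 7) (σ.idx 9 0) (σ.idx 8 0) (σ'.idx 17 0) ∧
      ∀ i ≤ σ.idx 8 0, splitFun (σ.idx 3 0) (σ.val 7) (σ.idx 9 0) (σ.idx 8 0) i
        ≤ σ'.val 12 0 := by
  set g := splitFun (σ.idx 3 0) (σ.val 7) (σ.idx 9 0) (σ.idx 8 0) with hg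
  refine (Exec.seq (T := 40) (U := (σ.idx 8 0 + 1) * 105 + 30) (Exec.mono (Exec.frame (Exec.of_run
    (Q := fun σ' => σ'.idx 17 0 = 0 ∧ σ'.val 12 0 = g 0) rfl ?_)) (by decide) ?_)).mono
    (by omega) fun _ h => h
  · simp [Prog.run, Store.writeIdx_idx, Store.writeVal_val, splitValue_eval, IExp.eval, hg]
  rintro σ₁ ⟨F₁, k₁, k₁'⟩
  -- the register `17` holds the best split among the first `i`, the real register `12` its value
  refine (Exec.forProg (T := 90) (Inv := fun i σ' => σ'.idx 17 0 ≤ σ.idx 8 0 ∧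
    σ'.val 12 0 = g (σ'.idx 17 0) ∧ ∀ j < i, g j ≤ σ'.val 12 0) (σ.idx 8 0 + 1) rfl
    (fun σ' F => by simp [IExp.eval, F.1 8 rfl, F₁.1 8 rfl]) (fun i σ' j h => by simpa using h)
    ⟨by rw [k₁]; exact Nat.zero_le _, by rw [k₁, k₁'], by simp⟩ ?_
    fun σ' F k => ⟨k.1, k.2.1, fun i hi => k.2.2 i (by omega)⟩).mono ?_ fun _ h => h
  · rintro i hi σ₂ F₂ hiv ⟨a1, a2, a3⟩
    refine Exec.flat rfl (by decide) ?_
    have e3 : σ₂.idx 3 0 = σ.idx 3 0 := by rw [F₂.1 3 rfl, F₁.1 3 rfl]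
    have e8 : σ₂.idx 8 0 = σ.idx 8 0 := by rw [F₂.1 8 rfl, F₁.1 8 rfl]
    have e9 : σ₂.idx 9 0 = σ.idx 9 0 := by rw [F₂.1 9 rfl, F₁.1 9 rfl]
    have e7 : σ₂.val 7 = σ.val 7 := by rw [F₂.2 7 rfl, F₁.2 7 rfl]
    by_cases hc : σ₂.val 12 0 < g i
    · have : Test.Holds σ₂ (.valLt (vreg 12) (splitValue (reg 10))) := by
        simpa [Test.Holds, splitValue_eval, e3, e8, e9, e7, hiv] using hc
      simp only [Prog.run, if_pos this]
      simp only [Store.writeIdx_idx, Store.writeVal_val, splitValue_eval, IExp.eval, reg_eval,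
        Store.writeIdx_val, Store.writeVal_idx, e3, e8, e9, e7, hiv, ← hg, and_self, if_true]
      refine ⟨by omega, trivial, fun j hj => ?_⟩
      rcases Nat.lt_succ_iff_lt_or_eq.mp hj with h | h
      · exact (a3 j h).trans hc.le
      · rw [h]
    · have : ¬ Test.Holds σ₂ (.valLt (vreg 12) (splitValue (reg 10))) := by
        simpa [Test.Holds, splitValue_eval, e3, e8, e9, e7, hiv] using hc
      simp only [Prog.run, if_neg this]
      refine ⟨a1, a2, fun j hj => ?_⟩
      rcases Nat.lt_succ_iff_lt_or_eq.mp hj with h | h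
      · exact a3 j h
      · rw [h]
        exact not_lt.mp hc
  · simp only [IExp.cost, reg_cost]
    omega

/-- The tables of the dynamic program, from the leaves to the root. -/
def dpProg : Prog :=
  forProg 7 (.sub (reg 4) (.const 1))
    (.seq (.setIdx 9 (.const 0) (.sub (.sub (reg 4) (.const 1)) (reg 7)))
      (forProg 8 (reg 3)
        (.seq bestSplitProg
          (.seq
            (.setVal 7 (cell (reg 9) (.add (reg 8) (.const 1)))
              (.add (.mul (.get 5 (reg 9)) (.get 5 (reg 9))) (vreg 12)))
            (.setIdx 13 (cell (reg 9) (.add (reg 8) (.const 1))) (reg 17))))))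

lemma exec_dpProg {N s : ℕ} (hN : 1 ≤ N) {σ : Store} (h4 : σ.idx 4 0 = N) (h3 : σ.idx 3 0 = s)
    (h7 : ∀ v b, b ≤ s → N ≤ v ∨ b = 0 → σ.val 7 (v * (s + 1) + b) = 0) :
    Exec dpProg σ (N * (s * (s * 110 + 250) + 40) + 20) fun σ' =>
      DPSpec N s (σ.val 5) (σ'.val 7) (σ'.idx 13) fun _ _ => True := by
  -- the outer loop treats the nodes in decreasing order, the inner one their budgets in increasing order
  refine (Exec.forProg (T := 9 + (s * (s * 110 + 240) + 12)) (Inv := fun i σ' =>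
    DPSpec N s (σ.val 5) (σ'.val 7) (σ'.idx 13) fun v _ => N < v + 1 + i) (N - 1) rfl
    (fun σ' F => by simp [IExp.eval, F.1 4 rfl, h4]) (fun i σ' j h => by simpa using h)
    ⟨h7, fun v b h1 h2 h3 h => by omega⟩ ?_ fun σ' F k =>
      ⟨k.1, fun v b h1 h2 h3 _ => k.2 v b h1 h2 h3 (by omega)⟩).mono ?_ fun _ h => h
  · intro i hi σ₁ F₁ hiv k₁
    obtain ⟨w, hw⟩ : ∃ w, w = N - 1 - i := ⟨_, rfl⟩
    refine Exec.seq (Exec.mono (Exec.frame (Exec.of_run (Q := fun σ' => σ'.idx 9 0 = w) rfl ?_))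
      (by decide) ?_)
    · simp [Prog.run, Store.writeIdx_idx, IExp.eval, F₁.1 4 rfl, h4, hiv, hw]
    rintro σ₂ ⟨F₂, k₂⟩
    have e3 : σ₂.idx 3 0 = s := by rw [F₂.1 3 rfl, F₁.1 3 rfl, h3]
    refine (Exec.forProg (T := s * 110 + 220) (Inv := fun j σ' =>
      DPSpec N s (σ.val 5) (σ'.val 7) (σ'.idx 13) fun v b => w < v ∨ v = w ∧ b < j) s rfl
      (fun σ' F => by rw [reg_eval, F.1 3 rfl, e3]) (fun i σ' j h => by simpa using h)
      ?_ ?_ fun σ' F k => ⟨k.1, fun v b h1 h2 h3 h => k.2 v b h1 h2 h3 (by omega)⟩).mono ?_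
      fun _ h => h
    · rw [F₂.2 7 rfl, F₂.1 13 rfl]
      exact ⟨k₁.1, fun v b h1 h2 h3 h => k₁.2 v b h1 h2 h3 (by omega)⟩
    · intro j hj σ₃ F₃ hjv k₃
      have e3' : σ₃.idx 3 0 = s := by rw [F₃.1 3 rfl, e3]
      have e9 : σ₃.idx 9 0 = w := by rw [F₃.1 9 rfl, k₂]
      refine (Exec.seq (U := 40) ((exec_bestSplitProg σ₃).frame.mono
        le_rfl ?_)).mono (by rw [hjv]; omega) fun _ h => h
      rintro σ₄ ⟨F₄, k₄, k₄', k₄''⟩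
      rw [hjv] at k₄
      rw [hjv, e3', e9] at k₄' k₄''
      refine Exec.flat rfl (by decide) ?_
      have e3'' : σ₄.idx 3 0 = s := by rw [F₄.1 3 rfl, e3']
      have e9' : σ₄.idx 9 0 = w := by rw [F₄.1 9 rfl, e9]
      have e8 : σ₄.idx 8 0 = j := by rw [F₄.1 8 rfl, hjv]
      have e5 : σ₄.val 5 = σ.val 5 := by rw [F₄.2 5 rfl, F₃.2 5 rfl, F₂.2 5 rfl, F₁.2 5 rfl]
      have e7 : σ₄.val 7 = σ₃.val 7 := F₄.2 7 rfl
      have e13 : σ₄.idx 13 = σ₃.idx 13 := F₄.1 13 rfl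
      have key := DPSpec.step (w := w) (j := j) (by omega) (by omega) hj k₃ k₄
        (fun i hi => (k₄'' i hi).trans k₄'.le)
      rw [show σ₃.val 7 (2 * w * (s + 1) + σ₄.idx 17 0) + σ₃.val 7 ((2 * w + 1) * (s + 1)
        + (j - σ₄.idx 17 0)) = σ₄.val 12 0 from k₄'.symm] at key
      convert key using 1
      · funext x
        simp only [Prog.run, Store.writeVal_val, Store.writeIdx_val, RExp.eval, IExp.eval, reg_eval,
          vreg_eval, cell, e3'', e9', e8, e5, e7, true_and, Function.update_apply]
      · funext x
        simp only [Prog.run, Store.writeVal_idx, Store.writeIdx_idx, IExp.eval, reg_eval,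
          cell, e3'', e9', e8, e13, true_and, Function.update_apply]
    · simp only [reg_cost]
      nlinarith
  · simp only [IExp.cost, reg_cost]
    have : (N - 1) * (9 + (s * (s * 110 + 240) + 12) + (1 + 2 + 1) + 10)
        ≤ N * (s * (s * 110 + 250) + 40) := Nat.mul_le_mul (by omega) (by nlinarith)
    rw [add_assoc]
    exact Nat.add_le_add this (by norm_num)

/-- The budgets of the children of the node `i + 1`, where `i` is the content of the register `7`, and
the new value of `z` at this node. -/
def allocBody : Prog :=
  .seq (.setIdx 9 (.const 0) (.add (reg 7) (.const 1)))
    (.cond (.idxLt (.const 0) (.get 14 (reg 9)))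
      (.seq (.setVal 4 (reg 9) (.get 5 (reg 9)))
        (.seq (.setIdx 14 (.mul (.const 2) (reg 9)) (.get 13 (cell (reg 9) (.get 14 (reg 9)))))
          (.setIdx 14 (.add (.mul (.const 2) (reg 9)) (.const 1))
            (.sub (.sub (.get 14 (reg 9)) (.const 1))
              (.get 13 (cell (reg 9) (.get 14 (reg 9))))))))
      (.seq (.setVal 4 (reg 9) (.ofIdx (.const 0)))
        (.seq (.setIdx 14 (.mul (.const 2) (reg 9)) (.const 0))
          (.setIdx 14 (.add (.mul (.const 2) (reg 9)) (.const 1)) (.const 0)))))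

/-- The effect of one round, where `w` is the node that is treated. -/
lemma allocBody_run {σ : Store} {w : ℕ} (hw : w = σ.idx 7 0 + 1) :
    (allocBody.run σ).idx 14 = Function.update (Function.update (σ.idx 14) (2 * w)
      (if 0 < σ.idx 14 w then σ.idx 13 (w * (σ.idx 3 0 + 1) + σ.idx 14 w) else 0)) (2 * w + 1)
      (if 0 < σ.idx 14 w then σ.idx 14 w - 1 - σ.idx 13 (w * (σ.idx 3 0 + 1) + σ.idx 14 w)
        else 0) ∧
    (allocBody.run σ).val 4 = Function.update (σ.val 4) w
      (if 0 < σ.idx 14 w then σ.val 5 w else 0) := by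
  have hne : w ≠ 2 * w := by omega
  refine ⟨funext fun x => ?_, funext fun x => ?_⟩ <;> by_cases hc : 0 < σ.idx 14 w <;>
    simp [allocBody, Prog.run, Test.Holds, IExp.eval, RExp.eval, Store.writeIdx_idx,
      Store.writeVal_val, Function.update_apply, cell, ← hw, hc, hne]

/-- The budgets, from the root to the leaves, and the restriction of `a` to the nodes with a positive
budget. -/
def allocProg : Prog :=
  .seq (.setIdx 14 (.const 1) (reg 3)) (forProg 7 (.sub (reg 4) (.const 1)) allocBody)

lemma exec_allocProg {N s : ℕ} (hN : 1 ≤ N) {σ : Store} (h4 : σ.idx 4 0 = N) (h3 : σ.idx 3 0 = s)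
    (hz : ∀ v, v ∉ Finset.Ico 1 N → σ.val 4 v = 0) :
    Exec allocProg σ (N * 110 + 20) fun σ' =>
      ∃ β, BudgetSpec N s (σ.idx 13) β ∧
        ∀ v, σ'.val 4 v = if v ∈ ({v ∈ Finset.Ico 1 N | 0 < β v} : Finset ℕ) then σ.val 5 v
          else 0 := by
  refine (Exec.seq (T := 4) (U := (N - 1) * 110 + 16) (Exec.mono (Exec.frame (Exec.of_run
    (Q := fun σ' => σ'.idx 14 1 = s) rfl ?_)) (by decide) ?_)).mono
    (by omega) fun _ h => h
  · simp [Prog.run, Store.writeIdx_idx, IExp.eval, h3]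
  rintro σ₁ ⟨F₁, k₁⟩
  -- the budgets of the children are determined by that of the parent, which is not written again
  refine (Exec.forProg (T := 95) (Inv := fun i σ' => σ'.idx 14 1 = s ∧ ∀ v,
    (1 ≤ v ∧ v < i + 1 →
      σ'.val 4 v = (if 0 < σ'.idx 14 v then σ.val 5 v else 0) ∧
      σ'.idx 14 (2 * v) = (if 0 < σ'.idx 14 v then
        σ.idx 13 (v * (s + 1) + σ'.idx 14 v) else 0) ∧
      σ'.idx 14 (2 * v + 1) = (if 0 < σ'.idx 14 v then σ'.idx 14 v - 1 -
        σ.idx 13 (v * (s + 1) + σ'.idx 14 v) else 0)) ∧ (v ∉ Finset.Ico 1 N → σ'.val 4 v = 0))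
    (N - 1) rfl
    (fun σ' F => by simp [IExp.eval, F.1 4 rfl, F₁.1 4 rfl, h4]) (fun i σ' j h => by simpa using h)
    ⟨k₁, fun v => ⟨by omega, by rw [F₁.2 4 rfl]; exact hz v⟩⟩ ?_
    fun σ' F k => ⟨σ'.idx 14, ⟨k.1, fun v h1 h2 => ((k.2 v).1 ⟨h1, by omega⟩).2⟩, fun v => ?_⟩).mono
    (by simp only [IExp.cost, reg_cost]; omega) fun _ h => h
  · rintro i hi σ₂ F₂ hiv ⟨k₂, k₂'⟩
    refine Exec.flat rfl (by decide) ?_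
    obtain ⟨w, hw⟩ : ∃ w, w = i + 1 := ⟨_, rfl⟩
    have e3 : σ₂.idx 3 0 = s := by rw [F₂.1 3 rfl, F₁.1 3 rfl, h3]
    have e5 : σ₂.val 5 = σ.val 5 := by rw [F₂.2 5 rfl, F₁.2 5 rfl]
    have e13 : σ₂.idx 13 = σ.idx 13 := by rw [F₂.1 13 rfl, F₁.1 13 rfl]
    obtain ⟨q1, q2⟩ := allocBody_run (σ := σ₂) (w := w) (by rw [hiv]; exact hw)
    rw [q1, q2, e3, e5, e13]
    refine ⟨?_, fun v => ⟨fun hv => ?_, fun hv => ?_⟩⟩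
    · rw [Function.update_of_ne (by omega), Function.update_of_ne (by omega), k₂]
    · have n1 : v ≠ 2 * w + 1 := by omega
      have n2 : v ≠ 2 * w := by omega
      rw [Function.update_of_ne n1, Function.update_of_ne n2]
      by_cases hvw : v = w
      · subst hvw
        rw [Function.update_self, Function.update_self, Function.update_of_ne (by omega),
          Function.update_self]
        exact ⟨rfl, rfl, rfl⟩
      · rw [Function.update_of_ne (by omega), Function.update_of_ne (by omega),
          Function.update_of_ne (by omega), Function.update_of_ne (by omega),
          Function.update_of_ne (by omega)]
        exact (k₂' v).1 (by omega)
    · rw [Function.update_of_ne (by rintro rfl; exact hv (Finset.mem_Ico.mpr (by omega)))]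
      exact (k₂' v).2 hv
  · by_cases hv : v ∈ Finset.Ico 1 N
    · have hv' := Finset.mem_Ico.mp hv
      rw [((k.2 v).1 (by omega)).1]
      simp only [Finset.mem_filter, hv, true_and]
    · rw [(k.2 v).2 hv, if_neg fun h => hv (Finset.mem_filter.mp h).1]

/-- One step of iterative hard thresholding with the tree model: `z'` is the restriction of the gradient
step `a` to a heap tree of at most `s` nodes on which the energy of `a` is largest. -/
def IsThresholdingStep (N s m : ℕ) (B : ℕ → ℕ → ℝ) (b z z' : ℕ → ℝ) : Prop :=
  ∃ a : ℕ → ℝ, (∀ v < N, a v = z v + (∑ r ∈ Finset.range m,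
      B r v * (b r - ∑ v ∈ Finset.range N, B r v * z v)) / m) ∧
    ∃ S, HeapTree N S ∧ S.card ≤ s ∧
      (∀ T, HeapTree N T → T.card ≤ s → ∑ v ∈ T, a v ^ 2 ≤ ∑ v ∈ S, a v ^ 2) ∧
      ∀ v, z' v = if v ∈ S then a v else 0

/-- `J` steps of iterative hard thresholding, where `J` is the content of the register `6`. -/
def iterationProg : Prog :=
  forProg 18 (reg 6) (.seq residualProg (.seq gradientProg (.seq dpProg allocProg)))

lemma exec_iterationProg {n N s m : ℕ} {B : ℕ → ℕ → ℝ} {b : ℕ → ℝ} {σ : Store} (hN : 1 ≤ N)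
    (h : HasData n N s m B b σ) (h4 : σ.val 4 = 0) (h7 : σ.val 7 = 0)
    {P : ℕ → (ℕ → ℝ) → Prop} (h0 : P 0 0)
    (hstep : ∀ i z z', P i z → IsThresholdingStep N s m B b z z' → P (i + 1) z') :
    Exec iterationProg σ (σ.idx 6 0 * (N * (m * 100 + s * (s * 110 + 250) + 300) + m * 60 + 100) + 20)
      fun σ' => P (σ.idx 6 0) (σ'.val 4) ∧ ∀ v, v ∉ Finset.Ico 1 N → σ'.val 4 v = 0 := by
  refine (Exec.forProg (T := (m * (N * 50 + 60) + 12) + ((N * (m * 50 + 60) + 12) +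
    ((N * (s * (s * 110 + 250) + 40) + 20) + (N * 110 + 20)))) (Inv := fun i σ' =>
    P i (σ'.val 4) ∧ (∀ v, v ∉ Finset.Ico 1 N → σ'.val 4 v = 0) ∧
    ∀ v b, b ≤ s → N ≤ v ∨ b = 0 → σ'.val 7 (v * (s + 1) + b) = 0) (σ.idx 6 0) rfl
    (fun σ' F => by rw [reg_eval, F.1 6 rfl]) (fun i σ' j k => k)
    ⟨by rw [h4]; exact h0, by simp [h4], by simp [h7]⟩ ?_ fun σ' F k => ⟨k.1, k.2.1⟩).mono ?_
    fun _ h => h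
  swap
  · simp only [reg_cost]
    rw [add_assoc]
    refine Nat.add_le_add (Nat.mul_le_mul le_rfl ?_) (by norm_num)
    nlinarith
  rintro i hi σ₁ F₁ hiv ⟨k₁, k₁', k₁''⟩
  have d₁ := h.frame F₁ rfl
  refine Exec.seq ((exec_residualProg d₁).frame.mono le_rfl ?_)
  rintro σ₂ ⟨F₂, k₂⟩
  have d₂ := d₁.frame F₂ rfl
  refine Exec.seq ((exec_gradientProg d₂).frame.mono le_rfl ?_)
  rintro σ₃ ⟨F₃, k₃⟩
  have d₃ := d₂.frame F₃ rfl
  refine Exec.seq ((exec_dpProg hN d₃.N_eq d₃.s_eq (by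
    rw [F₃.2 7 rfl, F₂.2 7 rfl]; exact k₁'')).frame.mono le_rfl ?_)
  rintro σ₄ ⟨F₄, k₄⟩
  have d₄ := d₃.frame F₄ rfl
  refine (exec_allocProg hN d₄.N_eq d₄.s_eq (by
    rw [F₄.2 4 rfl, F₃.2 4 rfl, F₂.2 4 rfl]; exact k₁')).frame.mono le_rfl ?_
  rintro σ₅ ⟨F₅, β, hβ, k₅⟩
  obtain ⟨o1, o2, o3⟩ := k₄.optimal hN hβ
  rw [F₄.2 5 rfl] at k₅
  refine ⟨hstep i (σ₁.val 4) _ k₁ ⟨σ₃.val 5, fun v hv => ?_, _, o1, o2, o3, k₅⟩, fun v hv => ?_, ?_⟩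
  · rw [k₃ v hv, F₂.2 4 rfl]
    congr 2
    exact Finset.sum_congr rfl fun r hr => by rw [k₂ r (Finset.mem_range.mp hr)]
  · rw [k₅, if_neg fun h => hv (Finset.mem_filter.mp h).1]
  · rw [F₅.2 7 rfl]
    exact k₄.1

/-! ### Rounding, verification and output -/

/-- The estimates `z v / w v` of the masses, rounded to the nearest natural number below `2 ^ J` by
comparisons with the powers of two, into the array `11`. -/
def roundProg : Prog :=
  forProg 7 (reg 4)
    (.seq (.setVal 11 (reg 7) (.ofIdx (.const 0)))
      (forProg 8 (reg 6)
        (.cond (.valLe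
            (.add (.get 11 (reg 7)) (.get 9 (.sub (.sub (reg 6) (.const 1)) (reg 8))))
            (.add (.div (.get 4 (reg 7)) (.get 10 (reg 7)))
              (.div (.ofIdx (.const 1)) (.ofIdx (.const 2)))))
          (.setVal 11 (reg 7)
            (.add (.get 11 (reg 7)) (.get 9 (.sub (.sub (reg 6) (.const 1)) (reg 8)))))
          .skip)))

/-- The comparison of `x + 1 / 2` with the leading digits of `t` and a further digit `1` decides
whether the digit of `t` at `2 ^ e` is `1`, if `x` is closer than `1 / 2` to `t`. -/
lemma binary_digit_step {t e : ℕ} {x : ℝ} (hx : |x - t| < 1 / 2) :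
    (((t / 2 ^ (e + 1) * 2 ^ (e + 1) : ℕ) : ℝ) + 2 ^ e ≤ x + 1 / 2 →
      t / 2 ^ (e + 1) * 2 ^ (e + 1) + 2 ^ e = t / 2 ^ e * 2 ^ e) ∧
    (¬ ((t / 2 ^ (e + 1) * 2 ^ (e + 1) : ℕ) : ℝ) + 2 ^ e ≤ x + 1 / 2 →
      t / 2 ^ (e + 1) * 2 ^ (e + 1) = t / 2 ^ e * 2 ^ e) := by
  have h2 := abs_lt.mp hx
  have hpos : 0 < 2 ^ e := by positivity
  have hq : t / 2 ^ (e + 1) = t / 2 ^ e / 2 := by rw [pow_succ, Nat.div_div_eq_div_mul]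
  have key : ((t / 2 ^ (e + 1) * 2 ^ (e + 1) : ℕ) : ℝ) + 2 ^ e ≤ x + 1 / 2 ↔
      2 * (t / 2 ^ e / 2) + 1 ≤ t / 2 ^ e := by
    rw [Nat.le_div_iff_mul_le hpos, hq]
    have e1 : (2 * (t / 2 ^ e / 2) + 1) * 2 ^ e = t / 2 ^ e / 2 * 2 ^ (e + 1) + 2 ^ e := by
      rw [pow_succ]; ring
    rw [e1]
    constructor
    · intro h
      have : ((t / 2 ^ e / 2 * 2 ^ (e + 1) + 2 ^ e : ℕ) : ℝ) < (t + 1 : ℕ) := by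
        push_cast at h ⊢; linarith
      have := Nat.cast_lt.mp this
      omega
    · intro h
      have : ((t / 2 ^ e / 2 * 2 ^ (e + 1) + 2 ^ e : ℕ) : ℝ) ≤ (t : ℕ) := Nat.cast_le.mpr h
      push_cast at this ⊢
      linarith
  rw [key, hq, pow_succ]
  constructor
  · intro h
    have : t / 2 ^ e = 2 * (t / 2 ^ e / 2) + 1 := by omega
    calc t / 2 ^ e / 2 * (2 ^ e * 2) + 2 ^ e = (2 * (t / 2 ^ e / 2) + 1) * 2 ^ e := by ring
      _ = t / 2 ^ e * 2 ^ e := by rw [← this]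
  · intro h
    have : t / 2 ^ e = 2 * (t / 2 ^ e / 2) := by omega
    calc t / 2 ^ e / 2 * (2 ^ e * 2) = (2 * (t / 2 ^ e / 2)) * 2 ^ e := by ring
      _ = t / 2 ^ e * 2 ^ e := by rw [← this]

lemma exec_roundProg {N J : ℕ} {σ : Store} (h4 : σ.idx 4 0 = N) (h6 : σ.idx 6 0 = J)
    (h9 : ∀ j ≤ J, σ.val 9 j = 2 ^ j) :
    Exec roundProg σ (N * (J * 70 + 40) + 20) fun σ' =>
      (∀ v < N, ∀ t : ℕ, t < 2 ^ J → |σ.val 4 v / σ.val 10 v - t| < 1 / 2 → σ'.val 11 v = t) ∧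
      ∀ v, N ≤ v → σ'.val 11 v = σ.val 11 v := by
  refine (Exec.forProg (T := 5 + (J * 70 + 12)) (Inv := fun i σ' =>
    (∀ v < i, ∀ t : ℕ, t < 2 ^ J → |σ.val 4 v / σ.val 10 v - t| < 1 / 2 → σ'.val 11 v = t) ∧
      ∀ v, N ≤ v → σ'.val 11 v = σ.val 11 v) N rfl
    (fun σ' F => by rw [reg_eval, F.1 4 rfl, h4]) (fun i σ' j h => by simpa using h)
    ⟨by simp, fun v _ => rfl⟩ ?_ fun σ' F k => k).mono ?_ fun _ h => h
  swap
  · simp only [reg_cost]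
    have : N * (5 + (J * 70 + 12) + 2 + 10) ≤ N * (J * 70 + 40) :=
      Nat.mul_le_mul le_rfl (by omega)
    omega
  rintro i hi σ₁ F₁ hiv ⟨k₁, k₁'⟩
  refine Exec.seq (Exec.mono (Exec.frame (Exec.of_run (Q := fun σ' =>
    σ'.val 11 = Function.update (σ₁.val 11) i 0) rfl ?_)) (by decide) ?_)
  · funext x
    simp [Prog.run, Store.writeVal_val, RExp.eval, IExp.eval, hiv, Function.update_apply]
  rintro σ₂ ⟨F₂, k₂⟩
  -- after `j` rounds the leading `j` of the `J` binary digits of `t` are known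
  refine (Exec.forProg (T := 55) (Inv := fun j σ' =>
    (∀ v < i, ∀ t : ℕ, t < 2 ^ J → |σ.val 4 v / σ.val 10 v - t| < 1 / 2 → σ'.val 11 v = t) ∧
    (∀ t : ℕ, t < 2 ^ J → |σ.val 4 i / σ.val 10 i - t| < 1 / 2 →
      σ'.val 11 i = (t / 2 ^ (J - j) * 2 ^ (J - j) : ℕ)) ∧
    ∀ v, N ≤ v → σ'.val 11 v = σ.val 11 v) J rfl
    (fun σ' F => by rw [reg_eval, F.1 6 rfl, F₂.1 6 rfl, F₁.1 6 rfl, h6])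
    (fun i σ' j h => by simpa using h) ⟨fun v hv => ?_, fun t ht _ => ?_, fun v hv => ?_⟩ ?_
    fun σ' F k => ⟨fun v hv t ht htv => ?_, k.2.2⟩).mono ?_ fun _ h => h
  · rw [k₂, Function.update_of_ne hv.ne]
    exact k₁ v hv
  · rw [k₂, Function.update_self, Nat.sub_zero, Nat.div_eq_of_lt ht]
    simp
  · rw [k₂, Function.update_of_ne (by omega)]
    exact k₁' v hv
  · rintro j hj σ₃ F₃ hjv ⟨k₃, k₃', k₃''⟩
    refine Exec.flat rfl (by decide) ?_
    obtain ⟨e, he⟩ : ∃ e, e = J - 1 - j := ⟨_, rfl⟩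
    have e7 : σ₃.idx 7 0 = i := by rw [F₃.1 7 rfl, F₂.1 7 rfl, hiv]
    have e6 : σ₃.idx 6 0 = J := by rw [F₃.1 6 rfl, F₂.1 6 rfl, F₁.1 6 rfl, h6]
    have e9 : σ₃.val 9 e = 2 ^ e := by
      rw [F₃.2 9 rfl, F₂.2 9 rfl, F₁.2 9 rfl, h9 e (by omega)]
    have e4 : σ₃.val 4 = σ.val 4 := by rw [F₃.2 4 rfl, F₂.2 4 rfl, F₁.2 4 rfl]
    have e10 : σ₃.val 10 = σ.val 10 := by rw [F₃.2 10 rfl, F₂.2 10 rfl, F₁.2 10 rfl]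
    simp only [Prog.run, Test.Holds, RExp.eval, IExp.eval, reg_eval, e7, e6, hjv, ← he, e9, e4, e10,
      Nat.cast_one, Nat.cast_ofNat]
    rw [show J - (j + 1) = e by omega]
    have e' : J - j = e + 1 := by omega
    rw [e'] at k₃'
    split_ifs with hc
    · simp only [Store.writeVal_val, true_and]
      refine ⟨fun v hv => ?_, fun t ht htx => ?_, fun v hv => ?_⟩
      · rw [if_neg hv.ne]
        exact k₃ v hv
      · have k := k₃' t ht htx
        rw [k] at hc
        rw [if_pos trivial, k, ← (binary_digit_step htx).1 hc]
        push_cast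
        ring
      · rw [if_neg (by omega)]
        exact k₃'' v hv
    · refine ⟨k₃, fun t ht htx => ?_, k₃''⟩
      have k := k₃' t ht htx
      rw [k] at hc
      rw [k, (binary_digit_step htx).2 hc]
  · simp only [reg_cost]
    omega
  · rcases Nat.lt_succ_iff_lt_or_eq.mp hv with h | rfl
    · exact k.1 v h t ht htv
    · rw [k.2.1 t ht htv, Nat.sub_self, pow_zero, Nat.div_one, mul_one]

/-- The register `15` becomes `1` if the rounded masses have the given sketch, and `0` otherwise. -/
def checkProg : Prog :=
  .seq (.setIdx 15 (.const 0) (.const 1))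
    (forProg 7 (reg 5)
      (.seq (sumProg 8 (reg 4)
          (.mul (entry (reg 7) (reg 8)) (.mul (.get 10 (reg 8)) (.get 11 (reg 8)))))
        (.seq (.cond (.valLt (vreg 8) (.get 2 (reg 7))) (.setIdx 15 (.const 0) (.const 0)) .skip)
          (.cond (.valLt (.get 2 (reg 7)) (vreg 8)) (.setIdx 15 (.const 0) (.const 0)) .skip))))

lemma exec_checkProg {n N s m : ℕ} {B : ℕ → ℕ → ℝ} {b : ℕ → ℝ} {σ : Store}
    (h : HasData n N s m B b σ) :
    Exec checkProg σ (m * (N * 60 + 80) + 20) fun σ' =>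
      (σ'.idx 15 0 = 0 ↔ ¬ ∀ r < m,
        ∑ v ∈ Finset.range N, B r v * (σ.val 10 v * σ.val 11 v) = b r) := by
  refine (Exec.seq (T := 3) (U := m * (N * 60 + 80) + 12) (Exec.mono (Exec.frame (Exec.of_run
    (Q := fun σ' => σ'.idx 15 0 = 1) rfl ?_)) (by decide) ?_)).mono
    (by omega) fun _ h => h
  · simp [Prog.run, Store.writeIdx_idx, IExp.eval]
  rintro σ₁ ⟨F₁, k₁⟩
  have d₁ := h.frame F₁ rfl
  refine (Exec.forProg (T := (N * 44 + 22) + 30) (Inv := fun i σ' => (σ'.idx 15 0 = 0 ↔ ¬ ∀ r < i,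
    ∑ v ∈ Finset.range N, B r v * (σ.val 10 v * σ.val 11 v) = b r)) m rfl
    (fun σ' F => by rw [reg_eval, F.1 5 rfl, d₁.m_eq]) (fun i σ' j h => by simpa using h)
    (by simp [k₁]) ?_ fun σ' F k => k).mono ?_ fun _ h => h
  swap
  · simp only [reg_cost]
    have : m * (N * 44 + 22 + 30 + 2 + 10) ≤ m * (N * 60 + 80) :=
      Nat.mul_le_mul le_rfl (by omega)
    omega
  rintro i hi σ₂ F₂ hiv k₂
  refine Exec.seq (Exec.mono (Exec.frame (Exec.sumProg N
    (fun v => B i v * (σ.val 10 v * σ.val 11 v)) ?_ ?_))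
      (by simp [RExp.cost, entry, IExp.cost]) ?_)
  · intro σ' F
    rw [reg_eval, F.1 4 rfl, F₂.1 4 rfl, d₁.N_eq]
  · intro v hv σ' F hvv
    have h' := (d₁.frame F₂ rfl).frame F rfl
    have e7 : σ'.idx 7 0 = i := by rw [F.1 7 rfl, hiv]
    rw [RExp.eval, h'.entry_eval (by rw [reg_eval, e7]; exact hi)
      (by rw [reg_eval, hvv]; exact hv)]
    simp only [reg_eval, RExp.eval, e7, hvv, F.2 10 rfl, F₂.2 10 rfl, F₁.2 10 rfl, F.2 11 rfl,
      F₂.2 11 rfl, F₁.2 11 rfl]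
  · rintro σ₃ ⟨F₃, k₃⟩
    refine Exec.flat rfl (by decide) ?_
    have e7 : σ₃.idx 7 0 = i := by rw [F₃.1 7 rfl, hiv]
    have e2 : σ₃.val 2 = b := by rw [F₃.2 2 rfl, F₂.2 2 rfl, F₁.2 2 rfl, h.b_eq]
    have e15 : σ₃.idx 15 = σ₂.idx 15 := F₃.1 15 rfl
    have hall : (∀ r < i + 1, ∑ v ∈ Finset.range N, B r v * (σ.val 10 v * σ.val 11 v) = b r) ↔
        (∀ r < i, ∑ v ∈ Finset.range N, B r v * (σ.val 10 v * σ.val 11 v) = b r) ∧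
          σ₃.val 8 0 = b i := by
      rw [k₃]
      refine ⟨fun H => ⟨fun r hr => H r (by omega), H i (by omega)⟩, fun H r hr => ?_⟩
      rcases Nat.lt_succ_iff_lt_or_eq.mp hr with h | rfl
      · exact H.1 r h
      · exact H.2
    rw [hall]
    rcases lt_trichotomy (σ₃.val 8 0) (b i) with hc | hc | hc
    · simp [Prog.run, Test.Holds, RExp.eval, e7, e2, hc, hc.not_gt, Store.writeIdx_idx, IExp.eval,
        hc.ne]
    · simp [Prog.run, Test.Holds, RExp.eval, e7, e2, hc, e15, k₂]
    · simp [Prog.run, Test.Holds, RExp.eval, e7, e2, hc, hc.not_gt, Store.writeIdx_idx, IExp.eval,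
        hc.ne']

/-- The masses that are output: the rounded ones if they passed the check, the estimates `z v / w v`
otherwise, and `0` on empty cells. -/
def selectProg : Prog :=
  forProg 7 (reg 4)
    (.seq
      (.cond (.idxLe (reg 15) (.const 0))
        (.setVal 11 (reg 7) (.div (.get 4 (reg 7)) (.get 10 (reg 7)))) .skip)
      (.cond (.idxLe (.get 12 (reg 7)) (.const 0))
        (.setVal 11 (reg 7) (.ofIdx (.const 0))) .skip))

open Classical in
lemma exec_selectProg {N : ℕ} {σ : Store} (h4 : σ.idx 4 0 = N) :
    Exec selectProg σ (N * 50 + 20) fun σ' => ∀ v, σ'.val 11 v = if v < N then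
      (if σ.idx 12 v = 0 then 0 else if σ.idx 15 0 = 0 then σ.val 4 v / σ.val 10 v
        else σ.val 11 v) else σ.val 11 v := by
  refine (Exec.forProg (T := 30) (Inv := fun i σ' => ∀ v, σ'.val 11 v = if v < i then
      (if σ.idx 12 v = 0 then 0 else if σ.idx 15 0 = 0 then σ.val 4 v / σ.val 10 v
        else σ.val 11 v) else σ.val 11 v) N rfl
    (fun σ' F => by rw [reg_eval, F.1 4 rfl, h4]) (fun i σ' j h => by simpa using h)
    (by simp) ?_ fun σ' F k => k).mono (by simp only [reg_cost]; omega) fun _ h => h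
  rintro i hi σ₁ F₁ hiv k₁
  refine Exec.flat rfl (by decide) ?_
  have e15 : σ₁.idx 15 = σ.idx 15 := F₁.1 15 rfl
  have e12 : σ₁.idx 12 = σ.idx 12 := F₁.1 12 rfl
  have e4 : σ₁.val 4 = σ.val 4 := F₁.2 4 rfl
  have e10 : σ₁.val 10 = σ.val 10 := F₁.2 10 rfl
  have hi11 : σ₁.val 11 i = σ.val 11 i := by rw [k₁, if_neg (lt_irrefl _)]
  intro v
  by_cases hv : v = i
  · subst hv
    rw [if_pos (Nat.lt_succ_self _)]
    by_cases c1 : σ.idx 15 0 = 0 <;> by_cases c2 : σ.idx 12 v = 0 <;>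
      simp [Prog.run, Test.Holds, RExp.eval, IExp.eval, Store.writeVal_val, e15, e12, e4, e10, hiv,
        c1, c2, hi11]
  · have e : (v < i + 1) = (v < i) := by
      rw [eq_iff_iff]; omega
    simp only [e]
    rw [← k₁ v]
    by_cases c1 : σ.idx 15 0 = 0 <;> by_cases c2 : σ.idx 12 i = 0 <;>
      simp [Prog.run, Test.Holds, RExp.eval, IExp.eval, Store.writeVal_val, e15, e12, hiv,
        c1, c2, hv]

/-- The image with the given masses: what the children of a node leave of its mass is placed on the
representative pixel of the node. -/
def rebuildProg : Prog :=
  forProg 7 (.sub (reg 4) (.const 1))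
    (.seq (.setIdx 9 (.const 0) (.add (reg 7) (.const 1)))
      (.setVal 3 (.sub (.get 12 (reg 9)) (.const 1))
        (.add (.get 3 (.sub (.get 12 (reg 9)) (.const 1)))
          (.sub (.get 11 (reg 9)) (.add (.get 11 (.mul (.const 2) (reg 9)))
            (.get 11 (.add (.mul (.const 2) (reg 9)) (.const 1))))))))

lemma exec_rebuildProg {h : ℕ} {σ : Store} (h4 : σ.idx 4 0 = 2 * 4 ^ h) (h3 : σ.val 3 = 0) :
    Exec rebuildProg σ (2 * 4 ^ h * 60 + 20) fun σ' =>
      ∀ q, σ'.val 3 q = rebuild h (σ.idx 12) (σ.val 11) q := by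
  have hN : 1 ≤ 2 * 4 ^ h := by have : 0 < 4 ^ h := by positivity
                                omega
  generalize hNN : 2 * 4 ^ h = N at *
  refine (Exec.forProg (T := 40) (Inv := fun i σ' => ∀ q, σ'.val 3 q = ∑ v ∈ Finset.Ico 1 (i + 1),
    if σ.idx 12 v - 1 = q then σ.val 11 v - (σ.val 11 (2 * v) + σ.val 11 (2 * v + 1)) else 0)
    (N - 1) rfl (fun σ' F => by simp [IExp.eval, F.1 4 rfl, h4])
    (fun i σ' j h => by simpa using h) (by simp [h3]) ?_ fun σ' F k q => ?_).mono ?_ fun _ h => h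
  · rintro i hi σ₁ F₁ hiv k₁
    refine Exec.flat rfl (by decide) ?_
    intro q
    rw [Finset.sum_Ico_succ_top (by omega), ← k₁ q]
    by_cases hq : σ.idx 12 (i + 1) - 1 = q
    · subst hq
      simp [Prog.run, RExp.eval, IExp.eval, Store.writeVal_val, Store.writeIdx_idx, hiv,
        F₁.1 12 rfl, F₁.2 11 rfl]
    · simp [Prog.run, RExp.eval, IExp.eval, Store.writeVal_val, Store.writeIdx_idx, hiv,
        F₁.1 12 rfl, F₁.2 11 rfl, hq, Ne.symm hq]
  · rw [k q, rebuild, hNN, show N - 1 + 1 = N by omega]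
  · simp only [IExp.cost, reg_cost]
    omega

/-! ### The recovery program -/

/-- The recovery program; `c` is the constant in the number of measurements. -/
def recoveryProg (c : ℕ) : Prog :=
  .seq (setupProg c) (.seq tableProg (.seq powerProg (.seq iterationProg
    (.seq roundProg (.seq checkProg (.seq selectProg rebuildProg))))))

/-- What the recovery program computes from the sketch `b`, in terms of its iterate `z` after `J` steps:
the masses `y` are the rounded values of `z v / w v` where these are close to natural numbers, `Y` are
the masses that are output and `out` is the resulting image. -/
structure IsRecovered (Δ h J m : ℕ) (B : ℕ → ℕ → ℝ) (b z y Y out : ℕ → ℝ) (rep : ℕ → ℕ) : Prop where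
  isRep : IsRep Δ h rep
  y_zero : y 0 = 0
  y_eq : ∀ v ∈ Finset.Ico 1 (2 * 4 ^ h), ∀ t : ℕ, t < 2 ^ J →
    |z v / nodeWeight h v - t| < 1 / 2 → y v = t
  Y_eq_zero : ∀ v, 2 * 4 ^ h ≤ v → Y v = 0
  Y_dead : ∀ v, rep v = 0 → Y v = 0
  Y_checked : (∀ r < m, ∑ v ∈ Finset.range (2 * 4 ^ h), B r v * (nodeWeight h v * y v) = b r) →
    ∀ v ∈ Finset.Ico 1 (2 * 4 ^ h), rep v ≠ 0 → Y v = y v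
  Y_unchecked : (¬ ∀ r < m, ∑ v ∈ Finset.range (2 * 4 ^ h), B r v * (nodeWeight h v * y v) = b r) →
    ∀ v ∈ Finset.Ico 1 (2 * 4 ^ h), rep v ≠ 0 → Y v = z v / nodeWeight h v
  out_eq : ∀ q, out q = rebuild h rep Y q

lemma exec_recoveryProg {c : ℕ} (hc : 0 < c) {Δ t h N m J : ℕ} (hh : h = Nat.clog 2 Δ)
    (hN : N = 2 * 4 ^ h) (hm : m = 3 * c * t) {B : ℕ → ℕ → ℝ} {b : ℕ → ℝ} {σ : Store}
    (h0 : σ.idx 0 0 = Δ) (h02 : σ.idx 0 2 = 27 * c * t) (hidx : ∀ a, a ≠ 0 → σ.idx a = 0)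
    (hval : ∀ a, 3 ≤ a → σ.val a = 0) (hb : σ.val 2 = b)
    (hB : ∀ r < m, ∀ v < N, σ.val 1 ((m + 8 * r) * (Δ * Δ) + v) = B r v)
    (hJ : J = Nat.clog 2 ⌈(1 + (∑ r ∈ Finset.range m, b r * b r) / m) * (N * N)⌉₊)
    {P : ℕ → (ℕ → ℝ) → Prop} (hP0 : P 0 0)
    (hP : ∀ i z z', P i z → IsThresholdingStep N t m B b z z' → P (i + 1) z') :
    Exec (recoveryProg c) σ (3000 * (N * ((J + 1) * ((c + 1) * (t + 1) ^ 2)))) fun σ' =>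
      ∃ z y Y rep, P J z ∧ IsRecovered Δ h J m B b z y Y (σ'.val 3) rep := by
  have hN1 : 1 ≤ 4 ^ h := Nat.one_le_pow _ _ (by norm_num)
  have hΔ : Δ ≤ 2 ^ h := hh ▸ Nat.le_pow_clog (by norm_num) _
  have hcost : (h * 13 + t * 14 + 60) + (300 * 4 ^ h + ((m * 31 + J * 40 + 60) +
      ((J * (N * (m * 100 + t * (t * 110 + 250) + 300) + m * 60 + 100) + 20) +
      ((N * (J * 70 + 40) + 20) + ((m * (N * 60 + 80) + 20) + ((N * 50 + 20) +
        (2 * 4 ^ h * 60 + 20)))))))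
      ≤ 3000 * (N * ((J + 1) * ((c + 1) * (t + 1) ^ 2))) := by
    have hhN : h ≤ N := by
      have := Nat.lt_pow_self (n := h) (show 1 < 4 by norm_num)
      omega
    have hNN : 4 ^ h ≤ N := by omega
    have hN1' : 1 ≤ N := by omega
    have hone : ∀ x : ℕ, x ≤ N * x := fun x => Nat.le_mul_of_pos_left x hN1'
    have e1 : (h * 13 + t * 14 + 60) + (300 * 4 ^ h + ((m * 31 + J * 40 + 60) +
      ((J * (N * (m * 100 + t * (t * 110 + 250) + 300) + m * 60 + 100) + 20) +
      ((N * (J * 70 + 40) + 20) + ((m * (N * 60 + 80) + 20) + ((N * 50 + 20) +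
        (2 * 4 ^ h * 60 + 20)))))))
        ≤ N * (13 + 14 * t + 700 + 31 * m + 40 * J + (160 * (J * m) + 110 * (J * (t * t))
          + 250 * (J * t) + 400 * J) + 70 * J + 140 * m) := by
      have a1 := hone t
      have a2 := hone m
      have a3 := hone J
      have a4 := hone (J * m)
      nlinarith
    refine e1.trans ?_
    rw [mul_left_comm 3000 N]
    refine Nat.mul_le_mul le_rfl ?_
    subst hm
    have b1 := Nat.zero_le (c * J * t ^ 2)
    have b2 := Nat.zero_le (c * J * t)
    have b3 := Nat.zero_le (c * J)
    have b4 := Nat.zero_le (c * t ^ 2)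
    have b5 := Nat.zero_le (c * t)
    have b6 := Nat.zero_le c
    have b7 := Nat.zero_le (J * t ^ 2)
    have b8 := Nat.zero_le (J * t)
    have b9 := Nat.zero_le J
    have b10 := Nat.zero_le (t ^ 2)
    have b11 := Nat.zero_le t
    nlinarith only [b1, b2, b3, b4, b5, b6, b7, b8, b9, b10, b11]
  refine Exec.mono ?_ hcost fun _ h => h
  refine Exec.seq ((exec_setupProg hc t σ h02).frame.mono (by rw [h0, hh]) ?_)
  rintro σ₁ ⟨F₁, s1, s2, s16, s4, s3, s5⟩
  rw [h0] at s1 s2 s16 s4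
  rw [← hh] at s2 s16 s4
  rw [← hN] at s4
  rw [← hm] at s5
  refine Exec.seq ((exec_tableProg hΔ σ₁ (by rw [F₁.1 0 rfl, h0]) s2 s16
    (by rw [F₁.1 11 rfl, hidx 11 (by norm_num)]; rfl)
    (fun v => by rw [F₁.1 12 rfl, hidx 12 (by norm_num)]; rfl)).frame.mono le_rfl ?_)
  rintro σ₂ ⟨F₂, hrep, hwt⟩
  have d₂ : HasData (Δ * Δ) N t m B b σ₂ :=
    ⟨by rw [F₂.1 1 rfl, s1], by rw [F₂.1 3 rfl, s3], by rw [F₂.1 4 rfl, s4],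
      by rw [F₂.1 5 rfl, s5], by rw [F₂.2 2 rfl, F₁.2 2 rfl, hb],
      by rw [F₂.2 1 rfl, F₁.2 1 rfl]; exact hB⟩
  have v₂ : ∀ a, 3 ≤ a → a ≠ 10 → σ₂.val a = 0 := by
    intro a ha ha'
    rw [F₂.2 a (by simp [tableProg, spreadProg, leafRepProg, leafWeightProg, treeTableProg,
      treeTableBody, forProg, Prog.writesVal, ha']), F₁.2 a rfl, hval a ha]
  refine Exec.seq ((exec_powerProg σ₂ d₂.b_eq d₂.m_eq d₂.N_eq hJ).frame.mono le_rfl ?_)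
  rintro σ₃ ⟨F₃, p1, p2⟩
  have d₃ := d₂.frame F₃ rfl
  refine Exec.seq ((exec_iterationProg (by omega) d₃ (by rw [F₃.2 4 rfl, v₂ 4 (by norm_num)
    (by norm_num)]) (by rw [F₃.2 7 rfl, v₂ 7 (by norm_num) (by norm_num)]) hP0
    hP).frame.mono (by rw [p1]) ?_)
  rintro σ₄ ⟨F₄, hPJ, hz⟩
  rw [p1] at hPJ
  have d₄ := d₃.frame F₄ rfl
  have e10 : σ₄.val 10 = σ₂.val 10 := by rw [F₄.2 10 rfl, F₃.2 10 rfl]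
  refine Exec.seq ((exec_roundProg d₄.N_eq (by rw [F₄.1 6 rfl, p1]) (by
    rw [F₄.2 9 rfl]; exact p2)).frame.mono le_rfl ?_)
  rintro σ₅ ⟨F₅, r1, r2⟩
  have d₅ := d₄.frame F₅ rfl
  have y0 : σ₅.val 11 0 = 0 := by
    have := r1 0 (by omega) 0 (by positivity) (by rw [hz 0 (by simp)]; norm_num)
    simpa using this
  refine Exec.seq ((exec_checkProg d₅).frame.mono le_rfl ?_)
  rintro σ₆ ⟨F₆, c1⟩
  have d₆ := d₅.frame F₆ rfl
  have e12 : σ₆.idx 12 = σ₂.idx 12 := by rw [F₆.1 12 rfl, F₅.1 12 rfl, F₄.1 12 rfl, F₃.1 12 rfl]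
  have e10' : σ₆.val 10 = σ₂.val 10 := by rw [F₆.2 10 rfl, F₅.2 10 rfl, e10]
  have e4 : σ₆.val 4 = σ₄.val 4 := by rw [F₆.2 4 rfl, F₅.2 4 rfl]
  refine Exec.seq ((exec_selectProg d₆.N_eq).frame.mono le_rfl ?_)
  rintro σ₇ ⟨F₇, q1⟩
  have d₇ := d₆.frame F₇ rfl
  refine (exec_rebuildProg (h := h) (by rw [d₇.N_eq, hN]) (by rw [F₇.2 3 rfl, F₆.2 3 rfl,
    F₅.2 3 rfl, F₄.2 3 rfl, F₃.2 3 rfl, v₂ 3 le_rfl (by norm_num)])).mono le_rfl ?_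
  intro σ₈ k₈
  rw [F₇.1 12 rfl, e12] at k₈
  rw [e12, e10', e4, F₆.2 11 rfl] at q1
  rw [F₅.2 10 rfl, e10] at c1
  have hmem : ∀ v, v ∈ Finset.Ico 1 (2 * 4 ^ h) → v < N := fun v hv => by
    rw [hN]; exact (Finset.mem_Ico.mp hv).2
  have hsum : ∀ r, ∑ v ∈ Finset.range (2 * 4 ^ h), B r v * (nodeWeight h v * σ₅.val 11 v)
      = ∑ v ∈ Finset.range N, B r v * (σ₂.val 10 v * σ₅.val 11 v) := by
    intro r
    rw [hN]
    refine Finset.sum_congr rfl fun v hv => ?_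
    rcases Nat.eq_zero_or_pos v with rfl | hv0
    · simp only [y0, mul_zero]
    · rw [hwt v (Finset.mem_Ico.mpr ⟨hv0, Finset.mem_range.mp hv⟩)]
  have hout : ∀ v, 2 * 4 ^ h ≤ v → σ₇.val 11 v = 0 := fun v hv => by
    rw [q1, if_neg (by omega), r2 v (by omega), F₄.2 11 rfl, F₃.2 11 rfl,
      v₂ 11 (by norm_num) (by norm_num)]
    rfl
  refine ⟨σ₄.val 4, σ₅.val 11, σ₇.val 11, σ₂.idx 12, hPJ, hrep, y0, fun v hv s hs hsv => ?_, hout,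
    fun v hv0 => ?_, fun H v hv hv0 => ?_,
    fun H v hv hv0 => ?_, k₈⟩
  · refine r1 v (hmem v hv) s hs ?_
    rwa [e10, hwt v hv]
  · by_cases hv : v < 2 * 4 ^ h
    · rw [q1, if_pos (by omega), if_pos hv0]
    · exact hout v (by omega)
  · have : σ₆.idx 15 0 ≠ 0 := fun e => c1.mp e fun r hr => by rw [← hsum]; exact H r hr
    rw [q1, if_pos (hmem v hv), if_neg hv0, if_neg this]
  · have : σ₆.idx 15 0 = 0 := c1.mpr fun H' => H fun r hr => by rw [hsum]; exact H' r hr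
    rw [q1, if_pos (hmem v hv), if_neg hv0, if_pos this, hwt v hv]

/-! ### Error of the recovered image -/

section

open Real InnerProductSpace
variable {Δ h : ℕ}

/-- The vector of the first `N` entries of an array. -/
noncomputable def arrayVec (N : ℕ) (z : ℕ → ℝ) : EuclideanSpace ℝ (Fin N) :=
  WithLp.toLp 2 fun i => z i

lemma arrayVec_apply (N : ℕ) (z : ℕ → ℝ) (i : Fin N) : arrayVec N z i = z i := rfl

lemma sum_arrayVec (N : ℕ) (f z : ℕ → ℝ) :
    ∑ i : Fin N, f i * arrayVec N z i = ∑ v ∈ Finset.range N, f v * z v :=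
  (Finset.sum_range fun v => f v * z v).symm

/-- The measurement of an array, before normalization by `√m`. -/
def measure (N : ℕ) (B : ℕ → ℕ → ℤ) (z : ℕ → ℝ) (r : ℕ) : ℝ :=
  ∑ v ∈ Finset.range N, (B r v : ℝ) * z v

/-- The normalized vector of measurements. -/
noncomputable def measuredVec (m : ℕ) (b : ℕ → ℝ) : EuclideanSpace ℝ (Fin m) :=
  WithLp.toLp 2 fun r => b r / √m

lemma measureMap_arrayVec (m N : ℕ) (B : ℕ → ℕ → ℤ) (z : ℕ → ℝ) :
    measureMap m N B (arrayVec N z) = measuredVec m (measure N B z) := by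
  ext r
  rw [measureMap_apply, sum_arrayVec N (fun i => (B r i : ℝ)) z]
  rfl

lemma measuredVec_congr {m : ℕ} {b b' : ℕ → ℝ} (h : ∀ r < m, b r = b' r) :
    measuredVec m b = measuredVec m b' := by
  ext r
  change b r / √m = b' r / √m
  rw [h r r.2]

lemma normSq_measuredVec (m : ℕ) (b : ℕ → ℝ) :
    ‖measuredVec m b‖ ^ 2 = (∑ r ∈ Finset.range m, b r * b r) / m := by
  rw [EuclideanSpace.norm_sq_eq, Finset.sum_range, Finset.sum_div]
  refine Finset.sum_congr rfl fun r _ => ?_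
  change ‖b r / √m‖ ^ 2 = _
  rw [Real.norm_eq_abs, sq_abs, div_pow, sq_sqrt (Nat.cast_nonneg m), sq]

lemma mem_finPart {N : ℕ} {T : Finset ℕ} {i : Fin N} : i ∈ finPart N T ↔ (i : ℕ) ∈ T := by
  simp [finPart]

lemma sum_finPart {N : ℕ} {T : Finset ℕ} (hT : T ⊆ Finset.Ico 1 N) (f : ℕ → ℝ) :
    ∑ i ∈ finPart N T, f i = ∑ v ∈ T, f v := by
  rw [finPart, Finset.sum_filter, ← Finset.sum_range fun v => if v ∈ T then f v else 0,
    ← Finset.sum_filter]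
  refine Finset.sum_congr ?_ fun _ _ => rfl
  ext v
  simp only [Finset.mem_filter, Finset.mem_range, and_iff_right_iff_imp]
  exact fun hv => (Finset.mem_Ico.mp (hT hv)).2

/-- The weighted masses of the cells, as an array. -/
noncomputable def weightedMass (h : ℕ) (x : Pixel Δ → ℝ) (v : ℕ) : ℝ :=
  (nodeWeight h v : ℝ) * cellMass h x v

lemma pyramid_eq_arrayVec (x : Pixel Δ → ℝ) :
    pyramid h x = arrayVec (2 * 4 ^ h) (weightedMass h x) := rfl

lemma nodeWeight_pos (h v : ℕ) : (0 : ℝ) < nodeWeight h v := by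
  unfold nodeWeight
  positivity

/-- An approximation of the weighted masses on a heap tree gives an approximation of the image in the
Earth-Mover norm. -/
lemma emdNorm_sub_rebuild_le_of_tree (hΔ : Δ ≤ 2 ^ h) (hΔ0 : 0 < Δ) {rep : ℕ → ℕ}
    (hrep : IsRep Δ h rep) {x : Pixel Δ → ℝ} {Y z : ℕ → ℝ} {s : ℕ} {S T : Finset ℕ}
    (hY : ∀ v, 2 * 4 ^ h ≤ v → Y v = 0) (hY0 : ∀ v, rep v = 0 → Y v = 0)
    (hYz : ∀ v ∈ Finset.Ico 1 (2 * 4 ^ h), rep v ≠ 0 → Y v = z v / nodeWeight h v)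
    (hS : S.card ≤ s) (hT : T.card ≤ s) (hz : ∀ v, v ∉ S → z v = 0) :
    emdNorm (x - fun p => rebuild h rep Y (pixelIndex p)) ≤
      4 * (∑ i ∈ Finset.univ \ finPart (2 * 4 ^ h) T, |pyramid h x i| + √(2 * s) *
        ‖arrayVec (2 * 4 ^ h) z - restrictTo (finPart (2 * 4 ^ h) T) (pyramid h x)‖) := by
  refine (emdNorm_sub_rebuild_le hΔ hΔ0 hrep x Y hY hY0).trans ?_
  refine mul_le_mul_of_nonneg_left ?_ (by norm_num)
  refine le_trans ?_ (sum_abs_sub_le (finPart (2 * 4 ^ h) S) (finPart (2 * 4 ^ h) T) s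
    ((card_finPart_le _ _).trans hS) ((card_finPart_le _ _).trans hT)
    (z := arrayVec (2 * 4 ^ h) z) (u := pyramid h x)
    fun i hi => hz i fun hiS => hi (Finset.mem_coe.mpr (mem_finPart.mpr hiS)))
  have e : ∑ i : Fin (2 * 4 ^ h), |pyramid h x i - arrayVec (2 * 4 ^ h) z i|
      = ∑ v ∈ Finset.range (2 * 4 ^ h), |weightedMass h x v - z v| :=
    (Finset.sum_range fun v => |weightedMass h x v - z v|).symm
  rw [e]
  refine le_trans (Finset.sum_le_sum fun v hv => ?_)
    (Finset.sum_le_sum_of_subset_of_nonneg (s := Finset.Ico 1 (2 * 4 ^ h))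
      (fun v hv => Finset.mem_range.mpr (Finset.mem_Ico.mp hv).2) fun _ _ _ => abs_nonneg _)
  by_cases h0 : rep v = 0
  · have hc : cellMass h x v = 0 := by
      rcases hrep v hv with ⟨-, h1⟩ | ⟨p, h1, -⟩
      · exact Finset.sum_eq_zero fun p _ => if_neg (h1 p)
      · omega
    rw [hY0 v h0, hc, sub_zero, abs_zero, mul_zero]
    exact abs_nonneg _
  · rw [hYz v hv h0, weightedMass]
    have hw := nodeWeight_pos h v
    have e2 : (nodeWeight h v : ℝ) * cellMass h x v - z v
        = nodeWeight h v * (cellMass h x v - z v / nodeWeight h v) := by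
      field_simp
    rw [e2, abs_mul, abs_of_pos hw]

/-- One step of the iteration halves the distance to the restriction of `u` to a heap tree, up to the
effective noise `e`. -/
lemma IsThresholdingStep.norm_sub_le {N s m : ℕ} (hm : 1 ≤ m) {B : ℕ → ℕ → ℤ}
    (hB : TreeIsometry m N (3 * s) B)
    {b z z' : ℕ → ℝ} (hstep : IsThresholdingStep N s m (fun r v => (B r v : ℝ)) b z z')
    {T : Finset ℕ} (hT : HeapTree N T) (hTs : T.card ≤ s) {u : EuclideanSpace ℝ (Fin N)}
    {e : EuclideanSpace ℝ (Fin m)} (hu : u ∈ supportedIn (finPart N T : Set (Fin N)))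
    (hb : measuredVec m b = measureMap m N B u + e)
    (hz : ∃ S, HeapTree N S ∧ S.card ≤ s ∧ ∀ v, v ∉ S → z v = 0) :
    (∃ S, HeapTree N S ∧ S.card ≤ s ∧ ∀ v, v ∉ S → z' v = 0) ∧
    ‖arrayVec N z' - u‖ ≤ 1 / 2 * ‖arrayVec N z - u‖ + 3 * ‖e‖ := by
  obtain ⟨a, ha, S, hS, hSs, hopt, hz'⟩ := hstep
  obtain ⟨S₀, hS₀, hS₀s, hz₀⟩ := hz
  refine ⟨⟨S, hS, hSs, fun v hv => by rw [hz' v, if_neg hv]⟩, ?_⟩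
  have hmp : (0 : ℝ) < m := by exact_mod_cast hm
  -- the supports of the old iterate, of the new iterate and of `u` lie in a tree of `3 * s` nodes
  have hR : (S₀ ∪ (S ∪ T)).card ≤ 3 * s := by
    have h1 := Finset.card_union_le S₀ (S ∪ T)
    have h2 := Finset.card_union_le S T
    omega
  have hmono : ∀ {P Q : Finset ℕ}, P ⊆ Q → finPart N P ⊆ finPart N Q := fun hPQ i hi =>
    mem_finPart.mpr (hPQ (mem_finPart.mp hi))
  refine thresholding_step (measureMap m N B) (finPart N (S₀ ∪ (S ∪ T))) (finPart N S)
    (finPart N T) (hB _ (hS₀.union (hS.union hT)) hR) (hmono (by intro v; simp; tauto))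
    (hmono (by intro v; simp; tauto)) (a := arrayVec N a) ?_ hu ?_ ?_ ?_
  · intro i hi
    refine hz₀ i fun h => hi (Finset.mem_coe.mpr (mem_finPart.mpr (Finset.mem_union_left _ h)))
  · intro y
    rw [← hb, measureMap_arrayVec]
    simp only [PiLp.inner_apply, RCLike.inner_apply, conj_trivial]
    have e1 : ∀ i : Fin N, arrayVec N a i * y i = arrayVec N z i * y i +
        (∑ r : Fin m, (B r i : ℝ) * (b r - measure N B z r)) / m * y i := by
      intro i
      rw [arrayVec_apply, ha i i.2, Finset.sum_range, arrayVec_apply]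
      simp only [measure]
      ring
    rw [Finset.sum_congr rfl fun i _ => e1 i, Finset.sum_add_distrib]
    congr 1
    have e2 : ∀ r : Fin m, (measuredVec m b - measuredVec m (measure N B z)) r
        * measureMap m N B y r = ∑ i : Fin N, (B r i : ℝ) * (b r - measure N B z r) / m * y i := by
      intro r
      rw [PiLp.sub_apply, measureMap_apply]
      change (b r / √m - measure N B z r / √m) * _ = _
      have hs := sq_sqrt hmp.le
      have hs0 : √(m : ℝ) ≠ 0 := (sqrt_pos.mpr hmp).ne'
      rw [← sub_div, div_mul_div_comm, ← sq, hs, Finset.mul_sum, Finset.sum_div]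
      exact Finset.sum_congr rfl fun i _ => by ring
    rw [Finset.sum_congr rfl fun r _ => e2 r, Finset.sum_comm]
    refine Finset.sum_congr rfl fun i _ => ?_
    rw [Finset.sum_div, Finset.sum_mul]
  · ext i
    rw [arrayVec_apply, hz', restrictTo_apply]
    simp only [mem_finPart, arrayVec_apply]
  · rw [show ∑ i ∈ finPart N T, arrayVec N a i ^ 2 = ∑ v ∈ T, a v ^ 2 from
      sum_finPart hT.1 fun v => a v ^ 2, show ∑ i ∈ finPart N S, arrayVec N a i ^ 2
        = ∑ v ∈ S, a v ^ 2 from sum_finPart hS.1 fun v => a v ^ 2]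
    exact hopt T hT hTs

/-- The invariant of the iteration. -/
def IsIterate (N s : ℕ) (u : EuclideanSpace ℝ (Fin N)) (η : ℝ) (i : ℕ) (z : ℕ → ℝ) : Prop :=
  (∃ S, HeapTree N S ∧ S.card ≤ s ∧ ∀ v, v ∉ S → z v = 0) ∧
    ‖arrayVec N z - u‖ ≤ ‖u‖ / 2 ^ i + 6 * η

lemma isIterate_zero (N s : ℕ) (u : EuclideanSpace ℝ (Fin N)) {η : ℝ} (hη : 0 ≤ η) :
    IsIterate N s u η 0 0 := by
  refine ⟨⟨∅, ⟨by simp, by simp⟩, by simp, fun _ _ => rfl⟩, ?_⟩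
  have : arrayVec N 0 = 0 := rfl
  rw [this, zero_sub, norm_neg, pow_zero, div_one]
  linarith

lemma IsIterate.step {N s m : ℕ} (hm : 1 ≤ m) {B : ℕ → ℕ → ℤ} (hB : TreeIsometry m N (3 * s) B)
    {b z z' : ℕ → ℝ} {T : Finset ℕ} (hT : HeapTree N T) (hTs : T.card ≤ s)
    {u : EuclideanSpace ℝ (Fin N)} {e : EuclideanSpace ℝ (Fin m)}
    (hu : u ∈ supportedIn (finPart N T : Set (Fin N)))
    (hb : measuredVec m b = measureMap m N B u + e) {i : ℕ} (hz : IsIterate N s u ‖e‖ i z)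
    (hstep : IsThresholdingStep N s m (fun r v => (B r v : ℝ)) b z z') :
    IsIterate N s u ‖e‖ (i + 1) z' := by
  obtain ⟨h1, h2⟩ := hstep.norm_sub_le hm hB hT hTs hu hb hz.1
  refine ⟨h1, h2.trans ?_⟩
  have e1 : ‖u‖ / 2 ^ (i + 1) = 1 / 2 * (‖u‖ / 2 ^ i) := by rw [pow_succ]; field_simp
  rw [e1]
  linarith [hz.2]

/-- The support of a `k`-sparse vector, or any pixel if the vector is zero. -/
lemma exists_centres {k : ℕ} (hk : 1 ≤ k) (hΔ0 : 0 < Δ) {x' : Pixel Δ → ℝ} (hx' : IsSparse k x') :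
    ∃ C : Finset (Pixel Δ), C.Nonempty ∧ C.card ≤ k ∧ ∀ p, p ∉ C → x' p = 0 := by
  classical
  set C₀ : Finset (Pixel Δ) := Finset.univ.filter fun p => x' p ≠ 0 with hC
  have hcard : C₀.card ≤ k := by
    have : {p | x' p ≠ 0} = (C₀ : Set (Pixel Δ)) := by ext p; simp [hC]
    rwa [IsSparse, this, Set.ncard_coe_finset] at hx'
  by_cases hne : C₀.Nonempty
  · exact ⟨C₀, hne, hcard, fun p hp => by simpa [hC] using hp⟩
  · refine ⟨{(⟨0, hΔ0⟩, ⟨0, hΔ0⟩)}, by simp, by simpa using hk, fun p _ => ?_⟩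
    by_contra hp
    exact hne ⟨p, by simp [hC, hp]⟩

/-- Collecting the errors: `M` bounds the error on the tree, `τ` the tail. -/
lemma total_error_le {k ρ s D : ℕ} (hρ : 1 ≤ ρ) (hk : 1 ≤ k) (hD : 1 ≤ D)
    (hs : s = 28 * (k * ρ ^ 2) * D) {τ M δ E : ℝ} (hE : 0 ≤ E) (hτ : τ ≤ 4 / ρ * E)
    (hM : M ≤ δ + 8 * (10 / (ρ * √(k * ρ ^ 2 : ℕ)) * E)) (hδ : √(2 * s) * δ ≤ 2 / ρ * E) :
    4 * (τ + √(2 * s) * M) ≤ 2500 * √D / ρ * E := by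
  have hρ' : (0 : ℝ) < ρ := by exact_mod_cast hρ
  set κ : ℕ := k * ρ ^ 2 with hκ
  have hκ' : (0 : ℝ) < κ := by
    have : 0 < κ := by positivity
    exact_mod_cast this
  have hD1 : 1 ≤ √(D : ℝ) := by
    rw [show (1 : ℝ) = √1 by simp]
    exact sqrt_le_sqrt (by exact_mod_cast hD)
  have e1 : √(2 * s : ℝ) = √56 * (√κ * √D) := by
    rw [hs]
    push_cast
    rw [← sqrt_mul (by positivity), ← sqrt_mul (by norm_num)]
    congr 1
    ring
  have e2 : √(56 : ℝ) ≤ 15 / 2 := by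
    rw [sqrt_le_left (by norm_num)]
    norm_num
  have hE' : 0 ≤ E / ρ := by positivity
  have e3 : √(2 * s : ℝ) * (8 * (10 / (ρ * √(κ : ℝ)) * E)) = √56 * (80 * (√D * (E / ρ))) := by
    rw [e1]
    have : √(κ : ℝ) ≠ 0 := (sqrt_pos.mpr hκ').ne'
    field_simp
    ring
  have e4 : √56 * (80 * (√D * (E / ρ))) ≤ 15 / 2 * (80 * (√D * (E / ρ))) :=
    mul_le_mul_of_nonneg_right e2 (by positivity)
  have e5 : √(2 * s : ℝ) * M ≤ 2 / ρ * E + 15 / 2 * (80 * (√D * (E / ρ))) := by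
    refine (mul_le_mul_of_nonneg_left hM (sqrt_nonneg _)).trans ?_
    rw [mul_add, e3]
    linarith
  have e6 : E / ρ ≤ √D * (E / ρ) := le_mul_of_one_le_left hE' hD1
  have e7 : 2500 * √D / ρ * E = 2500 * (√D * (E / ρ)) := by ring
  have e8 : 4 / ρ * E = 4 * (E / ρ) := by ring
  have e9 : 2 / ρ * E = 2 * (E / ρ) := by ring
  rw [e7]
  rw [e8] at hτ
  rw [e9] at e5
  linarith

/-- Some choice of a pixel in each non-empty cell. -/
lemma exists_isRep (hΔ : Δ ≤ 2 ^ h) :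
    ∃ rep, IsRep Δ h rep ∧ ∀ v, 2 * 4 ^ h ≤ v → rep v = 0 := by
  classical
  refine ⟨fun v => if H : ∃ p : Pixel Δ, InCell h v p then pixelIndex H.choose + 1 else 0,
    fun v _ => ?_, fun v hv => ?_⟩
  · by_cases H : ∃ p : Pixel Δ, InCell h v p
    · exact Or.inr ⟨H.choose, by simp only [dif_pos H], H.choose_spec⟩
    · exact Or.inl ⟨by simp only [dif_neg H], fun p hp => H ⟨p, hp⟩⟩
  · refine dif_neg ?_
    rintro ⟨p, hp⟩
    have := Finset.mem_Ico.mp (hp.mem_Ico hΔ)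
    omega

lemma levelCount_pos (N κ : ℕ) : 1 ≤ levelCount N κ := by unfold levelCount; omega

/-- Recovery by least squares over all heap trees of at most `s` nodes. -/
lemma exists_leastSquares_recovery (hΔ : Δ ≤ 2 ^ h) (hΔ0 : 0 < Δ) {k ρ m s : ℕ} (hρ : 1 ≤ ρ)
    (hk : 1 ≤ k) (hs : s = 28 * (k * ρ ^ 2) * levelCount (2 * 4 ^ h) (k * ρ ^ 2))
    {B : ℕ → ℕ → ℤ} (hB : TreeIsometry m (2 * 4 ^ h) (3 * s) B) :
    ∃ R : (ℕ → ℝ) → (Pixel Δ → ℝ), ∀ x : Pixel Δ → ℝ, (∀ p, 0 ≤ x p) → ∀ b : ℕ → ℝ,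
      (∀ r < m, b r = measure (2 * 4 ^ h) B (weightedMass h x) r) →
      IsEMDApprox (2500 * √(levelCount (2 * 4 ^ h) (k * ρ ^ 2)) / ρ) k x (R b) := by
  classical
  set N := 2 * 4 ^ h with hN
  obtain ⟨rep, hrep, hrepN⟩ := exists_isRep hΔ
  -- the supports are finite in number, hence the residual attains its minimum over all of them
  set trees : Finset (Finset (Fin N)) := ((Finset.Ico 1 N).powerset.filter fun T =>
    HeapTree N T ∧ T.card ≤ s).image (finPart N) with htrees
  have hmem : ∀ T, HeapTree N T → T.card ≤ s → finPart N T ∈ trees := fun T hT hTs =>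
    Finset.mem_image_of_mem _ (Finset.mem_filter.mpr ⟨Finset.mem_powerset.mpr hT.1, hT, hTs⟩)
  have hne : trees.Nonempty := ⟨_, hmem ∅ ⟨by simp, by simp⟩ (by simp)⟩
  have hbest : ∀ b : EuclideanSpace ℝ (Fin m), ∃ z : ℕ → ℝ, ∃ S, HeapTree N S ∧ S.card ≤ s ∧
      (∀ v, v ∉ S → z v = 0) ∧ ∀ T, HeapTree N T → T.card ≤ s →
        ∀ u ∈ supportedIn (finPart N T : Set (Fin N)),
          ‖b - measureMap m N B (arrayVec N z)‖ ≤ ‖b - measureMap m N B u‖ := by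
    intro b
    obtain ⟨S', hS', z, hz, hmin⟩ := exists_best_sparse (measureMap m N B) trees hne b
    obtain ⟨S, hS, rfl⟩ := Finset.mem_image.mp hS'
    obtain ⟨-, hS1, hS2⟩ := Finset.mem_filter.mp hS
    have hzv : arrayVec N (fun v => if hv : v < N then z ⟨v, hv⟩ else 0) = z := by
      ext i
      rw [arrayVec_apply, dif_pos i.2]
    refine ⟨fun v => if hv : v < N then z ⟨v, hv⟩ else 0, S, hS1, hS2, fun v hv => ?_,
      fun T hT hTs u hu => ?_⟩
    · dsimp only
      split_ifs with hvN
      · exact hz _ fun h => hv (mem_finPart.mp (Finset.mem_coe.mp h))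
      · rfl
    · rw [hzv]
      exact hmin _ (hmem T hT hTs) u hu
  choose Z S hS hSs hZ hmin using hbest
  refine ⟨fun b p => rebuild h rep
    (fun v => if rep v = 0 then 0 else Z (measuredVec m b) v / nodeWeight h v) (pixelIndex p),
    fun x hx b hb x' hx' => ?_⟩
  obtain ⟨C, hC, hCk, hCx⟩ := exists_centres hk hΔ0 hx'
  obtain ⟨T, hT, hTs, t1, t2, -⟩ := exists_tree_approximation hΔ hρ hk hs hB hC hCk hx
  have hE := sum_mul_centreDist_le_emdNorm hC x x' hCx
  have hE0 : 0 ≤ ∑ p, x p * centreDist C hC p :=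
    Finset.sum_nonneg fun p _ => mul_nonneg (hx p) (centreDist_nonneg C hC p)
  set E := ∑ p, x p * centreDist C hC p with hEdef
  set u := restrictTo (finPart N T) (pyramid h x) with hu
  set e := measureMap m N B (restrictTo (Finset.univ \ finPart N T) (pyramid h x)) with he
  have hbu : measuredVec m b = measureMap m N B u + e := by
    rw [he, ← map_add, restrictTo_add_sdiff, pyramid_eq_arrayVec, measureMap_arrayVec]
    exact measuredVec_congr hb
  -- the difference is supported in the union of two trees, on which the measurement is almost isometric
  have hclose : ‖arrayVec N (Z (measuredVec m b)) - u‖ ≤ 3 * ‖e‖ := by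
    refine norm_sub_le_of_residual_le (measureMap m N B)
      (hB (S (measuredVec m b) ∪ T) ((hS _).union hT) ?_ _ ?_) hbu ?_
    · have h1 := Finset.card_union_le (S (measuredVec m b)) T
      have h2 := hSs (measuredVec m b)
      omega
    · refine Submodule.sub_mem _ (fun i hi => hZ _ i fun h => hi ?_)
        (supportedIn_mono (fun i hi => ?_) (restrictTo_mem (finPart N T) _))
      · exact Finset.mem_coe.mpr (mem_finPart.mpr (Finset.mem_union_left _ h))
      · exact Finset.mem_coe.mpr (mem_finPart.mpr (Finset.mem_union_right _
          (mem_finPart.mp (Finset.mem_coe.mp hi))))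
    · refine (hmin (measuredVec m b) T hT hTs u (restrictTo_mem _ _)).trans (le_of_eq ?_)
      rw [hbu, add_sub_cancel_left]
  refine (emdNorm_sub_rebuild_le_of_tree hΔ hΔ0 hrep (z := Z (measuredVec m b)) (s := s)
    (S := S (measuredVec m b)) (T := T)
    (fun v hv => if_pos (hrepN v hv)) (fun v hv => if_pos hv) (fun v _ hv => if_neg hv)
    (hSs _) hTs (hZ _)).trans ?_
  refine (total_error_le hρ hk (levelCount_pos _ _) hs (δ := 0) hE0 t1 (hclose.trans ?_)
    ?_).trans (mul_le_mul_of_nonneg_left hE (by positivity))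
  · have := norm_nonneg e
    rw [zero_add]
    linarith
  · rw [mul_zero]
    positivity

/-- The distances of pixels are natural numbers; hence so is the transport cost of an image with natural
numbers as entries, and it cannot be small without being zero. -/
lemma exists_nat_eq_centreDist {C : Finset (Pixel Δ)} (hC : C.Nonempty) (p : Pixel Δ) :
    ∃ n : ℕ, centreDist C hC p = n := by
  obtain ⟨c, -, hc⟩ := Finset.exists_mem_eq_inf' hC (pixelDist p)
  refine ⟨((|((p.1 : ℕ) : ℤ) - ((c.1 : ℕ) : ℤ)| + |((p.2 : ℕ) : ℤ) - ((c.2 : ℕ) : ℤ)|)).toNat, ?_⟩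
  rw [centreDist, hc, pixelDist]
  have : (0 : ℤ) ≤ |((p.1 : ℕ) : ℤ) - ((c.1 : ℕ) : ℤ)| + |((p.2 : ℕ) : ℤ) - ((c.2 : ℕ) : ℤ)| := by
    positivity
  have e := Int.toNat_of_nonneg this
  have e' : (((|((p.1 : ℕ) : ℤ) - ((c.1 : ℕ) : ℤ)|
      + |((p.2 : ℕ) : ℤ) - ((c.2 : ℕ) : ℤ)|).toNat : ℤ) : ℝ)
      = ((|((p.1 : ℕ) : ℤ) - ((c.1 : ℕ) : ℤ)| + |((p.2 : ℕ) : ℤ) - ((c.2 : ℕ) : ℤ)| : ℤ) : ℝ) := by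
    rw [e]
  rw [Int.cast_natCast] at e'
  rw [e']
  push_cast
  rfl

/-- The property of the iterates that the thresholding steps preserve. -/
def IsIterateFor (N s m : ℕ) (B : ℕ → ℕ → ℤ) (b : ℕ → ℝ) (i : ℕ) (z : ℕ → ℝ) : Prop :=
  ∀ (T : Finset ℕ) (u : EuclideanSpace ℝ (Fin N)) (e : EuclideanSpace ℝ (Fin m)),
    HeapTree N T → T.card ≤ s → u ∈ supportedIn (finPart N T : Set (Fin N)) →
    measuredVec m b = measureMap m N B u + e → IsIterate N s u ‖e‖ i z

/-- The accuracy that the iteration reaches: `β` exceeds the norm of the measured vector, so that after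
`J` steps with `2 ^ J ≥ β * N ^ 2` the initial error has become negligible. -/
lemma IsIterate.norm_sub_le_final {N s m J : ℕ} (hN : 2 ≤ N) {B : ℕ → ℕ → ℤ} {b z : ℕ → ℝ}
    {u : EuclideanSpace ℝ (Fin N)} {e : EuclideanSpace ℝ (Fin m)}
    (hL : |‖measureMap m N B u‖ ^ 2 - ‖u‖ ^ 2| ≤ 1 / 4 * ‖u‖ ^ 2)
    (hb : measuredVec m b = measureMap m N B u + e) (hz : IsIterate N s u ‖e‖ J z)
    (hJ : J = Nat.clog 2 ⌈(1 + (∑ r ∈ Finset.range m, b r * b r) / m) * (N * N)⌉₊) :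
    ‖arrayVec N z - u‖ ≤ 6 / 5 / N ^ 2 + 8 * ‖e‖ ∧ (‖e‖ = 0 → ‖u‖ < 2 ^ J) := by
  set β : ℝ := 1 + (∑ r ∈ Finset.range m, b r * b r) / m with hβ
  have hN' : (2 : ℝ) ≤ N := by exact_mod_cast hN
  have hsq := normSq_measuredVec m b
  have hβ1 : 1 ≤ β := by
    rw [hβ, ← hsq]
    linarith [sq_nonneg ‖measuredVec m b‖]
  have hbβ : ‖measuredVec m b‖ ≤ β := by
    rw [hβ, ← hsq]
    nlinarith [sq_nonneg (‖measuredVec m b‖ - 1)]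
  have h2J : β * N ^ 2 ≤ 2 ^ J := by
    have h1 := Nat.le_pow_clog (b := 2) (by norm_num) ⌈β * (N * N)⌉₊
    rw [← hJ] at h1
    have h2 : ((⌈β * (N * N)⌉₊ : ℕ) : ℝ) ≤ ((2 ^ J : ℕ) : ℝ) := Nat.cast_le.mpr h1
    push_cast at h2
    rw [sq]
    exact (Nat.le_ceil _).trans h2
  have hu : ‖u‖ ≤ 6 / 5 * (β + ‖e‖) := by
    refine (norm_le_norm_map_of_almost_isometry hL).trans ?_
    have : measureMap m N B u = measuredVec m b - e := by rw [hb, add_sub_cancel_right]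
    rw [this]
    linarith [norm_sub_le (measuredVec m b) e]
  have he := norm_nonneg e
  have hNsq : (4 : ℝ) ≤ (N : ℝ) ^ 2 := by nlinarith
  refine ⟨hz.2.trans ?_, fun h0 => ?_⟩
  · have h3 : ‖u‖ / 2 ^ J ≤ 6 / 5 * (β + ‖e‖) / (β * N ^ 2) :=
      div_le_div₀ (by positivity) hu (by positivity) h2J
    have h4 : 6 / 5 * (β + ‖e‖) / (β * N ^ 2) = 6 / 5 / N ^ 2 + 6 / 5 * ‖e‖ / (β * N ^ 2) := by
      field_simp
    have h5 : 6 / 5 * ‖e‖ / (β * N ^ 2) ≤ 2 * ‖e‖ := by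
      rw [div_le_iff₀ (by positivity)]
      have : 1 ≤ β * (N : ℝ) ^ 2 := by nlinarith
      nlinarith
    linarith
  · rw [h0, add_zero] at hu
    refine lt_of_le_of_lt hu (lt_of_lt_of_le ?_ h2J)
    nlinarith

lemma exists_nat_eq_cellMass (x : Pixel Δ → ℕ) (v : ℕ) :
    ∃ t : ℕ, cellMass h (fun p => (x p : ℝ)) v = t := by
  refine ⟨∑ p, if InCell h v p then x p else 0, ?_⟩
  unfold cellMass
  push_cast
  rfl

/-- The output of the recovery program approximates an image with natural numbers as entries. Either
nothing is left outside of the tree, then rounding recovers the image exactly; or the error of the best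
approximation is at least `1`, and the accuracy of the iteration suffices. -/
lemma IsRecovered.isEMDApprox (hΔ : Δ ≤ 2 ^ h) (hΔ0 : 0 < Δ) {k ρ m s J : ℕ}
    (hρ : 1 ≤ ρ) (hk : 1 ≤ k)
    (hs : s = 28 * (k * ρ ^ 2) * levelCount (2 * 4 ^ h) (k * ρ ^ 2))
    {B : ℕ → ℕ → ℤ} (hB : TreeIsometry m (2 * 4 ^ h) (3 * s) B) {x : Pixel Δ → ℕ} {b : ℕ → ℝ}
    (hb : ∀ r < m, b r = measure (2 * 4 ^ h) B (weightedMass h fun p => (x p : ℝ)) r)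
    (hJ : J = Nat.clog 2 ⌈(1 + (∑ r ∈ Finset.range m, b r * b r) / m)
      * (((2 * 4 ^ h : ℕ) : ℝ) * ((2 * 4 ^ h : ℕ) : ℝ))⌉₊)
    {z y Y out : ℕ → ℝ} {rep : ℕ → ℕ} (hP : IsIterateFor (2 * 4 ^ h) s m B b J z)
    (H : IsRecovered Δ h J m (fun r v => (B r v : ℝ)) b z y Y out rep) :
    IsEMDApprox (2500 * √(levelCount (2 * 4 ^ h) (k * ρ ^ 2)) / ρ) k (fun p => (x p : ℝ))
      (fun p => out (pixelIndex p)) := by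
  intro x' hx'
  have hN2 : 2 ≤ 2 * 4 ^ h := by
    have : 0 < 4 ^ h := by positivity
    omega
  obtain ⟨C, hC, hCk, hCx⟩ := exists_centres hk hΔ0 hx'
  obtain ⟨T, hT, hTs, t1, t2, t3⟩ := exists_tree_approximation hΔ hρ hk hs hB hC hCk
    (x := fun p => (x p : ℝ)) fun p => Nat.cast_nonneg _
  have hE := sum_mul_centreDist_le_emdNorm hC (fun p => (x p : ℝ)) x' hCx
  have hE0 : 0 ≤ ∑ p, (x p : ℝ) * centreDist C hC p :=
    Finset.sum_nonneg fun p _ => mul_nonneg (Nat.cast_nonneg _) (centreDist_nonneg C hC p)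
  have hEnat : ∃ n : ℕ, ∑ p, (x p : ℝ) * centreDist C hC p = n := by
    choose f hf using exists_nat_eq_centreDist hC
    refine ⟨∑ p, x p * f p, ?_⟩
    push_cast
    exact Finset.sum_congr rfl fun p _ => by rw [hf]
  set E := ∑ p, (x p : ℝ) * centreDist C hC p with hEdef
  have hρ' : (0 : ℝ) < ρ := by exact_mod_cast hρ
  refine le_trans ?_ (mul_le_mul_of_nonneg_left hE (by positivity))
  have hout : (fun p : Pixel Δ => out (pixelIndex p)) = fun p => rebuild h rep Y (pixelIndex p) :=
    funext fun p => H.out_eq _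
  rw [hout]
  set pyr := pyramid h fun p => (x p : ℝ) with hpyr
  set u := restrictTo (finPart (2 * 4 ^ h) T) pyr with hu
  set e := measureMap m (2 * 4 ^ h) B (restrictTo (Finset.univ \ finPart (2 * 4 ^ h) T) pyr) with he
  have hbu : measuredVec m b = measureMap m (2 * 4 ^ h) B u + e := by
    rw [he, ← map_add, restrictTo_add_sdiff, hpyr, pyramid_eq_arrayVec, measureMap_arrayVec]
    exact measuredVec_congr hb
  have huT : u ∈ supportedIn (finPart (2 * 4 ^ h) T : Set (Fin (2 * 4 ^ h))) := restrictTo_mem _ _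
  have hz := hP T u e hT hTs huT hbu
  obtain ⟨hacc, hsmall⟩ := hz.norm_sub_le_final hN2 (hB T hT (by omega) u huT) hbu hJ
  obtain ⟨S, hS, hSs, hzS⟩ := hz.1
  -- a mass that the iterate estimates by `0` is rounded to `0`
  have hzero : ∀ v, v ∉ S → v < 2 * 4 ^ h → y v = 0 := by
    intro v hv hvN
    rcases Nat.eq_zero_or_pos v with rfl | hv0
    · exact H.y_zero
    · have := H.y_eq v (Finset.mem_Ico.mpr ⟨hv0, hvN⟩) 0 (by positivity)
        (by rw [hzS v hv]; norm_num)
      simpa using this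
  -- if nothing is left outside of the tree, the masses are rounded correctly and pass the check
  by_cases htail : restrictTo (Finset.univ \ finPart (2 * 4 ^ h) T) pyr = 0
  · have he0 : ‖e‖ = 0 := by rw [he, htail, map_zero, norm_zero]
    have hupyr : u = pyr := by
      have := restrictTo_add_sdiff (finPart (2 * 4 ^ h) T) pyr
      rwa [htail, add_zero] at this
    have hy : ∀ v ∈ Finset.Ico 1 (2 * 4 ^ h), y v = cellMass h (fun p => (x p : ℝ)) v := by
      intro v hv
      obtain ⟨t, ht⟩ := exists_nat_eq_cellMass (h := h) x v
      have hvN := (Finset.mem_Ico.mp hv).2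
      have hw := nodeWeight_pos h v
      have hw1 : (1 : ℝ) ≤ nodeWeight h v := by
        have : 0 < nodeWeight h v := by exact_mod_cast hw
        exact_mod_cast this
      have hpv : pyr ⟨v, hvN⟩ = nodeWeight h v * t := by
        rw [← ht]; rfl
      rw [ht]
      refine H.y_eq v hv t ?_ ?_
      · have h1 : ‖pyr ⟨v, hvN⟩‖ ≤ ‖pyr‖ := PiLp.norm_apply_le pyr _
        rw [← hupyr] at h1
        have h2 := h1.trans_lt (hsmall he0)
        rw [hupyr, hpv, Real.norm_eq_abs, abs_of_nonneg (by positivity)] at h2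
        have h3 : (t : ℝ) ≤ nodeWeight h v * t := le_mul_of_one_le_left (Nat.cast_nonneg _) hw1
        have : (t : ℝ) < ((2 ^ J : ℕ) : ℝ) := by push_cast; linarith
        exact_mod_cast this
      · have h1 := PiLp.norm_apply_le (arrayVec (2 * 4 ^ h) z - u) ⟨v, hvN⟩
        rw [PiLp.sub_apply, arrayVec_apply, hupyr, hpv, Real.norm_eq_abs] at h1
        rw [hupyr, he0] at hacc
        have h2 : (6 / 5 : ℝ) / ((2 * 4 ^ h : ℕ) : ℝ) ^ 2 ≤ 3 / 10 := by
          rw [div_le_iff₀ (by positivity)]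
          have : (2 : ℝ) ≤ ((2 * 4 ^ h : ℕ) : ℝ) := by exact_mod_cast hN2
          nlinarith
        have h3 : z v / nodeWeight h v - t = (z v - nodeWeight h v * t) / nodeWeight h v := by
          field_simp
        rw [h3, abs_div, abs_of_pos hw, div_lt_iff₀ hw]
        linarith
    have hcheck : ∀ r < m, ∑ v ∈ Finset.range (2 * 4 ^ h), (B r v : ℝ) * (nodeWeight h v * y v)
        = b r := by
      intro r hr
      rw [hb r hr, measure]
      refine Finset.sum_congr rfl fun v hv => ?_
      rcases Nat.eq_zero_or_pos v with rfl | hv0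
      · rw [weightedMass, H.y_zero, cellMass_eq_zero_of_notMem hΔ _ (by simp)]
      · rw [weightedMass, hy v (Finset.mem_Ico.mpr ⟨hv0, Finset.mem_range.mp hv⟩)]
    refine (emdNorm_sub_rebuild_le hΔ hΔ0 H.isRep _ Y H.Y_eq_zero H.Y_dead).trans ?_
    rw [Finset.sum_eq_zero, mul_zero]
    · positivity
    · intro v hv
      have : Y v = cellMass h (fun p => (x p : ℝ)) v := by
        by_cases h0 : rep v = 0
        · rw [H.Y_dead v h0]
          rcases H.isRep v hv with ⟨-, h1⟩ | ⟨p, h1, -⟩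
          · exact (Finset.sum_eq_zero fun p _ => if_neg (h1 p)).symm
          · omega
        · rw [H.Y_checked hcheck v hv h0, hy v hv]
      rw [this, sub_self, abs_zero, mul_zero]
  · have hsN : s < 2 * 4 ^ h := by
      by_contra hc
      exact htail (t3 (by omega))
    have hE1 : 1 ≤ E := by
      obtain ⟨n, hn⟩ := hEnat
      rw [hn]
      have : n ≠ 0 := by
        rintro rfl
        refine htail ?_
        rw [hn, Nat.cast_zero, mul_zero] at t1
        have h0 := (Finset.sum_eq_zero_iff_of_nonneg fun i _ => abs_nonneg _).mp
          (le_antisymm t1 (Finset.sum_nonneg fun i _ => abs_nonneg _))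
        ext i
        rw [restrictTo_apply]
        split_ifs with hi
        · simpa using h0 i hi
        · rfl
      exact_mod_cast Nat.one_le_iff_ne_zero.mpr this
    -- either way, the output masses come from weighted masses `z₂` on a tree that are close to `u`:
    -- the rounded ones, since they explain the measurement, or those of the iterate
    obtain ⟨z₂, hz₂S, hz₂Y, hz₂⟩ : ∃ z₂ : ℕ → ℝ, (∀ v, v ∉ S → z₂ v = 0) ∧
        (∀ v ∈ Finset.Ico 1 (2 * 4 ^ h), rep v ≠ 0 → Y v = z₂ v / nodeWeight h v) ∧
        ‖arrayVec (2 * 4 ^ h) z₂ - u‖ ≤ 6 / 5 / ((2 * 4 ^ h : ℕ) : ℝ) ^ 2 + 8 * ‖e‖ := by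
      by_cases hcheck : ∀ r < m,
        ∑ v ∈ Finset.range (2 * 4 ^ h), (B r v : ℝ) * (nodeWeight h v * y v) = b r
      · have hz₂ : ∀ v < 2 * 4 ^ h, (if v ∈ S then (nodeWeight h v : ℝ) * y v else 0)
            = nodeWeight h v * y v := by
          intro v hv
          split_ifs with hvS
          · rfl
          · rw [hzero v hvS hv, mul_zero]
        refine ⟨fun v => if v ∈ S then (nodeWeight h v : ℝ) * y v else 0, fun v hv => if_neg hv,
          fun v hv h0 => ?_, ?_⟩
        · dsimp only
          rw [hz₂ v (Finset.mem_Ico.mp hv).2, H.Y_checked hcheck v hv h0,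
            mul_div_cancel_left₀ _ (nodeWeight_pos h v).ne']
        · have h1 : ‖arrayVec (2 * 4 ^ h) (fun v => if v ∈ S then (nodeWeight h v : ℝ) * y v else 0)
              - u‖ ≤ 3 * ‖e‖ := by
            refine norm_sub_le_of_residual_le (measureMap m (2 * 4 ^ h) B)
              (hB (S ∪ T) (hS.union hT) ?_ _ ?_) hbu ?_
            · have := Finset.card_union_le S T
              omega
            · refine Submodule.sub_mem _ (fun i hi => if_neg fun h => hi ?_)
                (supportedIn_mono (fun i hi => ?_) huT)
              · exact Finset.mem_coe.mpr (mem_finPart.mpr (Finset.mem_union_left _ h))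
              · exact Finset.mem_coe.mpr (mem_finPart.mpr (Finset.mem_union_right _
                  (mem_finPart.mp (Finset.mem_coe.mp hi))))
            · have h0 : measuredVec m (measure (2 * 4 ^ h) B
                  fun v => if v ∈ S then (nodeWeight h v : ℝ) * y v else 0) = measuredVec m b :=
                measuredVec_congr fun r hr => by
                  rw [← hcheck r hr, measure]
                  exact Finset.sum_congr rfl fun v hv => by
                    rw [hz₂ v (Finset.mem_range.mp hv)]
              rw [measureMap_arrayVec, h0, sub_self, norm_zero]
              exact norm_nonneg _
          have h2 : (0 : ℝ) ≤ 6 / 5 / ((2 * 4 ^ h : ℕ) : ℝ) ^ 2 := by positivity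
          linarith [norm_nonneg e]
      · exact ⟨z, hzS, H.Y_unchecked hcheck, hacc⟩
    refine (emdNorm_sub_rebuild_le_of_tree hΔ hΔ0 H.isRep H.Y_eq_zero H.Y_dead hz₂Y hSs hTs
      hz₂S).trans ?_
    refine total_error_le hρ hk (levelCount_pos _ _) hs hE0 t1
      (δ := 6 / 5 / ((2 * 4 ^ h : ℕ) : ℝ) ^ 2) (hz₂.trans (by linarith)) ?_
    -- here `ρ ≤ s < N`, so that the accuracy `1 / N ^ 2` is enough
    have hsρ : ρ ≤ s := by
      have h1 : 1 ≤ k * ρ * levelCount (2 * 4 ^ h) (k * ρ ^ 2) :=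
        Nat.mul_pos (Nat.mul_pos hk hρ) (levelCount_pos _ _)
      calc ρ = ρ * 1 := (mul_one ρ).symm
        _ ≤ ρ * (28 * (k * ρ * levelCount (2 * 4 ^ h) (k * ρ ^ 2))) :=
          Nat.mul_le_mul le_rfl (by omega)
        _ = s := by conv_rhs => rw [hs]
                    ring
    have hs1 : (1 : ℝ) ≤ s := by exact_mod_cast hρ.trans hsρ
    have hsρ' : (ρ : ℝ) ≤ s := by exact_mod_cast hsρ
    have hsN' : (s : ℝ) ≤ ((2 * 4 ^ h : ℕ) : ℝ) := by exact_mod_cast hsN.le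
    have hsqrt : √(2 * s : ℝ) ≤ 3 / 2 * s := by
      rw [sqrt_le_left (by positivity)]
      nlinarith
    have hNpos : (0 : ℝ) < ((2 * 4 ^ h : ℕ) : ℝ) := by linarith
    calc √(2 * s : ℝ) * (6 / 5 / ((2 * 4 ^ h : ℕ) : ℝ) ^ 2)
        ≤ 3 / 2 * s * (6 / 5 / ((2 * 4 ^ h : ℕ) : ℝ) ^ 2) :=
          mul_le_mul_of_nonneg_right hsqrt (by positivity)
      _ ≤ 2 / ρ := by
          rw [mul_div_assoc', div_le_div_iff₀ (by positivity) hρ']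
          nlinarith [mul_le_mul hsN' (hsρ'.trans hsN') hρ'.le hNpos.le]
      _ ≤ 2 / ρ * E := le_mul_of_one_le_right (by positivity) hE1

end

/-! ### The sketching matrix and its parameters -/

section

open Real
variable {Δ h : ℕ}

/-- The integer matrix of the sketch. Its first `m₀` rows apply `B` to the weighted masses of the
cells. The remaining rows make `B` itself known to the program: row `m₀ + 8 * r + i` lists entries of
row `r` of `B`, so that in the input array entry `v` of row `r` is found `v` cells behind the start of
row `m₀ + 8 * r`. -/
def measurementMatrix (Δ h m₀ : ℕ) (B : ℕ → ℕ → ℤ) (m : ℕ) : Matrix (Fin m) (Pixel Δ) ℤ :=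
  fun r p =>
    if (r : ℕ) < m₀ then
      ∑ v ∈ Finset.range (2 * 4 ^ h), if InCell h v p then (nodeWeight h v : ℤ) * B r v else 0
    else B (((r : ℕ) - m₀) / 8) (((r : ℕ) - m₀) % 8 * (Δ * Δ) + pixelIndex p)

lemma abs_measurementMatrix_le {B : ℕ → ℕ → ℤ} (hB : ∀ r v, |B r v| ≤ 1) (m₀ m : ℕ) (r : Fin m)
    (p : Pixel Δ) : |measurementMatrix Δ h m₀ B m r p| ≤ 2 * 4 ^ h * 2 ^ h := by
  unfold measurementMatrix
  split_ifs with hr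
  · refine (Finset.abs_sum_le_sum_abs _ _).trans ?_
    refine (Finset.sum_le_card_nsmul _ _ ((2 : ℤ) ^ h) fun v _ => ?_).trans ?_
    · have hw : (nodeWeight h v : ℤ) ≤ 2 ^ h := by
        have : nodeWeight h v ≤ 2 ^ h :=
          Nat.pow_le_pow_right (by norm_num) (by unfold nodeHeight; omega)
        exact_mod_cast this
      split_ifs
      · rw [abs_mul, abs_of_nonneg (Int.natCast_nonneg _)]
        calc (nodeWeight h v : ℤ) * |B r v| ≤ nodeWeight h v * 1 :=
              mul_le_mul_of_nonneg_left (hB _ _) (Int.natCast_nonneg _)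
          _ ≤ 2 ^ h := by rwa [mul_one]
      · rw [abs_zero]
        positivity
    · rw [Finset.card_range, nsmul_eq_mul]
      push_cast
      exact le_rfl
  · refine (hB _ _).trans ?_
    have h1 : (1 : ℤ) ≤ 4 ^ h := one_le_pow₀ (by norm_num)
    have h2 : (1 : ℤ) ≤ 2 ^ h := one_le_pow₀ (by norm_num)
    nlinarith

lemma sketch_measurementMatrix (m₀ m : ℕ) (B : ℕ → ℕ → ℤ) (x : Pixel Δ → ℝ) {r : ℕ} (hr : r < m₀)
    (hrm : r < m) :
    toArray (sketch (measurementMatrix Δ h m₀ B m) x) r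
      = measure (2 * 4 ^ h) B (weightedMass h x) r := by
  rw [toArray, dif_pos hrm, sketch, Matrix.mulVec, dotProduct, measure]
  simp only [Matrix.map_apply, measurementMatrix, if_pos hr, weightedMass, cellMass]
  push_cast
  simp only [Finset.sum_mul, Finset.mul_sum]
  rw [Finset.sum_comm]
  refine Finset.sum_congr rfl fun v _ => Finset.sum_congr rfl fun p _ => ?_
  split_ifs
  · ring
  · simp

lemma inputStore_measurementMatrix (m₀ : ℕ) (B : ℕ → ℕ → ℤ) {k : ℕ} {ε : ℝ} {m : ℕ}
    (hm : m = 9 * m₀) (b : Fin m → ℝ) (hN : 2 * 4 ^ h ≤ 8 * (Δ * Δ)) {r : ℕ} (hr : r < m₀) {v : ℕ}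
    (hv : v < 2 * 4 ^ h) :
    (inputStore k ε (measurementMatrix Δ h m₀ B m) b).val 1 ((m₀ + 8 * r) * (Δ * Δ) + v)
      = B r v := by
  have hΔ : 0 < Δ * Δ := by omega
  have hΔ' : 0 < Δ := Nat.pos_of_mul_pos_left hΔ
  -- the entry is the `q`-th one of row `m₀ + 8 * r + i`
  set i := v / (Δ * Δ) with hi
  set q := v % (Δ * Δ) with hq
  have hi8 : i < 8 := by rw [hi, Nat.div_lt_iff_lt_mul hΔ]; omega
  have hqlt : q < Δ * Δ := Nat.mod_lt _ hΔ
  have hvq : v = Δ * Δ * i + q := (Nat.div_add_mod v (Δ * Δ)).symm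
  clear_value i q
  clear hi hq
  have hcell : (m₀ + 8 * r) * (Δ * Δ) + v = q + Δ * Δ * (m₀ + 8 * r + i) := by
    rw [hvq]; ring
  have hrow : m₀ + 8 * r + i < m := by omega
  have hlt : (m₀ + 8 * r) * (Δ * Δ) + v < m * (Δ * Δ) := by
    rw [hcell]
    calc q + Δ * Δ * (m₀ + 8 * r + i) < Δ * Δ + Δ * Δ * (m₀ + 8 * r + i) := by omega
      _ = (m₀ + 8 * r + i + 1) * (Δ * Δ) := by ring
      _ ≤ _ := Nat.mul_le_mul_right _ hrow
  have hq1 : q / Δ < Δ := by rwa [Nat.div_lt_iff_lt_mul hΔ']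
  have hsymm : finProdFinEquiv.symm (⟨(m₀ + 8 * r) * (Δ * Δ) + v, hlt⟩ : Fin (m * (Δ * Δ)))
      = (⟨m₀ + 8 * r + i, hrow⟩, ⟨q, hqlt⟩) := by
    rw [Equiv.symm_apply_eq]
    ext
    simp only [finProdFinEquiv_apply_val]
    exact hcell
  have hsymm' : finProdFinEquiv.symm (⟨q, hqlt⟩ : Fin (Δ * Δ))
      = (⟨q / Δ, hq1⟩, ⟨q % Δ, Nat.mod_lt _ hΔ'⟩) := by
    rw [Equiv.symm_apply_eq]
    ext
    simp only [finProdFinEquiv_apply_val]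
    exact (Nat.mod_add_div q Δ).symm
  simp only [inputStore, one_ne_zero, if_false, if_true]
  rw [toArray, dif_pos hlt, hsymm]
  dsimp only
  rw [hsymm', measurementMatrix]
  dsimp only
  rw [if_neg (by omega), show m₀ + 8 * r + i - m₀ = 8 * r + i by omega, Nat.mul_add_div (by norm_num),
    Nat.div_eq_of_lt hi8, Nat.mul_add_mod, Nat.mod_eq_of_lt hi8, add_zero, pixelIndex]
  dsimp only
  rw [Nat.div_add_mod' q Δ, mul_comm i, ← hvq]

lemma IsEMDApprox.mono {C C' : ℝ} {k : ℕ} (hk : 1 ≤ k) (hΔ0 : 0 < Δ) {x xs : Pixel Δ → ℝ}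
    (hx : ∀ p, 0 ≤ x p) (H : IsEMDApprox C k x xs) (hC : C ≤ C') : IsEMDApprox C' k x xs := by
  intro x' hx'
  obtain ⟨S, hS, -, hSx⟩ := exists_centres hk hΔ0 hx'
  refine (H x' hx').trans (mul_le_mul_of_nonneg_right hC ?_)
  exact (Finset.sum_nonneg fun p _ => mul_nonneg (hx p) (centreDist_nonneg S hS p)).trans
    (sum_mul_centreDist_le_emdNorm hS x x' hSx)

/-- The number of levels that count is logarithmic in `n / k`. -/
lemma levelCount_le_log (hh : 2 ^ h ≤ 2 * Δ) {k κ : ℕ} (hk : 1 ≤ k) (hkΔ : 2 * k < Δ ^ 2)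
    (hκ : k ≤ κ) : (levelCount (2 * 4 ^ h) κ : ℝ) ≤ 9 * log ((Δ : ℝ) ^ 2 / k) := by
  have hk' : (0 : ℝ) < k := by exact_mod_cast hk
  have hΔ2 : (2 : ℝ) * k < (Δ : ℝ) ^ 2 := by exact_mod_cast hkΔ
  have hn : (2 : ℝ) ≤ (Δ : ℝ) ^ 2 / k := by
    rw [le_div_iff₀ hk']
    exact hΔ2.le
  have hL : log 2 ≤ log ((Δ : ℝ) ^ 2 / k) := log_le_log (by norm_num) hn
  have hN : (2 * 4 ^ h : ℕ) ≤ 8 * Δ ^ 2 := by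
    have := Nat.pow_le_pow_left hh 2
    rw [← pow_mul, mul_comm h 2, pow_mul] at this
    norm_num at this
    nlinarith
  have h2 := Real.log_two_gt_d9
  have key : (Nat.log 2 (2 * 4 ^ h / κ) : ℝ) * log 2 ≤ 3 * log 2 + log ((Δ : ℝ) ^ 2 / k) := by
    rcases Nat.eq_zero_or_pos (2 * 4 ^ h / κ) with h0 | h0
    · rw [h0, Nat.log_zero_right]
      push_cast
      linarith
    · have h1 : 2 ^ Nat.log 2 (2 * 4 ^ h / κ) ≤ 2 * 4 ^ h / κ := Nat.pow_log_le_self 2 h0.ne'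
      have h3 : ((2 * 4 ^ h / κ : ℕ) : ℝ) ≤ 8 * ((Δ : ℝ) ^ 2 / k) := by
        refine Nat.cast_div_le.trans ?_
        rw [← mul_div_assoc]
        refine div_le_div₀ (by positivity) ?_ hk' (by exact_mod_cast hκ)
        exact_mod_cast hN
      have h4 : (2 : ℝ) ^ Nat.log 2 (2 * 4 ^ h / κ) ≤ 2 ^ 3 * ((Δ : ℝ) ^ 2 / k) := by
        refine le_trans ?_ (h3.trans (by norm_num))
        exact_mod_cast h1
      have h5 := log_le_log (by positivity) h4
      rw [log_mul (by positivity) (by positivity), log_pow, log_pow] at h5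
      exact_mod_cast h5
  rw [levelCount]
  push_cast
  nlinarith

/-- The number of iterations is logarithmic. -/
lemma clog_le_of_abs_le (hΔ : Δ ≤ 2 ^ h) (hΔ2 : 2 ≤ Δ) (hh : 2 ^ h ≤ 2 * Δ) {m a : ℕ} {b : ℕ → ℝ}
    (hb : ∀ r < m, |b r| ≤ ((Δ : ℝ) ^ 2) ^ a) :
    Nat.clog 2 ⌈(1 + (∑ r ∈ Finset.range m, b r * b r) / m)
      * (((2 * 4 ^ h : ℕ) : ℝ) * ((2 * 4 ^ h : ℕ) : ℝ))⌉₊ ≤ 2 * h * (2 * a + 6) := by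
  have hΔ' : (2 : ℝ) ≤ Δ := by exact_mod_cast hΔ2
  set n : ℝ := (Δ : ℝ) ^ 2 with hn
  have hn4 : 4 ≤ n := by nlinarith
  have hsum : (∑ r ∈ Finset.range m, b r * b r) / m ≤ n ^ (2 * a) := by
    refine div_le_of_le_mul₀ (Nat.cast_nonneg _) (by positivity) ?_
    refine (Finset.sum_le_card_nsmul _ _ (n ^ (2 * a)) fun r hr => ?_).trans ?_
    · rw [← abs_mul_abs_self, mul_comm 2 a, pow_mul, sq]
      have := hb r (Finset.mem_range.mp hr)
      exact mul_le_mul this this (abs_nonneg _) (by positivity)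
    · rw [Finset.card_range, nsmul_eq_mul, mul_comm]
  have hN : ((2 * 4 ^ h : ℕ) : ℝ) ≤ 8 * n := by
    have := Nat.pow_le_pow_left hh 2
    rw [← pow_mul, mul_comm h 2, pow_mul] at this
    norm_num at this
    have h2 : 2 * 4 ^ h ≤ 8 * Δ ^ 2 := by nlinarith
    rw [hn]
    exact_mod_cast h2
  have hn1 : 1 ≤ n ^ (2 * a) := one_le_pow₀ (by linarith)
  have h3 : (1 + (∑ r ∈ Finset.range m, b r * b r) / m)
      * (((2 * 4 ^ h : ℕ) : ℝ) * ((2 * 4 ^ h : ℕ) : ℝ)) ≤ n ^ (2 * a + 6) := by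
    calc _ ≤ 2 * n ^ (2 * a) * (8 * n * (8 * n)) := by
          refine mul_le_mul (by linarith) (mul_le_mul hN hN (by positivity) (by positivity))
            (by positivity) (by positivity)
      _ = 128 * (n ^ (2 * a) * n ^ 2) := by ring
      _ ≤ n ^ 4 * (n ^ (2 * a) * n ^ 2) := by
          refine mul_le_mul_of_nonneg_right ?_ (by positivity)
          calc (128 : ℝ) ≤ 4 ^ 4 := by norm_num
            _ ≤ n ^ 4 := pow_le_pow_left₀ (by norm_num) hn4 4
      _ = n ^ (2 * a + 6) := by ring
  have h4 : ⌈(1 + (∑ r ∈ Finset.range m, b r * b r) / m)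
      * (((2 * 4 ^ h : ℕ) : ℝ) * ((2 * 4 ^ h : ℕ) : ℝ))⌉₊ ≤ 2 ^ (2 * h * (2 * a + 6)) := by
    refine Nat.ceil_le.mpr (h3.trans ?_)
    have : (Δ ^ 2) ^ (2 * a + 6) ≤ 2 ^ (2 * h * (2 * a + 6)) := by
      rw [pow_mul, mul_comm 2 h, pow_mul]
      exact Nat.pow_le_pow_left (Nat.pow_le_pow_left hΔ 2) _
    rw [hn]
    exact_mod_cast this
  exact (Nat.clog_mono_right 2 h4).trans (Nat.clog_pow 2 _ (by norm_num)).le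

lemma natCeil_one_div_le {ε : ℝ} (hε : 0 < ε) (hε1 : ε ≤ 1) : (⌈1 / ε⌉₊ : ℝ) ≤ 2 / ε := by
  have h1 : 1 ≤ 1 / ε := by rwa [le_div_iff₀ hε, one_mul]
  have h2 := Nat.ceil_lt_add_one (show 0 ≤ 1 / ε by linarith)
  calc (⌈1 / ε⌉₊ : ℝ) ≤ 1 / ε + 1 / ε := by linarith
    _ = 2 / ε := by ring

lemma abs_sketch_le {A : ℤ} {m : ℕ} {M : Matrix (Fin m) (Pixel Δ) ℤ} (hM : ∀ r p, |M r p| ≤ A)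
    {x : Pixel Δ → ℝ} {X : ℝ} (hx : ∀ p, |x p| ≤ X) (r : Fin m) :
    |sketch M x r| ≤ (Δ : ℝ) ^ 2 * (A * X) := by
  rw [sketch, Matrix.mulVec, dotProduct]
  refine (Finset.abs_sum_le_sum_abs _ _).trans ?_
  refine (Finset.sum_le_card_nsmul _ _ ((A : ℝ) * X) fun p _ => ?_).trans (le_of_eq ?_)
  · rw [abs_mul, Matrix.map_apply]
    have h1 : |(M r p : ℝ)| ≤ A := by exact_mod_cast hM r p
    exact mul_le_mul h1 (hx p) (abs_nonneg _) ((abs_nonneg _).trans h1)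
  · simp [sq]

/-- The number of nodes of the trees is of the order of the number of measurements. -/
lemma natCast_treeBudget_le (hh : 2 ^ h ≤ 2 * Δ) {k : ℕ} (hk : 1 ≤ k) (hkΔ : 2 * k < Δ ^ 2) {ε : ℝ}
    (hε : 0 < ε) (hε1 : ε ≤ 1) :
    ((28 * (k * ⌈1 / ε⌉₊ ^ 2) * levelCount (2 * 4 ^ h) (k * ⌈1 / ε⌉₊ ^ 2) : ℕ) : ℝ)
      ≤ 1008 * (1 / ε ^ 2 * k * log ((Δ : ℝ) ^ 2 / k)) := by
  have hρ : 1 ≤ ⌈1 / ε⌉₊ := Nat.one_le_iff_ne_zero.mpr (Nat.ceil_pos.mpr (by positivity)).ne'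
  have hD := levelCount_le_log hh hk hkΔ (Nat.le_mul_of_pos_right k (pow_pos hρ 2))
  have hκ : ((k * ⌈1 / ε⌉₊ ^ 2 : ℕ) : ℝ) ≤ 4 * (1 / ε ^ 2 * k) := by
    push_cast
    calc (k : ℝ) * (⌈1 / ε⌉₊ : ℝ) ^ 2 ≤ k * (2 / ε) ^ 2 := by
          refine mul_le_mul_of_nonneg_left ?_ (Nat.cast_nonneg _)
          exact pow_le_pow_left₀ (Nat.cast_nonneg _) (natCeil_one_div_le hε hε1) 2
      _ = _ := by ring
  rw [Nat.cast_mul, Nat.cast_mul]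
  calc _ ≤ ((28 : ℕ) : ℝ) * (4 * (1 / ε ^ 2 * k)) * (9 * log ((Δ : ℝ) ^ 2 / k)) :=
        mul_le_mul (mul_le_mul_of_nonneg_left hκ (by norm_num)) hD (Nat.cast_nonneg _)
          (by positivity)
    _ = _ := by push_cast; ring

lemma two_mul_four_pow_le (hh : 2 ^ h ≤ 2 * Δ) : 2 * 4 ^ h ≤ 8 * (Δ * Δ) := by
  have := Nat.pow_le_pow_left hh 2
  rw [← pow_mul, mul_comm h 2, pow_mul] at this
  norm_num at this
  nlinarith

lemma abs_measurementMatrix_le_pow (hΔ2 : 2 ≤ Δ) (hh : 2 ^ h ≤ 2 * Δ) {B : ℕ → ℕ → ℤ}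
    (hB : ∀ r v, |B r v| ≤ 1) (m₀ m : ℕ) (r : Fin m) (p : Pixel Δ) :
    |measurementMatrix Δ h m₀ B m r p| ≤ ((Δ : ℤ) ^ 2) ^ 4 := by
  refine (abs_measurementMatrix_le hB m₀ m r p).trans ?_
  have h1 : 2 * 4 ^ h * 2 ^ h ≤ 8 * (Δ * Δ) * (2 * Δ) :=
    Nat.mul_le_mul (two_mul_four_pow_le hh) hh
  have h2 : 8 * (Δ * Δ) * (2 * Δ) ≤ (Δ ^ 2) ^ 4 := by
    calc 8 * (Δ * Δ) * (2 * Δ) = 2 ^ 4 * Δ ^ 3 := by ring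
      _ ≤ Δ ^ 4 * Δ ^ 3 := Nat.mul_le_mul_right _ (Nat.pow_le_pow_left hΔ2 4)
      _ = Δ ^ 7 := by ring
      _ ≤ Δ ^ 8 := Nat.pow_le_pow_right (by omega) (by norm_num)
      _ = (Δ ^ 2) ^ 4 := by ring
  exact_mod_cast h1.trans h2

lemma one_le_log_sq (hΔ2 : 2 ≤ Δ) : 1 ≤ log ((Δ : ℝ) ^ 2) := by
  have hΔ' : (2 : ℝ) ≤ Δ := by exact_mod_cast hΔ2
  rw [log_pow]
  have h1 := log_le_log (by norm_num) hΔ'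
  have h2 := Real.log_two_gt_d9
  push_cast
  linarith

lemma natCast_height_le (hΔ2 : 2 ≤ Δ) (hh : 2 ^ h ≤ 2 * Δ) : (h : ℝ) ≤ 2 * log ((Δ : ℝ) ^ 2) := by
  have hΔ' : (2 : ℝ) ≤ Δ := by exact_mod_cast hΔ2
  have h1 := log_le_log (by norm_num) hΔ'
  have h2 := Real.log_two_gt_d9
  have h3 : (2 : ℝ) ^ h ≤ 2 * Δ := by exact_mod_cast hh
  have h4 := log_le_log (by positivity) h3
  rw [log_pow, log_mul (by norm_num) (by positivity)] at h4
  rw [log_pow]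
  push_cast
  nlinarith [(Nat.cast_nonneg h : (0 : ℝ) ≤ h)]

/-- The running time in terms of `K = ε⁻² * k`, `L = log n` and `n`. -/
lemma recovery_time_le {N s c J a : ℕ} {K L n : ℝ} (hL : 0 ≤ L) (hN : (N : ℝ) ≤ 8 * n)
    (hJ : (J : ℝ) + 1 ≤ (8 * a + 65) * L) (hs : (s : ℝ) + 1 ≤ 2016 * (K * L)) :
    ((3000 * (N * ((J + 1) * ((c + 1) * (s + 1) ^ 2))) : ℕ) : ℝ)
      ≤ 3000 * 8 * (8 * a + 65) * (c + 1) * 2016 ^ 2 * K ^ 2 * n * L ^ 3 := by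
  push_cast
  have hn : 0 ≤ 8 * n := (Nat.cast_nonneg _).trans hN
  calc (3000 : ℝ) * (N * ((J + 1) * ((c + 1) * (s + 1) ^ 2)))
      ≤ 3000 * (8 * n * (((8 * a + 65) * L) * ((c + 1) * (2016 * (K * L)) ^ 2))) := by
        gcongr
    _ = _ := by ring

/-! ### Recovery by the program from the sketch -/

/-- The program recovers images with natural numbers as entries from their sketches. -/
lemma exec_recoveryProg_measurementMatrix {c : ℕ} (hc : 0 < c) (hΔ2 : 2 ≤ Δ)
    (hh : h = Nat.clog 2 Δ) (hh2 : 2 ^ h ≤ 2 * Δ) {k ρ s : ℕ} (hρ : 1 ≤ ρ) (hk : 1 ≤ k)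
    (hs : s = 28 * (k * ρ ^ 2) * levelCount (2 * 4 ^ h) (k * ρ ^ 2)) {B : ℕ → ℕ → ℤ}
    (hB1 : ∀ r v, |B r v| ≤ 1) (hB : TreeIsometry (3 * c * s) (2 * 4 ^ h) (3 * s) B) {ε : ℝ} {a : ℕ}
    {x : Pixel Δ → ℕ} (hx : ∀ p, x p ≤ (Δ ^ 2) ^ a) :
    ∃ J ≤ h * (4 * a + 32), Exec (recoveryProg c)
      (inputStore k ε (measurementMatrix Δ h (3 * c * s) B (27 * c * s))
        (sketch (measurementMatrix Δ h (3 * c * s) B (27 * c * s)) fun p => (x p : ℝ)))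
      (3000 * (2 * 4 ^ h * ((J + 1) * ((c + 1) * (s + 1) ^ 2)))) fun σ =>
        IsEMDApprox (2500 * √(levelCount (2 * 4 ^ h) (k * ρ ^ 2)) / ρ) k (fun p => (x p : ℝ))
          (outputVector Δ σ) := by
  have hΔ : Δ ≤ 2 ^ h := hh ▸ Nat.le_pow_clog (by norm_num) _
  have hκ : 1 ≤ k * ρ ^ 2 := Nat.mul_pos hk (pow_pos hρ 2)
  have hs1 : 1 ≤ s := by
    rw [hs]
    exact Nat.mul_pos (Nat.mul_pos (by norm_num) hκ) (levelCount_pos _ _)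
  have hm0 : 1 ≤ 3 * c * s := Nat.mul_pos (Nat.mul_pos (by norm_num) hc) hs1
  set A := measurementMatrix Δ h (3 * c * s) B (27 * c * s) with hA
  set b : ℕ → ℝ := toArray (sketch A fun p => (x p : ℝ)) with hb
  have hrow : ∀ r < 3 * c * s, r < 27 * c * s := fun r hr =>
    hr.trans_le (Nat.mul_le_mul_right _ (Nat.mul_le_mul_right _ (by norm_num)))
  have hbB : ∀ r < 3 * c * s, b r
      = measure (2 * 4 ^ h) B (weightedMass h fun p => (x p : ℝ)) r := fun r hr =>
    sketch_measurementMatrix _ _ B _ hr (hrow r hr)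
  have hb_le : ∀ r < 3 * c * s, |b r| ≤ ((Δ : ℝ) ^ 2) ^ (a + 5) := by
    intro r hr
    rw [hb, toArray, dif_pos (hrow r hr)]
    refine (abs_sketch_le (abs_measurementMatrix_le_pow hΔ2 hh2 hB1 _ _)
      (X := ((Δ : ℝ) ^ 2) ^ a) (fun p => ?_) _).trans (le_of_eq ?_)
    · rw [abs_of_nonneg (Nat.cast_nonneg _)]
      exact_mod_cast hx p
    · push_cast
      ring
  refine ⟨_, (clog_le_of_abs_le hΔ hΔ2 hh2 hb_le).trans (le_of_eq (by ring)),
    (exec_recoveryProg hc hh rfl rfl rfl rfl (fun a ha => funext fun i => if_neg ha)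
      (fun a ha => funext fun i => ?_) rfl
      (fun r hr v hv => inputStore_measurementMatrix _ B (by ring) _ (two_mul_four_pow_le hh2) hr hv)
      rfl (P := IsIterateFor (2 * 4 ^ h) s (3 * c * s) B b) ?_ ?_).mono le_rfl ?_⟩
  · simp only [inputStore]
    rw [if_neg (by omega), if_neg (by omega), if_neg (by omega)]
    rfl
  · intro T u e _ _ _ _
    exact isIterate_zero _ _ u (norm_nonneg e)
  · intro i z z' hz hstep T u e hT hTs hu hbu
    exact (hz T u e hT hTs hu hbu).step hm0 hB hT hTs hu hbu hstep
  · rintro σ' ⟨z, y, Y, rep, hP, H⟩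
    exact H.isEMDApprox hΔ (by omega) hρ hk hs hB hbB rfl hP

end

end EMDRecovery

open EMDRecovery in
theorem mainTheorem4 :
    ∃ (prog : EMDRecovery.Prog) (C₁ C₂ : ℝ) (c d : ℕ) (T : ℕ → ℝ),
      ∀ (Δ k : ℕ) (ε : ℝ), 1 ≤ k → 2 * k < Δ ^ 2 → 0 < ε → ε ≤ 1 →
        ∃ (m : ℕ) (A : Matrix (Fin m) (EMDRecovery.Pixel Δ) ℤ),
          -- number of measurements
          (m : ℝ) ≤ C₁ * (1 / ε ^ 2) * k * Real.log ((Δ : ℝ) ^ 2 / k) ∧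
          -- bounded precision of the matrix
          (∀ r p, |A r p| ≤ ((Δ : ℤ) ^ 2) ^ d) ∧
          -- recovery of every non-negative real vector from its sketch
          (∃ R : (Fin m → ℝ) → (EMDRecovery.Pixel Δ → ℝ),
            ∀ x : EMDRecovery.Pixel Δ → ℝ, (∀ p, 0 ≤ x p) →
              EMDRecovery.IsEMDApprox (C₂ * (ε * Real.sqrt (Real.log ((Δ : ℝ) ^ 2 / k)))) k x
                (R (EMDRecovery.sketch A x))) ∧
          -- running time of the recovery for polynomially bounded integer coefficients
          (∀ (a : ℕ) (x : EMDRecovery.Pixel Δ → ℕ), (∀ p, x p ≤ (Δ ^ 2) ^ a) →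
            ∃ (t : ℕ) (s : EMDRecovery.Store),
              EMDRecovery.Runs prog
                (EMDRecovery.inputStore k ε A (EMDRecovery.sketch A (fun p => (x p : ℝ)))) t s ∧
              (t : ℝ) ≤ T a * ((1 / ε ^ 2) * k) ^ 2 * (Δ : ℝ) ^ 2
                * Real.log ((Δ : ℝ) ^ 2) ^ c ∧
              EMDRecovery.IsEMDApprox (C₂ * (ε * Real.sqrt (Real.log ((Δ : ℝ) ^ 2 / k)))) k
                (fun p => (x p : ℝ)) (EMDRecovery.outputVector Δ s)) := by
  obtain ⟨c, hc, hB⟩ := exists_treeIsometry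
  refine ⟨recoveryProg c, 27216 * c, 7500, 3, 4,
    fun a => 3000 * 8 * (8 * a + 65) * (c + 1) * 2016 ^ 2, fun Δ k ε hk hkΔ hε hε1 => ?_⟩
  have hΔ2 : 2 ≤ Δ := by
    by_contra hlt
    have : Δ ^ 2 ≤ 1 ^ 2 := Nat.pow_le_pow_left (by omega) 2
    omega
  obtain ⟨h, hh⟩ : ∃ h, h = Nat.clog 2 Δ := ⟨_, rfl⟩
  have hΔ : Δ ≤ 2 ^ h := hh ▸ Nat.le_pow_clog (by norm_num) _
  have hh2 : 2 ^ h ≤ 2 * Δ := by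
    have h0 : 1 ≤ h := hh ▸ Nat.clog_pos (by norm_num) hΔ2
    have h1 : 2 ^ (h - 1) < Δ := by
      rw [hh]
      exact Nat.pow_pred_clog_lt_self (by norm_num) hΔ2
    have h2 : 2 ^ h = 2 * 2 ^ (h - 1) := by rw [← pow_succ', Nat.sub_add_cancel h0]
    omega
  obtain ⟨ρ, hρε⟩ : ∃ ρ, ρ = ⌈1 / ε⌉₊ := ⟨_, rfl⟩
  have hρ : 1 ≤ ρ := hρε ▸ Nat.one_le_iff_ne_zero.mpr (Nat.ceil_pos.mpr (by positivity)).ne'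
  have hκ : 1 ≤ k * ρ ^ 2 := Nat.mul_pos hk (pow_pos hρ 2)
  obtain ⟨s, hs⟩ : ∃ s, s = 28 * (k * ρ ^ 2) * levelCount (2 * 4 ^ h) (k * ρ ^ 2) := ⟨_, rfl⟩
  have hs1 : 1 ≤ s := by
    rw [hs]
    exact Nat.mul_pos (Nat.mul_pos (by norm_num) hκ) (levelCount_pos _ _)
  have hs_le : (s : ℝ) ≤ 1008 * (1 / ε ^ 2 * k * Real.log ((Δ : ℝ) ^ 2 / k)) := by
    rw [hs, hρε]
    exact natCast_treeBudget_le hh2 hk hkΔ hε hε1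
  obtain ⟨B, hB1, hB⟩ := hB (2 * 4 ^ h) (3 * s) (by omega)
  rw [show c * (3 * s) = 3 * c * s by ring] at hB
  -- the factor of the approximation in terms of `ε`
  have hfactor : 2500 * √(levelCount (2 * 4 ^ h) (k * ρ ^ 2)) / ρ
      ≤ 7500 * (ε * √(Real.log ((Δ : ℝ) ^ 2 / k))) := by
    have hD := levelCount_le_log hh2 hk hkΔ (Nat.le_mul_of_pos_right k (pow_pos hρ 2))
    have h1 : √(levelCount (2 * 4 ^ h) (k * ρ ^ 2)) ≤ 3 * √(Real.log ((Δ : ℝ) ^ 2 / k)) := by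
      refine (Real.sqrt_le_sqrt hD).trans (le_of_eq ?_)
      rw [Real.sqrt_mul (by norm_num), show (9 : ℝ) = 3 ^ 2 by norm_num,
        Real.sqrt_sq (by norm_num)]
    have h2 : (1 : ℝ) / ρ ≤ ε := by
      rw [one_div_le (by exact_mod_cast hρ) hε, hρε]
      exact Nat.le_ceil _
    calc _ = 2500 * (1 / (ρ : ℝ) * √(levelCount (2 * 4 ^ h) (k * ρ ^ 2))) := by ring
      _ ≤ 2500 * (ε * (3 * √(Real.log ((Δ : ℝ) ^ 2 / k)))) := by gcongr
      _ = _ := by ring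
  refine ⟨27 * c * s, measurementMatrix Δ h (3 * c * s) B (27 * c * s), ?_, fun r p =>
    abs_measurementMatrix_le_pow hΔ2 hh2 hB1 _ _ r p, ?_, fun a x hx => ?_⟩
  · push_cast
    calc (27 : ℝ) * c * s
        ≤ 27 * c * (1008 * (1 / ε ^ 2 * k * Real.log ((Δ : ℝ) ^ 2 / k))) :=
          mul_le_mul_of_nonneg_left hs_le (by positivity)
      _ = _ := by ring
  · obtain ⟨R, hR⟩ := exists_leastSquares_recovery hΔ (by omega) hρ hk hs hB
    refine ⟨fun b => R (toArray b), fun x hx => (hR x hx _ fun r hr => ?_).mono hk (by omega) hx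
      hfactor⟩
    exact sketch_measurementMatrix _ _ B x hr
      (hr.trans_le (Nat.mul_le_mul_right _ (Nat.mul_le_mul_right _ (by norm_num))))
  · obtain ⟨J, hJ, t, σ, hrun, ht, happrox⟩ := exec_recoveryProg_measurementMatrix (ε := ε) hc hΔ2
      hh hh2 hρ hk hs hB1 hB hx
    refine ⟨t, σ, hrun, ?_, happrox.mono hk (by omega) (fun p => Nat.cast_nonneg _) hfactor⟩
    have hL := one_le_log_sq hΔ2
    have hk' : (1 : ℝ) ≤ k := by exact_mod_cast hk
    have hlog : Real.log ((Δ : ℝ) ^ 2 / k) ≤ Real.log ((Δ : ℝ) ^ 2) := by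
      refine Real.log_le_log (by positivity) (div_le_self (by positivity) hk')
    refine (Nat.cast_le.mpr ht).trans (recovery_time_le (by linarith) ?_ ?_ ?_)
    · have := two_mul_four_pow_le hh2
      rw [← sq] at this
      exact_mod_cast this
    · have h1 : (J : ℝ) ≤ h * (4 * a + 32) := by exact_mod_cast hJ
      have h2 := mul_le_mul_of_nonneg_right (natCast_height_le hΔ2 hh2)
        (show (0 : ℝ) ≤ 4 * a + 32 by positivity)
      linarith
    · have h1 : (1 : ℝ) ≤ s := by exact_mod_cast hs1
      have h2 : 1 / ε ^ 2 * k * Real.log ((Δ : ℝ) ^ 2 / k)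
          ≤ 1 / ε ^ 2 * k * Real.log ((Δ : ℝ) ^ 2) :=
        mul_le_mul_of_nonneg_left hlog (by positivity)
      linarith
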